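/- **Setting.** A (multistage) job type has a finite set $S$ of stages, with an initial stage and a final stage $z$, and transition probabilities $p_{ij}$ forming an acyclic Markov chain absorbed at $z$. Each stage $i\neq z$ has a size distribution on $(0,\infty)$ with a density $f_i$, tail $\overline F_i$, hazard rate $h_i=f_i/\overline F_i$ and finite mean. A job state is a pair $(i,x)$, with $i$ the stage in progress and $x$ its age; if $i\ne z$ it is required that $x\ge 0$ and $\overline F_i(x)>0$. While a job in state $(i,x)$ is served, its age grows at rate $1$ and it jumps to $(j,0)$ at rate $p_{ij}h_i(x)$; it leaves the system on entering stage $z$. *Single-job profit.* For $r>0$ let $$V_{(i,x)}(r)=\sup_\pi\bigl(r\,\mathbf P\{\pi\text{ completes the job}\}-\mathbf E[\text{time }\pi\text{ serves the job}]\bigr),$$ for a job started in state $(i,x)$, where $\pi$ ranges over stopping policies, which give up on stage $j$ after serving it for a time $\pi(j)\in[0,\infty]$. *BPOP A and BPOP P.* A system state is a list of $n$ job states. There are no arrivals. At every moment a preemptive, non-anticipating policy spends its whole effort (possibly split, as in processor sharing) on the jobs in the system until the system is empty. In BPOP P, jobs can only be served; cost is paid at rate $N-1$ while $N\ge 1$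 jobs are in the system (so it is the total queueing time). In BPOP A with parameter $r>0$, jobs can also be bypassed, a bypassed job leaving at rate $1/r$; cost is paid at rate $1$ until the system is empty. The cost functions $P$ and $A_r$ map a system state to the minimal expected cost, that is, the infimum over policies. **Proposition.** 1. For every job state $(i,x)$ and $r>0$, $A_r(i,x)=r-V_{(i,x)}(r)$, and $r\mapsto A_r(i,x)$ is differentiable at almost every $r>0$. 2. For every $n\ge 0$ and every system state $((i_1,x_1),\dots,(i_n,x_n))$, the cost function of BPOP P is $$P\bigl((i_1,x_1),\dots,(i_n,x_n)\bigr)=\sum_{k<\ell}\int_0^\infty \frac{d}{dr}A_r(i_k,x_k)\cdot\frac{d}{dr}A_r(i_\ell,x_\ell)\,dr ,$$ and the integrals are finite. 3. For every job state $(i,x)$ there is exactly one law of a nonnegative random variable $R_{(i,x)}$ (the *prevailing index*) with $\mathbf P\{R_{(i,x)}>r\}=\frac{d}{dr}A_r(i,x)$ at every $r>0$ where the derivative exists. For any two job states and independent $R_{(i,x)}$, $R_{(j,y)}$, the variable $\min\{R_{(i,x)},R_{(j,y)}\}$ is integrable and $$\int_0^\infty \frac{d}{dr}A_r(i,x)\cdot\frac{d}{dr}A_r(j,y)\,dr=\mathbf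 E\bigl[\min\{R_{(i,x)},R_{(j,y)}\}\bigr].$$ -/

import Mathlib

open MeasureTheory ProbabilityTheory Set
open scoped ENNReal

noncomputable section

namespace Multistage

/-- A multistage job type with finite set of stages `S`.  A stage `i ≠ fin` has a size
distribution on `(0, ∞)` with density `density i` and finite mean; on completing it, the job moves to
stage `j` with probability `trans i j`.  The stages form an acyclic Markov chain which is absorbed
at `fin` (acyclicity and finiteness make `fin` accessible from every stage).  The final stage
has size `0`, so nothing is asked of `density fin`. -/
structure JobType (S : Type*) [Fintype S] where
  init : S
  fin : S
  trans : S → S → ℝ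
  trans_nonneg : ∀ i j, 0 ≤ trans i j
  trans_sum : ∀ i, ∑ j, trans i j = 1
  trans_fin : trans fin fin = 1
  acyclic : ∀ i, ¬ Relation.TransGen (fun a b => a ≠ fin ∧ 0 < trans a b) i i
  density : S → ℝ → ℝ
  density_measurable : ∀ i, i ≠ fin → Measurable (density i)
  density_nonneg : ∀ i, i ≠ fin → ∀ t, 0 ≤ density i t
  density_integral : ∀ i, i ≠ fin → ∫ t in Ioi 0, density i t = 1
  finite_mean : ∀ i, i ≠ fin → IntegrableOn (fun t => t * density i t) (Ioi 0)

/-- The state of a job: the stage in progress and the age of that stage. -/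
abbrev JobState (S : Type*) := S × ℝ

/-- A system state: a list of `n` job states. -/
abbrev SysState (S : Type*) (n : ℕ) := Fin n → JobState S

/-- A (deterministic, history-dependent, preemptive) scheduling policy for `n` jobs.

Between two consecutive jumps of the system nothing random is observed, so a policy is described by
what it does after each history of jumps.  A history is the list `e` of the jumps so far, oldest
first, a jump `(k, j)` being "job `k` enters stage `j`", together with the times `t` elapsed
between consecutive jumps.  After this history and a further time `τ` without a jump, the
policy spends the fraction `serve e t τ k` of its effort on serving job `k` and the fraction
`bypass e t τ k` on bypassing job `k`.  Fractions other than `0` and `1` are processor sharing. -/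
structure Policy (S : Type*) (n : ℕ) where
  serve : (e : List (Fin n × S)) → (Fin e.length → ℝ) → ℝ → Fin n → ℝ
  bypass : (e : List (Fin n × S)) → (Fin e.length → ℝ) → ℝ → Fin n → ℝ

namespace Policy

variable {S : Type*} {n : ℕ}

/-- What remains of the policy after a first jump `(k, j)` at time `τ`. -/
def after (π : Policy S n) (k : Fin n) (j : S) (τ : ℝ) : Policy S n where
  serve e t := π.serve ((k, j) :: e) (Fin.cons τ t)
  bypass e t := π.bypass ((k, j) :: e) (Fin.cons τ t)

/-- Effort spent on serving job `k` at time `t`, when there has been no jump so far. -/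
def serveNow (π : Policy S n) (t : ℝ) (k : Fin n) : ℝ := π.serve [] Fin.elim0 t k

/-- Effort spent on bypassing job `k` at time `t`, when there has been no jump so far. -/
def bypassNow (π : Policy S n) (t : ℝ) (k : Fin n) : ℝ := π.bypass [] Fin.elim0 t k

/-- Service received by job `k` up to time `t`, when there has been no jump so far. -/
def served (π : Policy S n) (t : ℝ) (k : Fin n) : ℝ := ∫ τ in (0 : ℝ)..t, π.serveNow τ k

end Policy

/-- The stages of the jobs after the list `e` of jumps, starting from the stages `σ`. -/
def stagesAfter {S : Type*} {n : ℕ} (σ : Fin n → S) (e : List (Fin n × S)) : Fin n → S :=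
  e.foldl (fun σ p => Function.update σ p.1 p.2) σ

namespace JobType

variable {S : Type*} [Fintype S] [DecidableEq S] (J : JobType S)

/-- `P(X_i > x)`, for `x ≥ 0` and `i ≠ fin`. -/
def tail (i : S) (x : ℝ) : ℝ := ∫ t in Ioi x, J.density i t

/-- Hazard rate of the size of stage `i` at age `x`. -/
def hazard (i : S) (x : ℝ) : ℝ := J.density i x / J.tail i x

/-- The states a job can be in: an age has to be one that the stage can reach. -/
def Valid (p : JobState S) : Prop := p.1 ≠ J.fin → 0 ≤ p.2 ∧ 0 < J.tail p.1 p.2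

/-! ### Single-job profit -/

/-- For a job started in state `(i, x)`, the probability that it completes after at most `m`
stage transitions and before giving up.  The stopping policy `c` gives up on a stage `j`
when it has been served for time `c j` (for the first stage: counted from the start). -/
def completionProbUpTo (c : S → ℝ≥0∞) : ℕ → S → ℝ → ℝ≥0∞
  | 0, i, _ => if i = J.fin then 1 else 0
  | m + 1, i, x => if i = J.fin then 1 else
      (∫⁻ t in {t : ℝ | 0 < t ∧ ENNReal.ofReal t < c i},
          ENNReal.ofReal (J.density i (x + t) / J.tail i x)) *
        ∑ j, ENNReal.ofReal (J.trans i j) * completionProbUpTo c m j 0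

/-- For a job started in state `(i, x)`, the expected time that it is served under the stopping
policy `c` during its first `m` stages. -/
def serviceTimeUpTo (c : S → ℝ≥0∞) : ℕ → S → ℝ → ℝ≥0∞
  | 0, _, _ => 0
  | m + 1, i, x => if i = J.fin then 0 else
      (∫⁻ t in {t : ℝ | 0 < t ∧ ENNReal.ofReal t < c i},
          ENNReal.ofReal (J.tail i (x + t) / J.tail i x)) +
        (∫⁻ t in {t : ℝ | 0 < t ∧ ENNReal.ofReal t < c i},
          ENNReal.ofReal (J.density i (x + t) / J.tail i x)) *
        ∑ j, ENNReal.ofReal (J.trans i j) * serviceTimeUpTo c m j 0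

/-- Probability that the stopping policy `c` completes a job started in state `p`. -/
def completionProb (c : S → ℝ≥0∞) (p : JobState S) : ℝ≥0∞ :=
  ⨆ m, J.completionProbUpTo c m p.1 p.2

/-- Expected time that the stopping policy `c` serves a job started in state `p`. -/
def serviceTime (c : S → ℝ≥0∞) (p : JobState S) : ℝ≥0∞ :=
  ⨆ m, J.serviceTimeUpTo c m p.1 p.2

/-- The SJP function `V_p(r)`: the optimal expected profit for a job in state `p` and reward `r`. -/
def profit (p : JobState S) (r : ℝ) : ℝ :=
  ⨆ c : S → ℝ≥0∞, (r * (J.completionProb c p).toReal - (J.serviceTime c p).toReal)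

/-! ### Busy period optimization problems without arrivals

The system is a controlled piecewise-deterministic Markov process.  While a policy spends effort
`u k` on serving and `b k` on bypassing job `k`, the age of job `k` grows at rate `u k`, job `k` jumps
from state `(i, x)` to `(j, 0)` at rate `u k * trans i j * hazard i x`, and it jumps to `(fin, 0)` at
the additional rate `b k / r`.  A job in stage `fin` has left the system. -/

variable {n : ℕ}

/-- Number of jobs in the system. -/
def numJobs (s : SysState S n) : ℕ := (Finset.univ.filter fun k => (s k).1 ≠ J.fin).card

/-- Admissible policies from system state `s`: at every time the whole effort is spent on jobs that
are in the system, as long as there are any. -/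
structure Admissible (s : SysState S n) (π : Policy S n) : Prop where
  measurable_serve : ∀ e k,
    Measurable fun q : (Fin e.length → ℝ) × ℝ => π.serve e q.1 q.2 k
  measurable_bypass : ∀ e k,
    Measurable fun q : (Fin e.length → ℝ) × ℝ => π.bypass e q.1 q.2 k
  serve_nonneg : ∀ e t τ k, 0 ≤ π.serve e t τ k
  bypass_nonneg : ∀ e t τ k, 0 ≤ π.bypass e t τ k
  present : ∀ e t τ k, stagesAfter (fun l => (s l).1) e k = J.fin →
    π.serve e t τ k = 0 ∧ π.bypass e t τ k = 0
  total : ∀ e t τ, (∃ k, stagesAfter (fun l => (s l).1) e k ≠ J.fin) →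
    ∑ k, (π.serve e t τ k + π.bypass e t τ k) = 1

/-- Probability that there is no jump up to time `t`. -/
def survival (r : ℝ) (s : SysState S n) (π : Policy S n) (t : ℝ) : ℝ :=
  (∏ k, if (s k).1 = J.fin then 1 else
      J.tail (s k).1 ((s k).2 + π.served t k) / J.tail (s k).1 (s k).2) *
    Real.exp (-((∫ τ in (0 : ℝ)..t, ∑ k, π.bypassNow τ k) / r))

/-- Rate at time `t`, when there has been no jump so far, of the jump of job `k` to stage `j`. -/
def jumpRate (r : ℝ) (s : SysState S n) (π : Policy S n) (t : ℝ) (k : Fin n) (j : S) : ℝ :=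
  π.serveNow t k * (J.trans (s k).1 j * J.hazard (s k).1 ((s k).2 + π.served t k)) +
    if j = J.fin then π.bypassNow t k / r else 0

/-- System state just after the first jump, if it occurs at time `t` and brings job `k` to
stage `j`. -/
def stateAfter (s : SysState S n) (π : Policy S n) (t : ℝ) (k : Fin n) (j : S) : SysState S n :=
  Function.update (fun l => ((s l).1, (s l).2 + π.served t l)) k (j, 0)

/-- Expected cost of the policy `π` from state `s` that is paid before the `m`-th jump, when cost
is paid at rate `c N` while there are `N` jobs in the system. -/
def costUpTo (c : ℕ → ℝ≥0∞) (r : ℝ) : ℕ → SysState S n → Policy S n → ℝ≥0∞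
  | 0, _, _ => 0
  | m + 1, s, π =>
      (∫⁻ t in Ioi (0 : ℝ), c (J.numJobs s) * ENNReal.ofReal (J.survival r s π t)) +
        ∫⁻ t in Ioi (0 : ℝ), ∑ k, ∑ j,
          ENNReal.ofReal (J.survival r s π t * J.jumpRate r s π t k j) *
            costUpTo c r m (stateAfter s π t k j) (π.after k j t)

/-- Expected cost of the policy `π` from state `s`, until the system is empty. -/
def cost (c : ℕ → ℝ≥0∞) (r : ℝ) (s : SysState S n) (π : Policy S n) : ℝ≥0∞ :=
  ⨆ m, J.costUpTo c r m s π

/-- The cost function of BPOP A with expected bypass time `r > 0`: the minimal expected time until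
the system is empty, when jobs may be served or bypassed. -/
def costA (r : ℝ) (s : SysState S n) : ℝ≥0∞ :=
  ⨅ (π : Policy S n) (_ : J.Admissible s π), J.cost (fun N => if N = 0 then 0 else 1) r s π

/-- The cost function of BPOP P: the minimal expected total queueing time, when jobs may only be
served.  The cost rate with `N` jobs is `N - 1`, and `0` in the empty system.  As nothing is
bypassed, the value `1` of the bypass time is immaterial. -/
def costP (s : SysState S n) : ℝ≥0∞ :=
  ⨅ (π : Policy S n) (_ : J.Admissible s π) (_ : ∀ e t τ k, π.bypass e t τ k = 0),
    J.cost (fun N => ((N - 1 : ℕ) : ℝ≥0∞)) 1 s π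

/-- The BPOP A cost `A_r(p)` of a single job in state `p`, as a real function of `r`. -/
def singleCostA (p : JobState S) (r : ℝ) : ℝ := (J.costA r (fun _ : Fin 1 => p)).toReal

/-- `μ` is the law of the prevailing index of a job in state `p`: the law of a nonnegative random
variable `R` with `P(R > r) = (d/dr) A_r(p)` wherever the derivative exists. -/
structure IsPrevailingLaw (p : JobState S) (μ : Measure ℝ) : Prop where
  isProbabilityMeasure : IsProbabilityMeasure μ
  nonneg : ∀ᵐ x ∂μ, 0 ≤ x
  tail_eq : ∀ r > 0, DifferentiableAt ℝ (J.singleCostA p) r →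
    μ (Ioi r) = ENNReal.ofReal (deriv (J.singleCostA p) r)

end JobType

end Multistage

end

/-!
Both cost functions are read off from the optimal cost `optCost` of a single job that may be retired
at any moment at the price `r`.  This cost is built by recursion along the acyclic stages, and as a
function of `r` it is concave, increasing, `1`-Lipschitz and bounded (`RetirementCost`).  Its right
derivative `slope` therefore decreases from `1` to `0` and is the tail of a probability measure
`RetirementCost.law`.  For a fixed `r` it is optimal to serve until the first age at which the slope is
`1` and to retire then.  The service time that this takes is `giveUp`; it increases with `r`, so that
up to this age serving is optimal for every reward `r' ≥ r` as well (`tail_mul_optCost_eq`,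
`tail_mul_slope_eq`).  That the same policies attain the single-job profit is `profit_eq`.

*Serving and bypassing one job.*  While the job is bypassed, its optimal stopping cost, at most `r`,
flows out at rate `1 / r`, hence at rate `1` at most; while it is served, the dynamic programming
inequality `tail_mul_optCost_le` applies.  So along every policy the optimal stopping cost
decreases at most by the cost paid, and it vanishes in the long run (`ofReal_optCost_le_costUpTo`).
Serving up to `giveUp` and bypassing from then on attains it (`costA_eq`).

*Lower bound for serving several jobs.*  The pairwise cost `pairCost p q = ∫ slope p r * slope q r dr`
is the average of the optimal stopping cost of `p` over the law that belongs to `q` (`pairCost_eq`).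
Averaging the dynamic programming inequality shows that serving `p` decreases `pairCost p q` at rate
`1` at most (`tail_mul_pairCost_le`).  Serving one of `N` jobs thus decreases the sum over all pairs at
rate `N - 1` at most, which is the rate at which cost is paid.  Between two jumps this becomes
`potential_sub_le_integral`; induction over the number of jumps still possible, bounded through `rank`,
gives `ofReal_totalCost_le_costUpTo`.

*Upper bound.*  Equality would hold for the policy that always serves a job whose current
giving-up level is lowest, sharing the effort between ties.  It is approximated by policies without
sharing: for the levels `0, δ, 2δ, …` in turn, serve one job after the other until it is given up at
that level, and after the last level serve the jobs to completion (`levelPolicy`).  A pair of jobs then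
costs a Riemann sum for `pairCost`, up to an error that vanishes as `δ → 0` and the last level tends to
infinity (`levelRest_le`, `costP_eq`).  Such policies are assembled from phases in which one job is
served for a prescribed time, and `costUpTo_phase_le` splits the cost of a policy after its first phase.

*The prevailing index.*  The law with tail `slope p` satisfies the defining condition.  The condition
speaks of the points of differentiability only, but these are dense and distribution functions are
right continuous, so that it determines the law (`IsPrevailingLaw.cdf_eq`).  By independence the
product of two slopes is the tail of the minimum, and the layer cake formula turns the integral of
the product into the expectation (`pairCost_eq_integral_min`).
-/

noncomputable section

namespace Multistage

open Filter Topology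
open scoped NNReal

namespace JobType

variable {S : Type*} [Fintype S] (J : JobType S)

/-! ### Tails of the stage sizes -/

variable {J} {i : S}

theorem integrableOn_density (hi : i ≠ J.fin) : IntegrableOn (J.density i) (Ioi 0) := by
  by_contra h
  have h1 := J.density_integral i hi
  rw [integral_undef h] at h1
  exact zero_ne_one h1

theorem integrableOn_density_Ioi (hi : i ≠ J.fin) {x : ℝ} (hx : 0 ≤ x) :
    IntegrableOn (J.density i) (Ioi x) :=
  (integrableOn_density hi).mono_set (Ioi_subset_Ioi hx)

theorem tail_nonneg (hi : i ≠ J.fin) (x : ℝ) : 0 ≤ J.tail i x :=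
  setIntegral_nonneg measurableSet_Ioi fun t _ => J.density_nonneg i hi t

theorem tail_zero (hi : i ≠ J.fin) : J.tail i 0 = 1 := J.density_integral i hi

theorem intervalIntegrable_density (hi : i ≠ J.fin) {x y : ℝ} (hx : 0 ≤ x) (hy : 0 ≤ y) :
    IntervalIntegrable (J.density i) volume x y := by
  rw [intervalIntegrable_iff]
  exact (integrableOn_density hi).mono_set fun t ht => lt_of_le_of_lt (le_min hx hy) ht.1

theorem tail_sub_tail (hi : i ≠ J.fin) {x y : ℝ} (hx : 0 ≤ x) (hxy : x ≤ y) :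
    J.tail i x - J.tail i y = ∫ t in x..y, J.density i t := by
  rw [intervalIntegral.integral_of_le hxy, sub_eq_iff_eq_add, tail, tail,
    ← setIntegral_union (Ioc_disjoint_Ioi le_rfl) measurableSet_Ioi
      ((integrableOn_density_Ioi hi hx).mono_set Ioc_subset_Ioi_self)
      (integrableOn_density_Ioi hi (hx.trans hxy)), Ioc_union_Ioi_eq_Ioi hxy]

theorem tail_anti (hi : i ≠ J.fin) {x y : ℝ} (hx : 0 ≤ x) (hxy : x ≤ y) :
    J.tail i y ≤ J.tail i x := by
  rw [← sub_nonneg, tail_sub_tail hi hx hxy]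
  exact intervalIntegral.integral_nonneg hxy fun t _ => J.density_nonneg i hi t

theorem tail_le_one (hi : i ≠ J.fin) {x : ℝ} (hx : 0 ≤ x) : J.tail i x ≤ 1 :=
  (tail_anti hi le_rfl hx).trans_eq (tail_zero hi)

/-- The tail is continuous on `[0, ∞)`, phrased through `max` as continuity on the whole line. -/
theorem continuous_tail_max (hi : i ≠ J.fin) : Continuous fun x => J.tail i (max x 0) := by
  have h : ∀ x, J.tail i (max x 0) = 1 - ∫ t in (0 : ℝ)..(max x 0),
      (Ioi (0 : ℝ)).indicator (J.density i) t := by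
    intro x
    have h1 := tail_sub_tail hi le_rfl (le_max_right x 0)
    rw [tail_zero hi] at h1
    have h2 : ∫ t in (0 : ℝ)..(max x 0), (Ioi (0 : ℝ)).indicator (J.density i) t =
        ∫ t in (0 : ℝ)..(max x 0), J.density i t := by
      rw [intervalIntegral.integral_of_le (le_max_right _ _),
        intervalIntegral.integral_of_le (le_max_right _ _)]
      exact setIntegral_congr_fun measurableSet_Ioc fun t ht => by simp [mem_Ioi.2 ht.1]
    rw [h2]; linarith
  simp_rw [h]
  have h3 : Continuous fun y => ∫ t in (0 : ℝ)..y, (Ioi (0 : ℝ)).indicator (J.density i) t :=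
    intervalIntegral.continuous_primitive
      (fun a b => ((integrableOn_density hi).integrable_indicator
        measurableSet_Ioi).intervalIntegrable) 0
  exact continuous_const.sub (h3.comp (continuous_id.max continuous_const))

theorem continuousOn_tail (hi : i ≠ J.fin) : ContinuousOn (J.tail i) (Ici 0) :=
  (continuous_tail_max hi).continuousOn.congr fun x hx => by simp [max_eq_left (mem_Ici.1 hx)]

theorem tendsto_tail (hi : i ≠ J.fin) : Tendsto (J.tail i) atTop (𝓝 0) := by
  have h := intervalIntegral_tendsto_integral_Ioi 0 (integrableOn_density hi) tendsto_id
  rw [J.density_integral i hi] at h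
  have h2 : Tendsto (fun x => 1 - ∫ t in (0 : ℝ)..x, J.density i t) atTop (𝓝 (1 - 1)) :=
    tendsto_const_nhds.sub h
  rw [sub_self] at h2
  refine h2.congr' ?_
  filter_upwards [eventually_ge_atTop 0] with x hx
  rw [← tail_sub_tail hi le_rfl hx, tail_zero hi]; ring

theorem aestronglyMeasurable_tail (hi : i ≠ J.fin) :
    AEStronglyMeasurable (J.tail i) (volume.restrict (Ioi 0)) :=
  ((continuousOn_tail hi).mono Ioi_subset_Ici_self).aestronglyMeasurable measurableSet_Ioi

theorem lintegral_tail (hi : i ≠ J.fin) :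
    ∫⁻ x in Ioi (0 : ℝ), ENNReal.ofReal (J.tail i x) =
      ∫⁻ t in Ioi (0 : ℝ), ENNReal.ofReal (t * J.density i t) := by
  have h1 : ∀ x ∈ Ioi (0 : ℝ), ENNReal.ofReal (J.tail i x) =
      ∫⁻ t in Ioi (0 : ℝ), (Ioi x).indicator (fun t => ENNReal.ofReal (J.density i t)) t := by
    intro x hx
    rw [tail, ofReal_integral_eq_lintegral_ofReal (integrableOn_density_Ioi hi (le_of_lt hx))
      (Eventually.of_forall (J.density_nonneg i hi)), lintegral_indicator measurableSet_Ioi,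
      Measure.restrict_restrict measurableSet_Ioi, Ioi_inter_Ioi, max_eq_left (le_of_lt hx)]
  rw [setLIntegral_congr_fun measurableSet_Ioi h1, lintegral_lintegral_swap]
  · refine setLIntegral_congr_fun measurableSet_Ioi fun t ht => ?_
    have h2 : ∀ x, (Ioi x).indicator (fun t => ENNReal.ofReal (J.density i t)) t =
        (Iio t).indicator (fun _ => ENNReal.ofReal (J.density i t)) x := by
      intro x; simp [indicator_apply]
    simp_rw [h2]
    rw [lintegral_indicator measurableSet_Iio, setLIntegral_const,
      Measure.restrict_apply measurableSet_Iio, Iio_inter_Ioi, Real.volume_Ioo, sub_zero,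
      mul_comm, ENNReal.ofReal_mul (le_of_lt ht)]
  · have : Function.uncurry (fun (x t : ℝ) =>
        (Ioi x).indicator (fun t => ENNReal.ofReal (J.density i t)) t) =
        {q : ℝ × ℝ | q.1 < q.2}.indicator fun q => ENNReal.ofReal (J.density i q.2) := by
      ext ⟨a, b⟩; simp [indicator_apply]
    rw [this]
    exact (((J.density_measurable i hi).comp measurable_snd).ennreal_ofReal.indicator
      (measurableSet_lt measurable_fst measurable_snd)).aemeasurable

theorem integrableOn_tail (hi : i ≠ J.fin) : IntegrableOn (J.tail i) (Ioi 0) := by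
  refine ⟨aestronglyMeasurable_tail hi, ?_⟩
  rw [hasFiniteIntegral_iff_ofReal (Eventually.of_forall (tail_nonneg hi)), lintegral_tail hi,
    ← hasFiniteIntegral_iff_ofReal]
  · exact (J.finite_mean i hi).2
  · filter_upwards [ae_restrict_mem measurableSet_Ioi] with t ht
    exact mul_nonneg (le_of_lt ht) (J.density_nonneg i hi t)

theorem integrableOn_tail_Ioi (hi : i ≠ J.fin) {x : ℝ} (hx : 0 ≤ x) :
    IntegrableOn (J.tail i) (Ioi x) :=
  (integrableOn_tail hi).mono_set (Ioi_subset_Ioi hx)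

theorem intervalIntegrable_tail (hi : i ≠ J.fin) {x y : ℝ} (hx : 0 ≤ x) (hy : 0 ≤ y) :
    IntervalIntegrable (J.tail i) volume x y := by
  rw [intervalIntegrable_iff]
  exact (integrableOn_tail hi).mono_set fun t ht => lt_of_le_of_lt (le_min hx hy) ht.1

theorem intervalIntegral_tail_nonneg (hi : i ≠ J.fin) {x y : ℝ} (hxy : x ≤ y) :
    0 ≤ ∫ t in x..y, J.tail i t :=
  intervalIntegral.integral_nonneg hxy fun t _ => tail_nonneg hi t

theorem integral_tail_add (hi : i ≠ J.fin) {x y z : ℝ} (hx : 0 ≤ x) (hy : 0 ≤ y) (hz : 0 ≤ z) :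
    (∫ t in x..y, J.tail i t) + ∫ t in y..z, J.tail i t = ∫ t in x..z, J.tail i t :=
  intervalIntegral.integral_add_adjacent_intervals (intervalIntegrable_tail hi hx hy)
    (intervalIntegrable_tail hi hy hz)

theorem integral_tail_add_Ioi (hi : i ≠ J.fin) {x y : ℝ} (hx : 0 ≤ x) (hxy : x ≤ y) :
    (∫ t in x..y, J.tail i t) + ∫ t in Ioi y, J.tail i t = ∫ t in Ioi x, J.tail i t := by
  rw [intervalIntegral.integral_of_le hxy,
    ← setIntegral_union (Ioc_disjoint_Ioi le_rfl) measurableSet_Ioi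
      ((integrableOn_tail_Ioi hi hx).mono_set Ioc_subset_Ioi_self)
      (integrableOn_tail_Ioi hi (hx.trans hxy)), Ioc_union_Ioi_eq_Ioi hxy]

theorem integral_Ioi_tail_nonneg (hi : i ≠ J.fin) (x : ℝ) : 0 ≤ ∫ t in Ioi x, J.tail i t :=
  setIntegral_nonneg measurableSet_Ioi fun t _ => tail_nonneg hi t

theorem tendsto_integral_tail (hi : i ≠ J.fin) {x : ℝ} (hx : 0 ≤ x) :
    Tendsto (fun y => ∫ t in x..y, J.tail i t) atTop (𝓝 (∫ t in Ioi x, J.tail i t)) :=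
  intervalIntegral_tendsto_integral_Ioi x (integrableOn_tail_Ioi hi hx) tendsto_id

theorem tendsto_integral_Ioi_tail (hi : i ≠ J.fin) :
    Tendsto (fun y => ∫ t in Ioi y, J.tail i t) atTop (𝓝 0) := by
  have h := (tendsto_const_nhds (x := ∫ t in Ioi 0, J.tail i t)).sub
    (tendsto_integral_tail hi le_rfl)
  rw [sub_self] at h
  refine h.congr' ?_
  filter_upwards [eventually_ge_atTop 0] with y hy
  rw [← integral_tail_add_Ioi hi le_rfl hy]; ring

/-- Where the tail vanishes the hazard rate is a junk value, but the density vanishes there almost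
everywhere. -/
theorem hazard_mul_tail_ae (hi : i ≠ J.fin) :
    ∀ᵐ t ∂(volume.restrict (Ioi (0 : ℝ))), J.hazard i t * J.tail i t = J.density i t := by
  set Z : Set ℝ := {t | 0 ≤ t ∧ J.tail i t = 0} with hZ
  by_cases hne : Z.Nonempty
  · have hbdd : BddBelow Z := ⟨0, fun t ht => ht.1⟩
    set e := sInf Z with he
    have hclosed : IsClosed Z := by
      have : Z = Ici 0 ∩ {t | J.tail i (max t 0) = 0} := by
        ext t; constructor
        · rintro ⟨h0, h1⟩; exact ⟨h0, by simpa [max_eq_left h0] using h1⟩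
        · rintro ⟨h0, h1⟩; exact ⟨h0, by simpa [max_eq_left (mem_Ici.1 h0)] using h1⟩
      rw [this]
      exact isClosed_Ici.inter (isClosed_eq (continuous_tail_max hi) continuous_const)
    have heZ : e ∈ Z := hclosed.csInf_mem hne hbdd
    have hz : ∀ᵐ t ∂(volume.restrict (Ioi e)), J.density i t = 0 :=
      (integral_eq_zero_iff_of_nonneg (J.density_nonneg i hi)
        (integrableOn_density_Ioi hi heZ.1)).1 heZ.2
    rw [ae_restrict_iff' measurableSet_Ioi] at hz ⊢
    filter_upwards [hz, (measure_eq_zero_iff_ae_notMem (s := {e})).1 (by simp)] with t h1 h2 ht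
    by_cases h3 : J.tail i t = 0
    · have h4 : e ≤ t := csInf_le hbdd ⟨le_of_lt ht, h3⟩
      have h5 : e < t := lt_of_le_of_ne h4 fun h => h2 h.symm
      rw [h1 h5, hazard, h1 h5]; simp
    · exact div_mul_cancel₀ _ h3
  · filter_upwards [ae_restrict_mem measurableSet_Ioi] with t ht
    have h3 : J.tail i t ≠ 0 := fun h => hne ⟨t, le_of_lt ht, h⟩
    exact div_mul_cancel₀ _ h3

/-- The part of the density on which the hazard rate is meaningful. -/
def liveDensity (J : JobType S) (i : S) (t : ℝ) : ℝ := J.hazard i t * J.tail i t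

theorem liveDensity_nonneg (hi : i ≠ J.fin) (t : ℝ) : 0 ≤ J.liveDensity i t :=
  mul_nonneg (div_nonneg (J.density_nonneg i hi t) (tail_nonneg hi t)) (tail_nonneg hi t)

theorem tail_sub_tail_live (hi : i ≠ J.fin) {x y : ℝ} (hx : 0 ≤ x) (hxy : x ≤ y) :
    J.tail i x - J.tail i y = ∫ t in x..y, J.liveDensity i t := by
  rw [tail_sub_tail hi hx hxy, intervalIntegral.integral_of_le hxy,
    intervalIntegral.integral_of_le hxy]
  refine integral_congr_ae ?_
  have h := hazard_mul_tail_ae hi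
  exact (ae_restrict_of_ae_restrict_of_subset
    (show Ioc x y ⊆ Ioi 0 from fun t ht => lt_of_le_of_lt hx ht.1) h).mono fun t ht => ht.symm

theorem measurable_tail (hi : i ≠ J.fin) : Measurable fun x => J.tail i (max x 0) :=
  (continuous_tail_max hi).measurable

end JobType
end Multistage
end

noncomputable section

namespace Multistage

open Filter Topology
open scoped NNReal

/-! ### Retirement costs as functions of the reward -/

/-- The shape, as a function of the reward `r`, of the optimal cost of a job that can be retired
at cost `r`.  Negative rewards are included so that one-sided derivatives exist everywhere. -/
structure RetirementCost (g : ℝ → ℝ) : Prop where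
  concave : ConcaveOn ℝ univ g
  mono : Monotone g
  sub_le : ∀ r r', r ≤ r' → g r' - g r ≤ r' - r
  eq_self : ∀ r ≤ 0, g r = r
  bounded : ∃ K, ∀ r, g r ≤ K

/-- The right derivative of a function on the line. -/
def rightSlope (g : ℝ → ℝ) (r : ℝ) : ℝ := derivWithin g (Ioi r) r

theorem rightSlope_eq_deriv {g : ℝ → ℝ} {r : ℝ} (h : DifferentiableAt ℝ g r) :
    rightSlope g r = deriv g r :=
  h.hasDerivAt.hasDerivWithinAt.derivWithin (uniqueDiffWithinAt_Ioi r)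

namespace RetirementCost

variable {g : ℝ → ℝ} (hg : RetirementCost g)
include hg

theorem le_self (r : ℝ) : g r ≤ r := by
  rcases le_total r 0 with h | h
  · exact (hg.eq_self r h).le
  · have := hg.sub_le 0 r h
    rw [hg.eq_self 0 le_rfl] at this; linarith

theorem nonneg {r : ℝ} (hr : 0 ≤ r) : 0 ≤ g r :=
  (hg.eq_self 0 le_rfl).symm.le.trans (hg.mono hr)

theorem continuous : Continuous g := by
  have : LipschitzWith 1 g := by
    refine LipschitzWith.of_le_add fun x y => ?_
    rcases le_total x y with h | h
    · have := hg.mono h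
      linarith [dist_nonneg (x := x) (y := y)]
    · have := hg.sub_le y x h
      rw [Real.dist_eq, abs_of_nonneg (by linarith)]; linarith
  exact this.continuous

theorem hasDerivWithinAt (r : ℝ) : HasDerivWithinAt g (rightSlope g r) (Ioi r) r := by
  have h := hg.concave.neg.hasDerivWithinAt_rightDeriv_of_mem_interior
    (x := r) (by simp)
  have h2 := h.neg
  simp only [neg_neg] at h2
  exact h2.differentiableWithinAt.hasDerivWithinAt

theorem antitone_rightSlope : Antitone (rightSlope g) := by
  intro a b hab
  have h := hg.concave.neg.monotoneOn_rightDeriv (a := a) (b := b) (by simp) (by simp) hab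
  have h2 : ∀ x, derivWithin (-g) (Ioi x) x = - rightSlope g x := fun x =>
    (hg.hasDerivWithinAt x).neg.derivWithin (uniqueDiffWithinAt_Ioi x)
  simp only [h2] at h
  linarith

theorem tendsto_slope (r : ℝ) : Tendsto (slope g r) (𝓝[>] r) (𝓝 (rightSlope g r)) := by
  have := hasDerivWithinAt_iff_tendsto_slope.1 (hg.hasDerivWithinAt r)
  simpa using this

theorem rightSlope_nonneg (r : ℝ) : 0 ≤ rightSlope g r := by
  refine ge_of_tendsto (hg.tendsto_slope r) ?_
  filter_upwards [self_mem_nhdsWithin] with x hx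
  rw [slope_def_field]
  exact div_nonneg (sub_nonneg.2 (hg.mono (le_of_lt hx))) (sub_nonneg.2 (le_of_lt hx))

theorem rightSlope_le_one (r : ℝ) : rightSlope g r ≤ 1 := by
  refine le_of_tendsto (hg.tendsto_slope r) ?_
  filter_upwards [self_mem_nhdsWithin] with x hx
  rw [slope_def_field, div_le_one (sub_pos.2 hx)]
  exact hg.sub_le r x (le_of_lt hx)

theorem integral_rightSlope {a b : ℝ} (hab : a ≤ b) :
    ∫ r in a..b, rightSlope g r = g b - g a :=
  intervalIntegral.integral_eq_sub_of_hasDeriv_right_of_le hab hg.continuous.continuousOn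
    (fun r _ => hg.hasDerivWithinAt r) (hg.antitone_rightSlope.intervalIntegrable)

theorem slope_le_rightSlope {a b : ℝ} (hab : a ≤ b) : g b - g a ≤ rightSlope g a * (b - a) := by
  rw [← hg.integral_rightSlope hab]
  calc ∫ r in a..b, rightSlope g r ≤ ∫ r in a..b, rightSlope g a :=
        intervalIntegral.integral_mono_on hab hg.antitone_rightSlope.intervalIntegrable
          intervalIntegrable_const fun r hr => hg.antitone_rightSlope hr.1
    _ = rightSlope g a * (b - a) := by simp [mul_comm]

theorem rightSlope_le_slope {a b : ℝ} (hab : a ≤ b) :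
    rightSlope g b * (b - a) ≤ g b - g a := by
  rw [← hg.integral_rightSlope hab]
  calc rightSlope g b * (b - a) = ∫ r in a..b, rightSlope g b := by simp [mul_comm]
    _ ≤ ∫ r in a..b, rightSlope g r :=
        intervalIntegral.integral_mono_on hab intervalIntegrable_const
          hg.antitone_rightSlope.intervalIntegrable fun r hr => hg.antitone_rightSlope hr.2

theorem rightSlope_of_neg {r : ℝ} (hr : r < 0) : rightSlope g r = 1 := by
  refine le_antisymm (hg.rightSlope_le_one r) ?_
  have h := hg.slope_le_rightSlope (a := r) (b := 0) hr.le
  rw [hg.eq_self r hr.le, hg.eq_self 0 le_rfl] at h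
  nlinarith

/-- Retiring is optimal at rewards where the right derivative is one. -/
theorem eq_self_of_rightSlope_eq_one {r : ℝ} (h : rightSlope g r = 1) : g r = r := by
  rcases le_total r 0 with hr | hr
  · exact hg.eq_self r hr
  · have h1 := hg.rightSlope_le_slope hr
    rw [h, hg.eq_self 0 le_rfl] at h1
    linarith [hg.le_self r]

/-- Continuing is strictly better above rewards where the right derivative is less than one. -/
theorem lt_self_of_rightSlope_lt_one {r r' : ℝ} (h : rightSlope g r < 1) (hr : r < r') :
    g r' < r' := by
  have h1 := hg.slope_le_rightSlope hr.le
  nlinarith [hg.le_self r]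

theorem rightContinuous_rightSlope (r : ℝ) : ContinuousWithinAt (rightSlope g) (Ici r) r := by
  have h1 : Tendsto (rightSlope g) (𝓝[>] r) (𝓝 (sSup (rightSlope g '' Ioi r))) :=
    hg.antitone_rightSlope.tendsto_nhdsGT r
  have h2 : sSup (rightSlope g '' Ioi r) = rightSlope g r := by
    apply le_antisymm
    · refine csSup_le ⟨_, mem_image_of_mem _ (show r + 1 ∈ Ioi r by simp)⟩ ?_
      rintro _ ⟨s, hs, rfl⟩
      exact hg.antitone_rightSlope (le_of_lt hs)
    · refine le_of_tendsto (hg.tendsto_slope r) ?_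
      filter_upwards [self_mem_nhdsWithin] with x hx
      have hx' : r < x := hx
      set L := sSup (rightSlope g '' Ioi r) with hL
      have hbdd : BddAbove (rightSlope g '' Ioi r) :=
        ⟨1, by rintro _ ⟨s, _, rfl⟩; exact hg.rightSlope_le_one s⟩
      rw [slope_def_field, div_le_iff₀ (sub_pos.2 hx'), ← hg.integral_rightSlope hx'.le]
      calc ∫ s in r..x, rightSlope g s ≤ ∫ s in r..x, L := by
            rw [intervalIntegral.integral_of_le hx'.le, intervalIntegral.integral_of_le hx'.le]
            refine setIntegral_mono_on
              (hg.antitone_rightSlope.intervalIntegrable (a := r) (b := x)).1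
              (by simp) measurableSet_Ioc fun s hs => ?_
            exact le_csSup hbdd (mem_image_of_mem _ hs.1)
        _ = L * (x - r) := by simp [mul_comm]
  rw [h2] at h1
  exact continuousWithinAt_Ioi_iff_Ici.1 h1

theorem integrableOn_rightSlope : IntegrableOn (rightSlope g) (Ioi 0) := by
  obtain ⟨K, hK⟩ := hg.bounded
  refine integrableOn_Ioi_of_intervalIntegral_norm_bounded (l := atTop) (b := id) K 0
    (fun r => ?_) tendsto_id ?_
  · exact (hg.antitone_rightSlope.intervalIntegrable (a := 0) (b := r)).1
  · filter_upwards [eventually_ge_atTop 0] with r hr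
    have : ∀ s, ‖rightSlope g s‖ = rightSlope g s := fun s => by
      rw [Real.norm_eq_abs, abs_of_nonneg (hg.rightSlope_nonneg s)]
    simp_rw [this]
    rw [id, hg.integral_rightSlope hr, hg.eq_self 0 le_rfl]
    linarith [hK r]

theorem tendsto_rightSlope : Tendsto (rightSlope g) atTop (𝓝 0) := by
  obtain ⟨K, hK⟩ := hg.bounded
  have h1 : Tendsto (fun r : ℝ => K / r) atTop (𝓝 0) := tendsto_const_nhds.div_atTop tendsto_id
  refine squeeze_zero' (Eventually.of_forall hg.rightSlope_nonneg) ?_ h1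
  filter_upwards [eventually_gt_atTop 0] with r hr
  have h2 := hg.rightSlope_le_slope hr.le
  rw [hg.eq_self 0 le_rfl] at h2
  rw [le_div_iff₀ hr]
  linarith [hK r]

/-- The distribution function whose tail is the right derivative. -/
def stieltjes : StieltjesFunction ℝ where
  toFun r := 1 - rightSlope g r
  mono' := fun a b hab => by
    have := hg.antitone_rightSlope hab
    linarith
  right_continuous' := fun r => continuousWithinAt_const.sub (hg.rightContinuous_rightSlope r)

/-- The probability measure with tail `rightSlope g`. -/
def law : Measure ℝ := (hg.stieltjes).measure

theorem tendsto_stieltjes_atTop : Tendsto hg.stieltjes atTop (𝓝 1) := by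
  have := (tendsto_const_nhds (x := (1 : ℝ))).sub hg.tendsto_rightSlope
  rwa [sub_zero] at this

theorem tendsto_stieltjes_atBot : Tendsto hg.stieltjes atBot (𝓝 0) := by
  refine tendsto_const_nhds.congr' ?_
  filter_upwards [eventually_lt_atBot 0] with r hr
  show 0 = 1 - rightSlope g r
  rw [hg.rightSlope_of_neg hr]; ring

theorem isProbabilityMeasure_law : IsProbabilityMeasure hg.law :=
  StieltjesFunction.isProbabilityMeasure _ hg.tendsto_stieltjes_atBot hg.tendsto_stieltjes_atTop

theorem law_Ioi (r : ℝ) : hg.law (Ioi r) = ENNReal.ofReal (rightSlope g r) := by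
  have h := StieltjesFunction.measure_Ioi hg.stieltjes hg.tendsto_stieltjes_atTop r
  rw [law, h]
  congr 1
  show 1 - (1 - rightSlope g r) = _
  ring

theorem law_nonneg : ∀ᵐ x ∂hg.law, 0 ≤ x := by
  have h : hg.law (Iio 0) = 0 := by
    rw [law, StieltjesFunction.measure_Iio hg.stieltjes hg.tendsto_stieltjes_atBot]
    have h1 : Function.leftLim hg.stieltjes 0 = 0 := by
      refine leftLim_eq_of_tendsto ?_
      refine tendsto_const_nhds.congr' ?_
      filter_upwards [self_mem_nhdsWithin] with r hr
      show 0 = 1 - rightSlope g r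
      rw [hg.rightSlope_of_neg hr]; ring
    simp [h1]
  rw [ae_iff]
  convert h using 2
  ext x; simp

/-- The integral of a product of two right derivatives, as an average of one retirement cost over the
law that belongs to the other. -/
theorem lintegral_rightSlope_mul {g' : ℝ → ℝ} (hg' : RetirementCost g') :
    ∫⁻ r in Ioi (0 : ℝ), ENNReal.ofReal (rightSlope g r * rightSlope g' r) =
      ∫⁻ y, ENNReal.ofReal (g y) ∂hg'.law := by
  have := hg'.isProbabilityMeasure_law
  have hm : Measurable (rightSlope g) := hg.antitone_rightSlope.measurable
  have h1 : ∀ r, ENNReal.ofReal (rightSlope g r * rightSlope g' r) =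
      ∫⁻ y, (Ioi r).indicator (fun _ => ENNReal.ofReal (rightSlope g r)) y ∂hg'.law := by
    intro r
    rw [lintegral_indicator measurableSet_Ioi, setLIntegral_const, hg'.law_Ioi,
      ENNReal.ofReal_mul (hg.rightSlope_nonneg r)]
  simp_rw [h1]
  rw [lintegral_lintegral_swap]
  · refine lintegral_congr_ae ?_
    filter_upwards [hg'.law_nonneg] with y hy
    have h2 : ∀ r, (Ioi r).indicator (fun _ => ENNReal.ofReal (rightSlope g r)) y =
        (Iio y).indicator (fun r => ENNReal.ofReal (rightSlope g r)) r := by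
      intro r; simp [indicator_apply]
    simp_rw [h2]
    rw [lintegral_indicator measurableSet_Iio, Measure.restrict_restrict measurableSet_Iio,
      inter_comm, Ioi_inter_Iio, restrict_Ioo_eq_restrict_Ioc,
      ← ofReal_integral_eq_lintegral_ofReal
        (hg.antitone_rightSlope.intervalIntegrable (a := 0) (b := y)).1
        (Eventually.of_forall hg.rightSlope_nonneg),
      ← intervalIntegral.integral_of_le hy, hg.integral_rightSlope hy, hg.eq_self 0 le_rfl,
      sub_zero]
  · have : Function.uncurry (fun (r y : ℝ) =>
        (Ioi r).indicator (fun _ => ENNReal.ofReal (rightSlope g r)) y) =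
        {q : ℝ × ℝ | q.1 < q.2}.indicator fun q => ENNReal.ofReal (rightSlope g q.1) := by
      ext ⟨a, b⟩; simp [indicator_apply]
    rw [this]
    exact ((hm.comp measurable_fst).ennreal_ofReal.indicator
      (measurableSet_lt measurable_fst measurable_snd)).aemeasurable

theorem integrable_law {g' : ℝ → ℝ} (hg' : RetirementCost g') : Integrable g hg'.law := by
  have := hg'.isProbabilityMeasure_law
  obtain ⟨K, hK⟩ := hg.bounded
  refine Integrable.mono' (integrable_const K) hg.continuous.aestronglyMeasurable ?_
  filter_upwards [hg'.law_nonneg] with y hy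
  rw [Real.norm_eq_abs, abs_of_nonneg (hg.nonneg hy)]
  exact hK y

theorem integrableOn_rightSlope_mul {g' : ℝ → ℝ} (hg' : RetirementCost g') :
    IntegrableOn (fun r => rightSlope g r * rightSlope g' r) (Ioi 0) := by
  refine Integrable.mono' hg.integrableOn_rightSlope
    (hg.antitone_rightSlope.measurable.mul
      hg'.antitone_rightSlope.measurable).aestronglyMeasurable (Eventually.of_forall fun r => ?_)
  rw [Real.norm_eq_abs, abs_of_nonneg (mul_nonneg (hg.rightSlope_nonneg r)
    (hg'.rightSlope_nonneg r))]
  exact mul_le_of_le_one_right (hg.rightSlope_nonneg r) (hg'.rightSlope_le_one r)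

theorem integral_rightSlope_mul {g' : ℝ → ℝ} (hg' : RetirementCost g') :
    ∫ r in Ioi (0 : ℝ), rightSlope g r * rightSlope g' r = ∫ y, g y ∂hg'.law := by
  rw [integral_eq_lintegral_of_nonneg_ae, integral_eq_lintegral_of_nonneg_ae,
    hg.lintegral_rightSlope_mul hg']
  · filter_upwards [hg'.law_nonneg] with y hy using hg.nonneg hy
  · exact hg.continuous.aestronglyMeasurable
  · exact Eventually.of_forall fun r =>
      mul_nonneg (hg.rightSlope_nonneg r) (hg'.rightSlope_nonneg r)
  · exact (hg.integrableOn_rightSlope_mul hg').1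

end RetirementCost

/-- A right derivative dominates another one when the difference of the functions is monotone. -/
theorem RetirementCost.mul_rightSlope_le {g g' : ℝ → ℝ} (hg : RetirementCost g)
    (hg' : RetirementCost g') {a b r : ℝ}
    (h : ∀ r', r ≤ r' → b * g' r' - b * g' r ≤ a * g r' - a * g r) :
    b * rightSlope g' r ≤ a * rightSlope g r := by
  refine le_of_tendsto_of_tendsto ((hg'.tendsto_slope r).const_mul b)
    ((hg.tendsto_slope r).const_mul a) ?_
  filter_upwards [self_mem_nhdsWithin] with x hx
  have hx' : r < x := hx
  rw [slope_def_field, slope_def_field, ← mul_div_assoc, ← mul_div_assoc]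
  refine div_le_div_of_nonneg_right ?_ (sub_pos.2 hx').le
  rw [mul_sub, mul_sub]
  exact h x hx'.le

theorem retirementCost_min_zero : RetirementCost fun r => min r 0 where
  concave := (concaveOn_id convex_univ).inf (concaveOn_const 0 convex_univ)
  mono := fun a b hab => min_le_min_right 0 hab
  sub_le r r' h := by
    rcases le_total r 0 with h1 | h1 <;> rcases le_total r' 0 with h2 | h2 <;> simp [h1, h2] <;>
      linarith
  eq_self r hr := min_eq_left hr
  bounded := ⟨0, fun r => min_le_right r 0⟩

theorem rightSlope_min_zero {r : ℝ} (hr : 0 ≤ r) : rightSlope (fun r => min r 0) r = 0 := by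
  have : HasDerivWithinAt (fun r : ℝ => min r 0) 0 (Ioi r) r :=
    (hasDerivWithinAt_const r (Ioi r) (0 : ℝ)).congr
      (fun x hx => min_eq_right (hr.trans (le_of_lt hx))) (min_eq_right hr)
  exact this.derivWithin (uniqueDiffWithinAt_Ioi r)

theorem RetirementCost.sum {ι : Type*} [Fintype ι] {p : ι → ℝ} {g : ι → ℝ → ℝ}
    (hp : ∀ j, 0 ≤ p j) (hs : ∑ j, p j = 1) (hg : ∀ j, 0 < p j → RetirementCost (g j)) :
    RetirementCost fun r => ∑ j, p j * g j r where
  concave := by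
    refine ⟨convex_univ, fun x _ y _ a b ha hb hab => ?_⟩
    simp only [smul_eq_mul, Finset.mul_sum, ← Finset.sum_add_distrib]
    refine Finset.sum_le_sum fun j _ => ?_
    rcases (hp j).eq_or_lt with h | h
    · simp [← h]
    · have := (hg j h).concave.2 (mem_univ x) (mem_univ y) ha hb hab
      simp only [smul_eq_mul] at this
      nlinarith
  mono := fun r r' hr => by
    refine Finset.sum_le_sum fun j _ => ?_
    rcases (hp j).eq_or_lt with h | h
    · simp [← h]
    · exact mul_le_mul_of_nonneg_left ((hg j h).mono hr) h.le
  sub_le r r' hr := by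
    rw [← Finset.sum_sub_distrib]
    calc ∑ j, (p j * g j r' - p j * g j r) ≤ ∑ j, p j * (r' - r) := by
          refine Finset.sum_le_sum fun j _ => ?_
          rcases (hp j).eq_or_lt with h | h
          · simp [← h]
          · rw [← mul_sub]; exact mul_le_mul_of_nonneg_left ((hg j h).sub_le r r' hr) h.le
      _ = r' - r := by rw [← Finset.sum_mul, hs, one_mul]
  eq_self r hr := by
    calc ∑ j, p j * g j r = ∑ j, p j * r := by
          refine Finset.sum_congr rfl fun j _ => ?_
          rcases (hp j).eq_or_lt with h | h
          · simp [← h]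
          · rw [(hg j h).eq_self r hr]
      _ = r := by rw [← Finset.sum_mul, hs, one_mul]
  bounded := by
    have : ∀ j, ∃ K, ∀ r, p j * g j r ≤ K := by
      intro j
      rcases (hp j).eq_or_lt with h | h
      · exact ⟨0, fun r => by simp [← h]⟩
      · obtain ⟨K, hK⟩ := (hg j h).bounded
        exact ⟨p j * K, fun r => mul_le_mul_of_nonneg_left (hK r) h.le⟩
    choose K hK using this
    exact ⟨∑ j, K j, fun r => Finset.sum_le_sum fun j _ => hK j r⟩

end Multistage
end

noncomputable section

namespace Multistage

open Filter Topology
open scoped NNReal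

namespace JobType

variable {S : Type*} [Fintype S] (J : JobType S)

/-! ### The optimal cost of a single job -/

/-- Stage `j` can directly follow stage `i`. -/
def Follows (j i : S) : Prop := i ≠ J.fin ∧ 0 < J.trans i j

theorem wellFounded_follows : WellFounded J.Follows := by
  have h1 : WellFounded fun a b => Relation.TransGen (fun a b => a ≠ J.fin ∧ 0 < J.trans a b) b a := by
    have : Std.Irrefl (fun a b : S =>
        Relation.TransGen (fun a b => a ≠ J.fin ∧ 0 < J.trans a b) b a) := ⟨J.acyclic⟩
    have : IsTrans S fun a b =>
        Relation.TransGen (fun a b => a ≠ J.fin ∧ 0 < J.trans a b) b a :=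
      ⟨fun a b c h1 h2 => h2.trans h1⟩
    exact Finite.wellFounded_of_trans_of_irrefl _
  exact Subrelation.wf (r := fun a b : S =>
    Relation.TransGen (fun a b => a ≠ J.fin ∧ 0 < J.trans a b) b a)
    (fun {a b} (h : J.Follows a b) => Relation.TransGen.single h) h1

/-- Induction along the stages of a job, backwards from the final stage. -/
theorem stage_induction {P : S → Prop} (fin : P J.fin)
    (step : ∀ i, i ≠ J.fin → (∀ j, 0 < J.trans i j → P j) → P i) (i : S) : P i := by
  induction i using J.wellFounded_follows.induction with
  | _ i ih =>
    by_cases hi : i = J.fin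
    · exact hi ▸ fin
    · exact step i hi fun j hj => ih j ⟨hi, hj⟩

/-- The cost of serving stage `i`, from age `x` on, for a time `d`, when retiring then costs `r` and
finishing the stage before costs `b`; multiplied by the probability of reaching age `x`. -/
def stageValue (i : S) (b x r : ℝ) (d : ℝ≥0) : ℝ :=
  r * J.tail i (x + d) + b * (J.tail i x - J.tail i (x + d)) + ∫ t in x..x + d, J.tail i t

/-- The optimal cost of serving stage `i` from age `x` on, multiplied by the probability of reaching
age `x`. -/
def rawCost (i : S) (b x r : ℝ) : ℝ := ⨅ d : ℝ≥0, J.stageValue i b x r d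

open Classical in
/-- The optimal cost `A_r(i, x)` of a single job that can be retired at any moment at cost `r`.  It is
defined by recursion along the stages.  In the final stage it is `min r 0`, that is, `0` for `r ≥ 0`;
the value for `r < 0` makes it equal to `r` there, as in the other stages. -/
def optCost : S → ℝ → ℝ → ℝ :=
  J.wellFounded_follows.fix fun i rec x r =>
    if i = J.fin then min r 0 else
      J.rawCost i (∑ j, if h : J.Follows j i then J.trans i j * rec j h 0 r else 0) x r / J.tail i x

/-- The optimal expected cost after completing stage `i`. -/
def nextCost (i : S) (r : ℝ) : ℝ := ∑ j, J.trans i j * J.optCost j 0 r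

variable {J} {i : S}

theorem optCost_fin (x : ℝ) : J.optCost J.fin x = fun r => min r 0 := by
  ext r; rw [optCost, WellFounded.fix_eq]; simp

theorem optCost_eq (hi : i ≠ J.fin) (x r : ℝ) :
    J.optCost i x r = J.rawCost i (J.nextCost i r) x r / J.tail i x := by
  rw [optCost, WellFounded.fix_eq, if_neg hi]
  congr 2
  refine Finset.sum_congr rfl fun j _ => ?_
  split_ifs with h
  · rfl
  · have : J.trans i j = 0 :=
      le_antisymm (not_lt.1 fun h' => h ⟨hi, h'⟩) (J.trans_nonneg i j)
    rw [this, zero_mul]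

theorem bddBelow_stageValue (hi : i ≠ J.fin) (b r : ℝ) {x : ℝ} (hx : 0 ≤ x) :
    BddBelow (range (J.stageValue i b x r)) := by
  refine ⟨-(|r| + |b|), ?_⟩
  rintro _ ⟨d, rfl⟩
  have h1 := tail_nonneg hi (x + d)
  have h2 := tail_le_one hi hx
  have h3 := tail_anti hi hx (le_add_of_nonneg_right d.2 : x ≤ x + d)
  have h4 := intervalIntegral_tail_nonneg hi (le_add_of_nonneg_right d.2 : x ≤ x + d)
  have h5 : -|r| ≤ r * J.tail i (x + d) := by
    nlinarith [neg_abs_le r, abs_nonneg r]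
  have h6 : -|b| ≤ b * (J.tail i x - J.tail i (x + d)) := by
    nlinarith [neg_abs_le b, abs_nonneg b]
  simp only [stageValue]
  linarith

theorem rawCost_le (hi : i ≠ J.fin) (b r : ℝ) {x y : ℝ} (hx : 0 ≤ x) (hxy : x ≤ y) :
    J.rawCost i b x r ≤
      r * J.tail i y + b * (J.tail i x - J.tail i y) + ∫ t in x..y, J.tail i t := by
  have h := ciInf_le (bddBelow_stageValue hi b r hx) (y - x).toNNReal
  simp only [stageValue, Real.coe_toNNReal _ (sub_nonneg.2 hxy), add_sub_cancel] at h
  exact h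

theorem le_rawCost {b r x c : ℝ} (h : ∀ y, x ≤ y → c ≤
    r * J.tail i y + b * (J.tail i x - J.tail i y) + ∫ t in x..y, J.tail i t) :
    c ≤ J.rawCost i b x r :=
  le_ciInf fun d => h (x + d) (le_add_of_nonneg_right d.2)

/-- Serving up to age `y` and then acting optimally is no better than acting optimally. -/
theorem rawCost_le_step (hi : i ≠ J.fin) (b r : ℝ) {x y : ℝ} (hx : 0 ≤ x) (hxy : x ≤ y) :
    J.rawCost i b x r ≤ (∫ t in x..y, J.tail i t) + (J.tail i x - J.tail i y) * b +
      J.rawCost i b y r := by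
  rw [← sub_le_iff_le_add']
  refine le_rawCost fun z hz => ?_
  have h := rawCost_le hi b r hx (hxy.trans hz)
  rw [← integral_tail_add hi hx (hx.trans hxy) ((hx.trans hxy).trans hz)] at h
  linarith

/-- Until the first age at which retiring is optimal, serving is optimal. -/
theorem rawCost_eq_of_lt (hi : i ≠ J.fin) {b r x y : ℝ} (hx : 0 ≤ x) (hxy : x ≤ y)
    (hlt : ∀ z, x ≤ z → z < y → J.rawCost i b z r < r * J.tail i z) :
    J.rawCost i b x r = (∫ t in x..y, J.tail i t) + (J.tail i x - J.tail i y) * b +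
      J.rawCost i b y r := by
  refine le_antisymm (rawCost_le_step hi b r hx hxy) ?_
  by_contra! hcon
  set c := (∫ t in x..y, J.tail i t) + (J.tail i x - J.tail i y) * b + J.rawCost i b y r with hc
  set φ : ℝ → ℝ := fun z => r * J.tail i z + b * (J.tail i x - J.tail i z) +
    ∫ t in x..z, J.tail i t with hφ
  have hφ_ge : ∀ z, y ≤ z → c ≤ φ z := by
    intro z hz
    have h := rawCost_le hi b r (hx.trans hxy) hz
    simp only [hφ, ← integral_tail_add hi hx (hx.trans hxy) ((hx.trans hxy).trans hz), hc]
    linarith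
  have hcont : ContinuousOn φ (Icc x y) := by
    have h1 : ContinuousOn (J.tail i) (Icc x y) :=
      (continuousOn_tail hi).mono fun z hz => hx.trans hz.1
    have h2 : ContinuousOn (fun z => ∫ t in x..z, J.tail i t) (Icc x y) := by
      have := intervalIntegral.continuousOn_primitive_interval (μ := volume) (f := J.tail i)
        (a := x) (b := y) ?_
      · rwa [uIcc_of_le hxy] at this
      · rw [uIcc_of_le hxy]; exact h1.integrableOn_Icc
    exact ((continuousOn_const.mul h1).add
      (continuousOn_const.mul (continuousOn_const.sub h1))).add h2
  obtain ⟨z, hz, hmin⟩ := isCompact_Icc.exists_isMinOn (nonempty_Icc.2 hxy) hcont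
  have hex : ∃ z', x ≤ z' ∧ φ z' < c := by
    by_contra! h
    exact absurd (le_rawCost h) (not_le.2 hcon)
  obtain ⟨z', hz', hz'c⟩ := hex
  have hz'y : z' < y := by
    by_contra! h
    exact absurd (hφ_ge z' h) (not_le.2 hz'c)
  have hzc : φ z < c := (hmin ⟨hz', hz'y.le⟩).trans_lt hz'c
  have hzy : z < y := by
    by_contra! h
    exact absurd (hφ_ge z h) (not_le.2 hzc)
  have hraw : φ z ≤ J.rawCost i b x r := by
    refine le_rawCost fun w hw => ?_
    rcases le_or_gt y w with h | h
    · exact hzc.le.trans (hφ_ge w h)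
    · exact hmin ⟨hw, h.le⟩
  have h1 := rawCost_le_step hi b r hx hz.1
  have h2 := hlt z hz.1 hzy
  simp only [hφ] at hraw
  linarith

/-- The increase of the optimal cost with the reward and with the cost after the stage is larger at
earlier ages. -/
theorem rawCost_add_le (hi : i ≠ J.fin) {b b' r r' x y : ℝ} (hx : 0 ≤ x) (hxy : x ≤ y)
    (hb : b ≤ b') (hbr : b' - b ≤ r' - r) :
    J.rawCost i b x r + J.rawCost i b' y r' ≤ J.rawCost i b' x r' + J.rawCost i b y r := by
  have hy := hx.trans hxy
  rw [← sub_le_iff_le_add]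
  refine le_rawCost fun u hu => ?_
  suffices h : J.rawCost i b x r + J.rawCost i b' y r' - (r' * J.tail i u +
      b' * (J.tail i x - J.tail i u) + ∫ t in x..u, J.tail i t) ≤ J.rawCost i b y r by linarith
  refine le_rawCost fun v hv => ?_
  have hT : J.tail i y ≤ J.tail i x := tail_anti hi hx hxy
  -- given retirement ages `u` for `(x, r')` and `v` for `(y, r)`: if `y ≤ u`, use `u` for `(y, r')` and
  -- `v` for `(x, r)`; otherwise `u` is out of reach from age `y`, and `u` serves `(x, r)`, `v` `(y, r')`
  rcases le_or_gt y u with h | h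
  · have h1 := rawCost_le hi b' r' hy h
    have h2 := rawCost_le hi b r hx (hxy.trans hv)
    have e1 := integral_tail_add hi hx hy (hy.trans h)
    have e2 := integral_tail_add hi hx hy (hy.trans hv)
    nlinarith [mul_nonneg (sub_nonneg.2 hb) (sub_nonneg.2 hT)]
  · have h1 := rawCost_le hi b r hx hu
    have h2 := rawCost_le hi b' r' hy hv
    have hT2 : J.tail i v ≤ J.tail i u := tail_anti hi (hx.trans hu) (h.le.trans hv)
    nlinarith [mul_nonneg (sub_nonneg.2 hb) (sub_nonneg.2 hT),
      mul_nonneg (sub_nonneg.2 hbr) (sub_nonneg.2 hT2)]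

theorem rawCost_le_of_bound (hi : i ≠ J.fin) {b r x : ℝ} (hx : 0 ≤ x) :
    J.rawCost i b x r ≤ b * J.tail i x + ∫ t in Ioi x, J.tail i t := by
  have h : Tendsto (fun y => r * J.tail i y + b * (J.tail i x - J.tail i y) +
      ∫ t in x..y, J.tail i t) atTop
      (𝓝 (r * 0 + b * (J.tail i x - 0) + ∫ t in Ioi x, J.tail i t)) :=
    (((tendsto_tail hi).const_mul r).add
      ((tendsto_const_nhds.sub (tendsto_tail hi)).const_mul b)).add (tendsto_integral_tail hi hx)
  rw [mul_zero, zero_add, sub_zero] at h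
  refine ge_of_tendsto h ?_
  filter_upwards [eventually_ge_atTop x] with y hy using rawCost_le hi b r hx hy

theorem retirementCost_rawCost (hi : i ≠ J.fin) {B : ℝ → ℝ} (hB : RetirementCost B) {x : ℝ}
    (hx : 0 ≤ x) (hT : 0 < J.tail i x) :
    RetirementCost fun r => J.rawCost i (B r) x r / J.tail i x where
  concave := by
    have h : ConcaveOn ℝ univ fun r => J.rawCost i (B r) x r := by
      refine ⟨convex_univ, fun r _ r' _ a b ha hb hab => ?_⟩
      simp only [smul_eq_mul]
      refine le_rawCost fun y hy => ?_
      have h1 := mul_le_mul_of_nonneg_left (rawCost_le hi (B r) r hx hy) ha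
      have h2 := mul_le_mul_of_nonneg_left (rawCost_le hi (B r') r' hx hy) hb
      have h3 := hB.concave.2 (mem_univ r) (mem_univ r') ha hb hab
      simp only [smul_eq_mul] at h3
      have h4 := mul_le_mul_of_nonneg_right h3 (sub_nonneg.2 (tail_anti hi hx hy))
      have h5 : (∫ t in x..y, J.tail i t) =
          a * (∫ t in x..y, J.tail i t) + b * ∫ t in x..y, J.tail i t := by
        rw [← add_mul, hab, one_mul]
      linarith
    have h2 := h.smul (inv_nonneg.2 hT.le)
    simpa [div_eq_inv_mul] using h2
  mono := by
    intro r r' hr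
    refine div_le_div_of_nonneg_right (le_rawCost fun y hy => ?_) hT.le
    refine (rawCost_le hi (B r) r hx hy).trans ?_
    have h1 := mul_le_mul_of_nonneg_right hr (tail_nonneg hi y)
    have h2 := mul_le_mul_of_nonneg_right (hB.mono hr) (sub_nonneg.2 (tail_anti hi hx hy))
    linarith
  sub_le := by
    intro r r' hr
    rw [← sub_div, div_le_iff₀ hT, sub_le_comm]
    refine le_rawCost fun y hy => ?_
    have h0 := rawCost_le hi (B r') r' hx hy
    have h1 := mul_nonneg (sub_nonneg.2 (hB.sub_le r r' hr))
      (sub_nonneg.2 (tail_anti hi hx hy))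
    nlinarith
  eq_self := by
    intro r hr
    rw [div_eq_iff hT.ne']
    refine le_antisymm ?_ (le_rawCost fun y hy => ?_)
    · simpa using rawCost_le hi (B r) r hx le_rfl
    · rw [hB.eq_self r hr]
      have := intervalIntegral_tail_nonneg hi hy
      linarith
  bounded := by
    obtain ⟨K, hK⟩ := hB.bounded
    refine ⟨K + (∫ t in Ioi x, J.tail i t) / J.tail i x, fun r => ?_⟩
    rw [div_le_iff₀ hT, add_mul, div_mul_cancel₀ _ hT.ne']
    have := mul_le_mul_of_nonneg_right (hK r) hT.le
    linarith [rawCost_le_of_bound hi (b := B r) (r := r) hx]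

theorem retirementCost_optCost_zero (i : S) : RetirementCost (J.optCost i 0) := by
  induction i using J.stage_induction with
  | fin => rw [optCost_fin]; exact retirementCost_min_zero
  | step i hi ih =>
    have : J.optCost i 0 = fun r => J.rawCost i (J.nextCost i r) 0 r / J.tail i 0 :=
      funext fun r => optCost_eq hi 0 r
    rw [this]
    exact retirementCost_rawCost hi (.sum (J.trans_nonneg i) (J.trans_sum i) ih) le_rfl
      (by rw [tail_zero hi]; exact one_pos)

theorem retirementCost_nextCost (i : S) : RetirementCost (J.nextCost i) :=
  .sum (J.trans_nonneg i) (J.trans_sum i) fun j _ => retirementCost_optCost_zero j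

theorem retirementCost_optCost {p : JobState S} (hp : J.Valid p) :
    RetirementCost (J.optCost p.1 p.2) := by
  by_cases hi : p.1 = J.fin
  · rw [hi, optCost_fin]; exact retirementCost_min_zero
  · have : J.optCost p.1 p.2 = fun r => J.rawCost p.1 (J.nextCost p.1 r) p.2 r / J.tail p.1 p.2 :=
      funext fun r => optCost_eq hi p.2 r
    rw [this]
    exact retirementCost_rawCost hi (retirementCost_nextCost _) (hp hi).1 (hp hi).2

theorem tail_mul_optCost (hi : i ≠ J.fin) (x r : ℝ) (hT : J.tail i x ≠ 0) :
    J.tail i x * J.optCost i x r = J.rawCost i (J.nextCost i r) x r := by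
  rw [optCost_eq hi, mul_div_cancel₀ _ hT]

theorem rawCost_of_tail_eq_zero (hi : i ≠ J.fin) {b r x : ℝ} (hx : 0 ≤ x)
    (hT : J.tail i x = 0) : J.rawCost i b x r = 0 := by
  have hz : ∀ y, x ≤ y → J.tail i y = 0 := fun y hy =>
    le_antisymm ((tail_anti hi hx hy).trans hT.le) (tail_nonneg hi y)
  refine le_antisymm ?_ (le_rawCost fun y hy => ?_)
  · simpa [hT] using rawCost_le hi b r hx le_rfl
  · simpa [hT, hz y hy] using intervalIntegral_tail_nonneg hi hy

theorem tail_mul_optCost' (hi : i ≠ J.fin) {x : ℝ} (r : ℝ) (hx : 0 ≤ x) :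
    J.tail i x * J.optCost i x r = J.rawCost i (J.nextCost i r) x r := by
  by_cases hT : J.tail i x = 0
  · rw [rawCost_of_tail_eq_zero hi hx hT, hT, zero_mul]
  · exact tail_mul_optCost hi x r hT

theorem valid_of_le (hi : i ≠ J.fin) {x y : ℝ} (hp : J.Valid (i, y)) (hx : 0 ≤ x) (hxy : x ≤ y) :
    J.Valid (i, x) := fun _ => ⟨hx, (hp hi).2.trans_le (tail_anti hi hx hxy)⟩

theorem valid_zero (i : S) : J.Valid (i, 0) := fun hi => ⟨le_rfl, by rw [tail_zero hi]; exact one_pos⟩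

/-- Serving for a while costs at least as much as the optimum. -/
theorem tail_mul_optCost_le (hi : i ≠ J.fin) {x y : ℝ} (r : ℝ) (hx : 0 ≤ x) (hxy : x ≤ y) :
    J.tail i x * J.optCost i x r ≤ (∫ t in x..y, J.tail i t) +
      (J.tail i x - J.tail i y) * J.nextCost i r + J.tail i y * J.optCost i y r := by
  rw [tail_mul_optCost' hi r hx, tail_mul_optCost' hi r (hx.trans hxy)]
  exact rawCost_le_step hi _ r hx hxy

/-- The increase of the optimal cost with the reward, weighted by the probability of reaching the age,
is larger at earlier ages. This makes the weighted slope decrease with the age. -/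
theorem tail_mul_optCost_sub_le (hi : i ≠ J.fin) {x y r r' : ℝ} (hx : 0 ≤ x) (hxy : x ≤ y)
    (hr : r ≤ r') : J.tail i y * J.optCost i y r' - J.tail i y * J.optCost i y r ≤
      J.tail i x * J.optCost i x r' - J.tail i x * J.optCost i x r := by
  rw [tail_mul_optCost' hi _ hx, tail_mul_optCost' hi _ (hx.trans hxy), tail_mul_optCost' hi _ hx,
    tail_mul_optCost' hi _ (hx.trans hxy)]
  have hB := retirementCost_nextCost (J := J) i
  linarith [rawCost_add_le hi hx hxy (hB.mono hr) (hB.sub_le r r' hr)]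

/-- The right derivative in the reward, at a job state. -/
def slope (J : JobType S) (p : JobState S) (r : ℝ) : ℝ := rightSlope (J.optCost p.1 p.2) r

theorem slope_nonneg {p : JobState S} (hp : J.Valid p) (r : ℝ) : 0 ≤ J.slope p r :=
  (retirementCost_optCost hp).rightSlope_nonneg r

theorem slope_le_one {p : JobState S} (hp : J.Valid p) (r : ℝ) : J.slope p r ≤ 1 :=
  (retirementCost_optCost hp).rightSlope_le_one r

theorem slope_fin {r : ℝ} (hr : 0 ≤ r) (x : ℝ) : J.slope (J.fin, x) r = 0 := by
  rw [slope, optCost_fin]; exact rightSlope_min_zero hr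

theorem tail_mul_slope_anti (hi : i ≠ J.fin) {x y : ℝ} (r : ℝ) (hx : 0 ≤ x) (hxy : x ≤ y) :
    J.tail i y * J.slope (i, y) r ≤ J.tail i x * J.slope (i, x) r := by
  rcases (tail_nonneg hi y).eq_or_lt with hT | hT
  · rw [← hT, zero_mul]
    rcases (tail_nonneg hi x).eq_or_lt with hT' | hT'
    · rw [← hT', zero_mul]
    · exact mul_nonneg hT'.le (slope_nonneg (fun _ => ⟨hx, hT'⟩) r)
  · have hy : J.Valid (i, y) := fun _ => ⟨hx.trans hxy, hT⟩
    exact RetirementCost.mul_rightSlope_le (retirementCost_optCost (valid_of_le hi hy hx hxy))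
      (retirementCost_optCost hy) fun r' hr => tail_mul_optCost_sub_le hi hx hxy hr

/-! ### The age at which an optimal policy retires a job -/

/-- For a job of age `y` in stage `i`, retiring is optimal for the reward `r` and, to first order, for
slightly larger rewards; by convention this also holds at ages that are never reached. -/
def Stops (J : JobType S) (i : S) (r y : ℝ) : Prop := J.tail i y = 0 ∨ J.slope (i, y) r = 1

/-- The first age from `x` on at which a job in stage `i` is retired. -/
def stopAge (J : JobType S) (i : S) (r x : ℝ) : ℝ≥0∞ :=
  ⨅ (y : ℝ) (_ : x ≤ y ∧ J.Stops i r y), ENNReal.ofReal y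

/-- How long an optimal policy serves a job in stage `i` of age `x`, before retiring it. -/
def giveUp (J : JobType S) (i : S) (r x : ℝ) : ℝ≥0∞ := J.stopAge i r x - ENNReal.ofReal x

theorem measurable_giveUp (i : S) (r : ℝ) : Measurable (J.giveUp i r) := by
  have h : Monotone (J.stopAge i r) := by
    intro x x' hx
    refine le_iInf₂ fun y hy => ?_
    exact iInf₂_le y ⟨hx.trans hy.1, hy.2⟩
  exact h.measurable.sub ENNReal.measurable_ofReal

theorem not_stops_of_lt {r x t : ℝ} (hx : 0 ≤ x) (ht : 0 ≤ t)
    (h : ENNReal.ofReal t < J.giveUp i r x) : ¬ J.Stops i r (x + t) := by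
  intro hs
  have h1 : J.stopAge i r x ≤ ENNReal.ofReal (x + t) := iInf₂_le _ ⟨by linarith, hs⟩
  rw [giveUp, lt_tsub_iff_right, ← ENNReal.ofReal_add ht hx, add_comm t] at h
  exact absurd h1 (not_le.2 h)

/-- The age at which an optimal policy retires is attained. -/
theorem stops_giveUp (hi : i ≠ J.fin) {r x : ℝ} (hx : 0 ≤ x) (h : J.giveUp i r x ≠ ⊤) :
    J.Stops i r (x + (J.giveUp i r x).toReal) := by
  have hs : J.stopAge i r x ≠ ⊤ := by
    intro h'; exact h (by rw [giveUp, h']; simp)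
  set Z : Set ℝ := {y | x ≤ y ∧ J.Stops i r y} with hZ
  have hne : Z.Nonempty := by
    by_contra hc
    rw [not_nonempty_iff_eq_empty] at hc
    refine hs ?_
    refine iInf₂_eq_top.2 fun y hy => ?_
    exact absurd (show y ∈ Z from hy) (by simp [hc])
  have hbdd : BddBelow Z := ⟨x, fun y hy => hy.1⟩
  have hxe : x ≤ sInf Z := le_csInf hne fun y hy => hy.1
  have hse : J.stopAge i r x = ENNReal.ofReal (sInf Z) := by
    refine le_antisymm ?_ ?_
    · obtain ⟨u, -, hu, huZ⟩ := exists_seq_tendsto_sInf hne hbdd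
      refine ge_of_tendsto (ENNReal.tendsto_ofReal hu) (Eventually.of_forall fun n => ?_)
      exact iInf₂_le (u n) (huZ n)
    · exact le_iInf₂ fun y hy => ENNReal.ofReal_le_ofReal (csInf_le hbdd hy)
  have hval : x + (J.giveUp i r x).toReal = sInf Z := by
    rw [giveUp, hse, ← ENNReal.ofReal_sub _ hx, ENNReal.toReal_ofReal (sub_nonneg.2 hxe)]
    ring
  rw [hval]
  have he0 := hx.trans hxe
  by_cases hT : J.tail i (sInf Z) = 0
  · exact Or.inl hT
  · right
    have hT' : 0 < J.tail i (sInf Z) := (tail_nonneg hi _).lt_of_ne' hT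
    refine le_antisymm (slope_le_one (p := (i, sInf Z)) (fun _ => ⟨he0, hT'⟩) r) ?_
    rw [← mul_le_mul_iff_right₀ hT', mul_one]
    obtain ⟨u, -, hu, huZ⟩ := exists_seq_tendsto_sInf hne hbdd
    have hu2 : Tendsto u atTop (𝓝[Ici 0] (sInf Z)) :=
      tendsto_nhdsWithin_iff.2 ⟨hu, Eventually.of_forall fun n => hx.trans (huZ n).1⟩
    refine le_of_tendsto ((continuousOn_tail hi _ he0).tendsto.comp hu2)
      (Eventually.of_forall fun n => ?_)
    refine le_trans ?_ (tail_mul_slope_anti hi r he0 (csInf_le hbdd (huZ n)))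
    rcases (huZ n).2 with h0 | h1
    · simp [h0]
    · simp [h1]

/-- Probability of surviving a further service time `d`, times that of reaching age `x`. -/
def tailAfter (J : JobType S) (i : S) (x : ℝ) (d : ℝ≥0∞) : ℝ :=
  if d = ⊤ then 0 else J.tail i (x + d.toReal)

/-- Mean service time spent on stage `i`, from age `x` on and during a time `d` at most, times the
probability of reaching age `x`. -/
def workFor (J : JobType S) (i : S) (x : ℝ) (d : ℝ≥0∞) : ℝ :=
  if d = ⊤ then ∫ t in Ioi x, J.tail i t else ∫ t in x..x + d.toReal, J.tail i t

theorem rawCost_lt_of_not_stops (hi : i ≠ J.fin) {r r' y : ℝ} (hy : 0 ≤ y) (hr : r < r')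
    (h : ¬ J.Stops i r y) : J.rawCost i (J.nextCost i r') y r' < r' * J.tail i y := by
  have h' := not_or.1 h
  have hT : 0 < J.tail i y := (tail_nonneg hi y).lt_of_ne' h'.1
  have hv : J.Valid (i, y) := fun _ => ⟨hy, hT⟩
  rw [← tail_mul_optCost' hi _ hy, mul_comm r']
  exact mul_lt_mul_of_pos_left ((retirementCost_optCost hv).lt_self_of_rightSlope_lt_one
    (lt_of_le_of_ne (slope_le_one hv r) h'.2) hr) hT

theorem rawCost_nonneg (hi : i ≠ J.fin) {b r x : ℝ} (hx : 0 ≤ x) (hb : 0 ≤ b) (hr : 0 ≤ r) :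
    0 ≤ J.rawCost i b x r :=
  le_rawCost fun _ hy => add_nonneg (add_nonneg (mul_nonneg hr (tail_nonneg hi _))
    (mul_nonneg hb (sub_nonneg.2 (tail_anti hi hx hy)))) (intervalIntegral_tail_nonneg hi hy)

/-- Until the moment of retirement for reward `r`, serving is optimal for all rewards `r' > r`. -/
theorem tail_mul_optCost_eq_of_lt (hi : i ≠ J.fin) {r r' x : ℝ} (hr0 : 0 ≤ r) (hr : r < r')
    (hx : 0 ≤ x) :
    J.tail i x * J.optCost i x r' = J.workFor i x (J.giveUp i r x) +
      (J.tail i x - J.tailAfter i x (J.giveUp i r x)) * J.nextCost i r' +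
      J.tailAfter i x (J.giveUp i r x) *
        J.optCost i (x + (J.giveUp i r x).toReal) r' := by
  have key : ∀ y, x ≤ y → ENNReal.ofReal (y - x) ≤ J.giveUp i r x →
      J.rawCost i (J.nextCost i r') x r' = (∫ t in x..y, J.tail i t) +
      (J.tail i x - J.tail i y) * J.nextCost i r' + J.rawCost i (J.nextCost i r') y r' := by
    intro y hxy hle
    refine rawCost_eq_of_lt hi hx hxy fun z hz hzy => ?_
    refine rawCost_lt_of_not_stops hi (hx.trans hz) hr ?_
    have := not_stops_of_lt (i := i) (J := J) (r := r) hx (sub_nonneg.2 hz)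
      (lt_of_lt_of_le ((ENNReal.ofReal_lt_ofReal_iff_of_nonneg (sub_nonneg.2 hz)).2
        (by linarith)) hle)
    rwa [add_sub_cancel] at this
  rw [tail_mul_optCost' hi _ hx]
  by_cases hd : J.giveUp i r x = ⊤
  · rw [hd, tailAfter, if_pos rfl, workFor, if_pos rfl, zero_mul, add_zero, sub_zero]
    refine le_antisymm ((rawCost_le_of_bound hi hx).trans_eq (by ring)) ?_
    have h : Tendsto (fun y => (∫ t in x..y, J.tail i t) +
        (J.tail i x - J.tail i y) * J.nextCost i r') atTop
        (𝓝 ((∫ t in Ioi x, J.tail i t) + (J.tail i x - 0) * J.nextCost i r')) :=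
      (tendsto_integral_tail hi hx).add
        ((tendsto_const_nhds.sub (tendsto_tail hi)).mul_const _)
    rw [sub_zero] at h
    refine le_of_tendsto h ?_
    filter_upwards [eventually_ge_atTop x] with y hy
    rw [key y hy (by rw [hd]; exact le_top)]
    linarith [rawCost_nonneg hi (hx.trans hy) ((retirementCost_nextCost (J := J) i).nonneg
      (hr0.trans hr.le)) (hr0.trans hr.le)]
  · rw [tailAfter, if_neg hd, workFor, if_neg hd]
    have h := key (x + (J.giveUp i r x).toReal) (by simp) (by
      rw [add_sub_cancel_left, ENNReal.ofReal_toReal hd])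
    rw [h, tail_mul_optCost' hi _ (by positivity)]

/-- Until the moment of retirement for reward `r`, serving is optimal for all rewards `r' ≥ r`. -/
theorem tail_mul_optCost_eq (hi : i ≠ J.fin) {r r' x : ℝ} (hr0 : 0 ≤ r) (hr : r ≤ r')
    (hx : 0 ≤ x) :
    J.tail i x * J.optCost i x r' = J.workFor i x (J.giveUp i r x) +
      (J.tail i x - J.tailAfter i x (J.giveUp i r x)) * J.nextCost i r' +
      J.tailAfter i x (J.giveUp i r x) *
        J.optCost i (x + (J.giveUp i r x).toReal) r' := by
  rcases hr.lt_or_eq with h | rfl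
  · exact tail_mul_optCost_eq_of_lt hi hr0 h hx
  -- both sides are continuous in the reward
  have hc : ∀ {y}, 0 ≤ y → ∀ a : ℝ, (a = 0 ∨ a = J.tail i y) →
      Continuous fun r => a * J.optCost i y r := by
    intro y hy a ha
    by_cases ha0 : a = 0
    · simp only [ha0, zero_mul]; exact continuous_const
    · have hT : a = J.tail i y := ha.resolve_left ha0
      have hv : J.Valid (i, y) := fun _ => ⟨hy, (tail_nonneg hi y).lt_of_ne' (hT ▸ ha0)⟩
      exact continuous_const.mul (retirementCost_optCost hv).continuous
  have h1 := ((hc hx _ (Or.inr rfl)).tendsto r).mono_left (nhdsWithin_le_nhds (s := Ioi r))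
  have h2 : Continuous fun r' => J.workFor i x (J.giveUp i r x) +
      (J.tail i x - J.tailAfter i x (J.giveUp i r x)) * J.nextCost i r' +
      J.tailAfter i x (J.giveUp i r x) * J.optCost i (x + (J.giveUp i r x).toReal) r' := by
    refine (continuous_const.add
      (continuous_const.mul (retirementCost_nextCost i).continuous)).add (hc (by positivity) _ ?_)
    rw [tailAfter]; split_ifs
    · exact Or.inl rfl
    · exact Or.inr rfl
  have h3 := (h2.tendsto r).mono_left (nhdsWithin_le_nhds (s := Ioi r))
  refine tendsto_nhds_unique h1 (h3.congr' ?_)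
  filter_upwards [self_mem_nhdsWithin] with r' hr'
  exact (tail_mul_optCost_eq_of_lt hi hr0 hr' hx).symm

/-- The right derivative in the reward of the optimal cost after completing a stage. -/
def nextSlope (J : JobType S) (i : S) (r : ℝ) : ℝ := ∑ j, J.trans i j * J.slope (j, 0) r

theorem hasDerivWithinAt_nextCost (i : S) (r : ℝ) :
    HasDerivWithinAt (J.nextCost i) (J.nextSlope i r) (Ioi r) r := by
  have h : ∀ j ∈ Finset.univ, HasDerivWithinAt (fun r => J.trans i j * J.optCost j 0 r)
      (J.trans i j * J.slope (j, 0) r) (Ioi r) r := fun j _ =>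
    ((retirementCost_optCost_zero j).hasDerivWithinAt r).const_mul _
  have := HasDerivWithinAt.fun_sum h
  exact this

/-- The derivative of `tail_mul_optCost_eq` in `r'`: until the moment of retirement for reward `r`, the
slope at every `r' ≥ r` is a martingale of the served job. -/
theorem tail_mul_slope_eq (hi : i ≠ J.fin) {r r' x : ℝ} (hr0 : 0 ≤ r) (hr : r ≤ r')
    (hx : 0 ≤ x) :
    J.tail i x * J.slope (i, x) r' =
      (J.tail i x - J.tailAfter i x (J.giveUp i r x)) * J.nextSlope i r' +
      J.tailAfter i x (J.giveUp i r x) *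
        J.slope (i, x + (J.giveUp i r x).toReal) r' := by
  have hc : ∀ {y}, 0 ≤ y → ∀ a : ℝ, (a = 0 ∨ a = J.tail i y) →
      HasDerivWithinAt (fun r => a * J.optCost i y r) (a * J.slope (i, y) r') (Ioi r') r' := by
    intro y hy a ha
    by_cases ha0 : a = 0
    · simp only [ha0, zero_mul]; exact hasDerivWithinAt_const _ _ _
    · have hT : a = J.tail i y := ha.resolve_left ha0
      have hv : J.Valid (i, y) := fun _ => ⟨hy, (tail_nonneg hi y).lt_of_ne' (hT ▸ ha0)⟩
      exact ((retirementCost_optCost hv).hasDerivWithinAt r').const_mul a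
  have h1 := hc hx _ (Or.inr rfl)
  have h2 := ((hasDerivWithinAt_const r' (Ioi r') (J.workFor i x (J.giveUp i r x))).add
    ((hasDerivWithinAt_nextCost (J := J) i r').const_mul
      (J.tail i x - J.tailAfter i x (J.giveUp i r x)))).add
    (hc (y := x + (J.giveUp i r x).toReal) (by positivity)
      (J.tailAfter i x (J.giveUp i r x)) (by
        rw [tailAfter]; split_ifs
        · exact Or.inl rfl
        · exact Or.inr rfl))
  have h3 := h2.congr (f₁ := fun r => J.tail i x * J.optCost i x r)
    (fun s hs => tail_mul_optCost_eq hi hr0 (hr.trans (le_of_lt hs)) hx)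
    (tail_mul_optCost_eq hi hr0 hr hx)
  have := (uniqueDiffWithinAt_Ioi r').eq_deriv _ h1 h3
  rw [this]; ring

end JobType
end Multistage
end

noncomputable section

namespace Multistage

open Filter Topology
open scoped NNReal

namespace JobType

variable {S : Type*} [Fintype S] {J : JobType S} {i : S}

/-! ### The single-job profit -/

theorem tailAfter_nonneg (hi : i ≠ J.fin) (x : ℝ) (d : ℝ≥0∞) : 0 ≤ J.tailAfter i x d := by
  rw [tailAfter]; split_ifs
  · exact le_rfl
  · exact tail_nonneg hi _

theorem tailAfter_le (hi : i ≠ J.fin) {x : ℝ} (hx : 0 ≤ x) (d : ℝ≥0∞) :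
    J.tailAfter i x d ≤ J.tail i x := by
  rw [tailAfter]; split_ifs
  · exact tail_nonneg hi x
  · exact tail_anti hi hx (by simp)

theorem workFor_nonneg (hi : i ≠ J.fin) (x : ℝ) (d : ℝ≥0∞) : 0 ≤ J.workFor i x d := by
  rw [workFor]; split_ifs
  · exact integral_Ioi_tail_nonneg hi x
  · exact intervalIntegral_tail_nonneg hi (by simp)

theorem setLIntegral_add_left (x : ℝ) (F : ℝ → ℝ≥0∞) (s : Set ℝ) :
    ∫⁻ t in (fun t => x + t) ⁻¹' s, F (x + t) = ∫⁻ t in s, F t :=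
  (measurePreserving_add_left volume x).setLIntegral_comp_preimage_emb
    (measurableEmbedding_addLeft x) F s

/-- An integral over the times before `d`, translated to ages. -/
theorem lintegral_before {g : ℝ → ℝ} (hg : ∀ t, 0 ≤ g t) {x T : ℝ} (hT : 0 < T)
    (hint : IntegrableOn g (Ioi x)) (d : ℝ≥0∞) :
    ∫⁻ t in {t : ℝ | 0 < t ∧ ENNReal.ofReal t < d}, ENNReal.ofReal (g (x + t) / T) =
      ENNReal.ofReal ((if d = ⊤ then ∫ t in Ioi x, g t else ∫ t in x..x + d.toReal, g t) / T) := by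
  have key : ∀ s : Set ℝ, s ⊆ Ioi x →
      ∫⁻ t in (fun t => x + t) ⁻¹' s, ENNReal.ofReal (g (x + t) / T) =
        ENNReal.ofReal ((∫ t in s, g t) / T) := by
    intro s hs
    rw [setLIntegral_add_left x (fun t => ENNReal.ofReal (g t / T)), ← integral_div,
      ofReal_integral_eq_lintegral_ofReal ((hint.mono_set hs).div_const T)]
    exact Eventually.of_forall fun t => div_nonneg (hg t) hT.le
  split_ifs with hd
  · rw [← key _ subset_rfl]
    congr 2
    ext t; simp [hd]
  · rw [intervalIntegral.integral_of_le (by simp), integral_Ioc_eq_integral_Ioo,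
      ← key (Ioo x (x + d.toReal)) Ioo_subset_Ioi_self]
    congr 2
    ext t
    simp only [mem_ofPred_eq, mem_preimage, mem_Ioo, lt_add_iff_pos_right, add_lt_add_iff_left]
    refine and_congr_right fun ht => ?_
    rw [ENNReal.ofReal_lt_iff_lt_toReal ht.le hd]

theorem lintegral_before_density (hi : i ≠ J.fin) {x : ℝ} (hx : 0 ≤ x) (hT : 0 < J.tail i x)
    (d : ℝ≥0∞) :
    ∫⁻ t in {t : ℝ | 0 < t ∧ ENNReal.ofReal t < d},
        ENNReal.ofReal (J.density i (x + t) / J.tail i x) =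
      ENNReal.ofReal ((J.tail i x - J.tailAfter i x d) / J.tail i x) := by
  rw [lintegral_before (J.density_nonneg i hi) hT (integrableOn_density_Ioi hi hx), tailAfter]
  congr 2
  split_ifs
  · rw [sub_zero]; rfl
  · rw [tail_sub_tail hi hx (by simp)]

theorem lintegral_before_tail (hi : i ≠ J.fin) {x : ℝ} (hx : 0 ≤ x) (hT : 0 < J.tail i x)
    (d : ℝ≥0∞) :
    ∫⁻ t in {t : ℝ | 0 < t ∧ ENNReal.ofReal t < d},
        ENNReal.ofReal (J.tail i (x + t) / J.tail i x) =
      ENNReal.ofReal (J.workFor i x d / J.tail i x) := by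
  rw [lintegral_before (tail_nonneg hi) hT (integrableOn_tail_Ioi hi hx), workFor]

/-- A job that is still in its stage when it is retired has slope `1`, unless this has probability
zero. -/
theorem tailAfter_giveUp_cases (hi : i ≠ J.fin) {r x : ℝ} (hx : 0 ≤ x) :
    J.tailAfter i x (J.giveUp i r x) = 0 ∨
      (J.Valid (i, x + (J.giveUp i r x).toReal) ∧
        J.slope (i, x + (J.giveUp i r x).toReal) r = 1) := by
  rw [tailAfter]
  split_ifs with h
  · exact Or.inl rfl
  · by_cases hT : J.tail i (x + (J.giveUp i r x).toReal) = 0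
    · exact Or.inl hT
    · exact Or.inr ⟨fun _ => ⟨by positivity, (tail_nonneg hi _).lt_of_ne' hT⟩,
        (stops_giveUp hi hx h).resolve_left hT⟩

/-- The mean service time from age `y` on, of which at most `ρ * tail i y` falls before age
`y + ρ`. -/
theorem integral_Ioi_tail_le (hi : i ≠ J.fin) {y ρ : ℝ} (hy : 0 ≤ y) (hρ : 0 ≤ ρ) :
    ∫ t in Ioi y, J.tail i t ≤ ρ * J.tail i y + ∫ t in Ioi ρ, J.tail i t := by
  rw [← integral_tail_add_Ioi hi hy (show y ≤ y + ρ by linarith)]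
  refine add_le_add ?_ ?_
  · calc ∫ t in y..y + ρ, J.tail i t ≤ ∫ t in y..y + ρ, J.tail i y :=
          intervalIntegral.integral_mono_on (by linarith)
            (intervalIntegrable_tail hi hy (by linarith)) intervalIntegrable_const
            fun t ht => tail_anti hi hy ht.1
      _ = ρ * J.tail i y := by simp
  · refine setIntegral_mono_set (integrableOn_tail_Ioi hi hρ)
      (Eventually.of_forall (tail_nonneg hi)) ?_
    exact (Ioi_subset_Ioi (by linarith)).eventuallyLE

variable [DecidableEq S]

theorem monotone_completionProbUpTo (c : S → ℝ≥0∞) (i : S) (x : ℝ) :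
    Monotone fun m => J.completionProbUpTo c m i x := by
  refine monotone_nat_of_le_succ fun m => ?_
  induction m generalizing i x with
  | zero =>
    rw [completionProbUpTo, completionProbUpTo]
    split_ifs
    · exact le_rfl
    · exact zero_le
  | succ m ih =>
    rw [completionProbUpTo, completionProbUpTo]
    split_ifs
    · exact le_rfl
    · gcongr with j _
      exact ih j 0

theorem monotone_serviceTimeUpTo (c : S → ℝ≥0∞) (i : S) (x : ℝ) :
    Monotone fun m => J.serviceTimeUpTo c m i x := by
  refine monotone_nat_of_le_succ fun m => ?_
  induction m generalizing i x with
  | zero => rw [serviceTimeUpTo]; exact zero_le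
  | succ m ih =>
    rw [serviceTimeUpTo, serviceTimeUpTo]
    split_ifs
    · exact le_rfl
    · gcongr with j _
      exact ih j 0

theorem completionProb_fin (c : S → ℝ≥0∞) (x : ℝ) : J.completionProb c (J.fin, x) = 1 := by
  have : ∀ m, J.completionProbUpTo c m J.fin x = 1 := by
    intro m; cases m <;> simp [completionProbUpTo]
  simp [completionProb, this]

theorem serviceTime_fin (c : S → ℝ≥0∞) (x : ℝ) : J.serviceTime c (J.fin, x) = 0 := by
  have : ∀ m, J.serviceTimeUpTo c m J.fin x = 0 := by
    intro m; cases m <;> simp [serviceTimeUpTo]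
  simp [serviceTime, this]

theorem completionProb_eq (hi : i ≠ J.fin) (c : S → ℝ≥0∞) {x : ℝ} (hx : 0 ≤ x)
    (hT : 0 < J.tail i x) :
    J.completionProb c (i, x) =
      ENNReal.ofReal ((J.tail i x - J.tailAfter i x (c i)) / J.tail i x) *
        ∑ j, ENNReal.ofReal (J.trans i j) * J.completionProb c (j, 0) := by
  simp only [completionProb]
  rw [← (monotone_completionProbUpTo c i x).iSup_nat_add 1]
  simp only [completionProbUpTo, if_neg hi, lintegral_before_density hi hx hT]
  rw [← ENNReal.mul_iSup]
  congr 1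
  simp_rw [ENNReal.mul_iSup]
  rw [ENNReal.finsetSum_iSup_of_monotone]
  exact fun j m m' h => mul_le_mul_right (monotone_completionProbUpTo c j 0 h) _

theorem serviceTime_eq (hi : i ≠ J.fin) (c : S → ℝ≥0∞) {x : ℝ} (hx : 0 ≤ x)
    (hT : 0 < J.tail i x) :
    J.serviceTime c (i, x) = ENNReal.ofReal (J.workFor i x (c i) / J.tail i x) +
      ENNReal.ofReal ((J.tail i x - J.tailAfter i x (c i)) / J.tail i x) *
        ∑ j, ENNReal.ofReal (J.trans i j) * J.serviceTime c (j, 0) := by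
  simp only [serviceTime]
  rw [← (monotone_serviceTimeUpTo c i x).iSup_nat_add 1]
  simp only [serviceTimeUpTo, if_neg hi, lintegral_before_density hi hx hT,
    lintegral_before_tail hi hx hT]
  rw [← ENNReal.add_iSup, ← ENNReal.mul_iSup]
  congr 2
  simp_rw [ENNReal.mul_iSup]
  rw [ENNReal.finsetSum_iSup_of_monotone]
  exact fun j m m' h => mul_le_mul_right (monotone_serviceTimeUpTo c j 0 h) _

theorem completionProb_ne_top (c : S → ℝ≥0∞) (i : S) :
    ∀ x, J.Valid (i, x) → J.completionProb c (i, x) ≠ ⊤ := by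
  induction i using J.stage_induction with
  | fin => intro x _; rw [completionProb_fin]; exact ENNReal.one_ne_top
  | step i hi ih =>
    intro x hx
    rw [completionProb_eq hi c (hx hi).1 (hx hi).2]
    refine ENNReal.mul_ne_top ENNReal.ofReal_ne_top (ENNReal.sum_ne_top.2 fun j _ => ?_)
    rcases (J.trans_nonneg i j).eq_or_lt with h | h
    · simp [← h]
    · exact ENNReal.mul_ne_top ENNReal.ofReal_ne_top (ih j h 0 (valid_zero j))

theorem serviceTime_ne_top (c : S → ℝ≥0∞) (i : S) :
    ∀ x, J.Valid (i, x) → J.serviceTime c (i, x) ≠ ⊤ := by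
  induction i using J.stage_induction with
  | fin => intro x _; rw [serviceTime_fin]; exact ENNReal.zero_ne_top
  | step i hi ih =>
    intro x hx
    rw [serviceTime_eq hi c (hx hi).1 (hx hi).2]
    refine ENNReal.add_ne_top.2 ⟨ENNReal.ofReal_ne_top,
      ENNReal.mul_ne_top ENNReal.ofReal_ne_top (ENNReal.sum_ne_top.2 fun j _ => ?_)⟩
    rcases (J.trans_nonneg i j).eq_or_lt with h | h
    · simp [← h]
    · exact ENNReal.mul_ne_top ENNReal.ofReal_ne_top (ih j h 0 (valid_zero j))

theorem tail_mul_completionProb (hi : i ≠ J.fin) (c : S → ℝ≥0∞) {x : ℝ} (hx : 0 ≤ x)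
    (hT : 0 < J.tail i x) :
    J.tail i x * (J.completionProb c (i, x)).toReal =
      (J.tail i x - J.tailAfter i x (c i)) *
        ∑ j, J.trans i j * (J.completionProb c (j, 0)).toReal := by
  rw [completionProb_eq hi c hx hT, ENNReal.toReal_mul, ENNReal.toReal_ofReal
    (div_nonneg (sub_nonneg.2 (tailAfter_le hi hx _)) hT.le), ENNReal.toReal_sum fun j _ =>
      ENNReal.mul_ne_top ENNReal.ofReal_ne_top (completionProb_ne_top c j 0 (valid_zero j))]
  simp only [ENNReal.toReal_mul, ENNReal.toReal_ofReal (J.trans_nonneg i _)]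
  field_simp

theorem tail_mul_serviceTime (hi : i ≠ J.fin) (c : S → ℝ≥0∞) {x : ℝ} (hx : 0 ≤ x)
    (hT : 0 < J.tail i x) :
    J.tail i x * (J.serviceTime c (i, x)).toReal = J.workFor i x (c i) +
      (J.tail i x - J.tailAfter i x (c i)) *
        ∑ j, J.trans i j * (J.serviceTime c (j, 0)).toReal := by
  have h1 : ∀ j ∈ Finset.univ, ENNReal.ofReal (J.trans i j) * J.serviceTime c (j, 0) ≠ ⊤ :=
    fun j _ => ENNReal.mul_ne_top ENNReal.ofReal_ne_top (serviceTime_ne_top c j 0 (valid_zero j))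
  rw [serviceTime_eq hi c hx hT, ENNReal.toReal_add ENNReal.ofReal_ne_top
    (ENNReal.mul_ne_top ENNReal.ofReal_ne_top (ENNReal.sum_ne_top.2 h1)), ENNReal.toReal_mul,
    ENNReal.toReal_ofReal (div_nonneg (sub_nonneg.2 (tailAfter_le hi hx _)) hT.le),
    ENNReal.toReal_ofReal (div_nonneg (workFor_nonneg hi _ _) hT.le), ENNReal.toReal_sum h1]
  simp only [ENNReal.toReal_mul, ENNReal.toReal_ofReal (J.trans_nonneg i _)]
  field_simp

/-- The expected cost of a stopping policy when giving up costs `r`. -/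
def stoppingCost (J : JobType S) (c : S → ℝ≥0∞) (p : JobState S) (r : ℝ) : ℝ :=
  r * (1 - (J.completionProb c p).toReal) + (J.serviceTime c p).toReal

theorem tail_mul_stoppingCost (hi : i ≠ J.fin) (c : S → ℝ≥0∞) {x : ℝ} (r : ℝ) (hx : 0 ≤ x)
    (hT : 0 < J.tail i x) :
    J.tail i x * J.stoppingCost c (i, x) r = r * J.tailAfter i x (c i) +
      (J.tail i x - J.tailAfter i x (c i)) * (∑ j, J.trans i j * J.stoppingCost c (j, 0) r) +
      J.workFor i x (c i) := by
  have h1 := tail_mul_completionProb hi c hx hT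
  have h2 := tail_mul_serviceTime hi c hx hT
  have h3 : ∑ j, J.trans i j * J.stoppingCost c (j, 0) r =
      r * (1 - ∑ j, J.trans i j * (J.completionProb c (j, 0)).toReal) +
        ∑ j, J.trans i j * (J.serviceTime c (j, 0)).toReal := by
    rw [← J.trans_sum i, ← Finset.sum_sub_distrib, Finset.mul_sum, ← Finset.sum_add_distrib]
    refine Finset.sum_congr rfl fun j _ => ?_
    rw [stoppingCost]; ring
  rw [h3, stoppingCost]
  linear_combination (-r) * h1 + h2

theorem stoppingCost_fin (c : S → ℝ≥0∞) (x r : ℝ) : J.stoppingCost c (J.fin, x) r = 0 := by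
  simp [stoppingCost, completionProb_fin, serviceTime_fin]

theorem optCost_le_stoppingCost (c : S → ℝ≥0∞) {r : ℝ} (i : S) :
    ∀ x, J.Valid (i, x) → J.optCost i x r ≤ J.stoppingCost c (i, x) r := by
  induction i using J.stage_induction with
  | fin => intro x _; rw [stoppingCost_fin, optCost_fin]; exact min_le_right r 0
  | step i hi ih =>
    intro x hv
    obtain ⟨hx, hT⟩ := hv hi
    rw [← mul_le_mul_iff_right₀ hT, tail_mul_stoppingCost hi c r hx hT, tail_mul_optCost' hi r hx]
    have hB : J.nextCost i r ≤ ∑ j, J.trans i j * J.stoppingCost c (j, 0) r := by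
      refine Finset.sum_le_sum fun j _ => ?_
      rcases (J.trans_nonneg i j).eq_or_lt with h | h
      · simp [← h]
      · exact mul_le_mul_of_nonneg_left (ih j h 0 (valid_zero j)) h.le
    have h1 := mul_le_mul_of_nonneg_left hB (sub_nonneg.2 (tailAfter_le hi hx (c i)))
    refine le_trans ?_ (add_le_add (add_le_add le_rfl h1) le_rfl)
    by_cases hc : c i = ⊤
    · rw [tailAfter, workFor, if_pos hc, if_pos hc]
      exact (rawCost_le_of_bound hi hx).trans_eq (by ring)
    · rw [tailAfter, workFor, if_neg hc, if_neg hc]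
      exact (rawCost_le hi _ r hx (le_add_of_nonneg_right (c i).toReal_nonneg)).trans_eq (by ring)

/-- The stopping policy that retires at the first optimal age attains the optimal cost. -/
theorem stoppingCost_eq_optCost {r : ℝ} (hr : 0 ≤ r) (c : S → ℝ≥0∞) (i : S) :
    ∀ x, J.Valid (i, x) → c i = J.giveUp i r x →
      (∀ j, Relation.TransGen (fun a b => a ≠ J.fin ∧ 0 < J.trans a b) i j →
        c j = J.giveUp j r 0) →
      J.stoppingCost c (i, x) r = J.optCost i x r := by
  induction i using J.stage_induction with
  | fin => intro x _ _ _; rw [stoppingCost_fin, optCost_fin]; exact (min_eq_right hr).symm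
  | step i hi ih =>
    intro x hv hc hreach
    obtain ⟨hx, hT⟩ := hv hi
    rw [← mul_right_inj' hT.ne', tail_mul_stoppingCost hi c r hx hT,
      tail_mul_optCost_eq hi hr le_rfl hx, hc]
    have hB : ∑ j, J.trans i j * J.stoppingCost c (j, 0) r = J.nextCost i r := by
      refine Finset.sum_congr rfl fun j _ => ?_
      rcases (J.trans_nonneg i j).eq_or_lt with h | h
      · simp [← h]
      · rw [ih j h 0 (valid_zero j) (hreach j (.single ⟨hi, h⟩))
          fun k hk => hreach k (.head ⟨hi, h⟩ hk)]
    rw [hB]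
    rcases tailAfter_giveUp_cases hi (r := r) hx with h | ⟨h1, h2⟩
    · rw [h]; ring
    · rw [(retirementCost_optCost h1).eq_self_of_rightSlope_eq_one h2]; ring

/-- Maximizing the profit for the reward `r` is the same as minimizing the cost when giving up costs
`r`. -/
theorem profit_eq {p : JobState S} (hp : J.Valid p) {r : ℝ} (hr : 0 ≤ r) :
    J.profit p r = r - J.optCost p.1 p.2 r := by
  have h1 : ∀ c, r * (J.completionProb c p).toReal - (J.serviceTime c p).toReal =
      r - J.stoppingCost c p r := fun c => by rw [stoppingCost]; ring
  simp only [profit, h1]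
  have h2 : ∀ c, r - J.stoppingCost c p r ≤ r - J.optCost p.1 p.2 r := fun c =>
    sub_le_sub_left (optCost_le_stoppingCost c p.1 p.2 hp) r
  refine le_antisymm (ciSup_le h2) ?_
  set c : S → ℝ≥0∞ := Function.update (fun j => J.giveUp j r 0) p.1 (J.giveUp p.1 r p.2) with hc
  have h3 : J.stoppingCost c p r = J.optCost p.1 p.2 r := by
    refine stoppingCost_eq_optCost hr c p.1 p.2 hp (by simp [hc]) fun j hj => ?_
    have : j ≠ p.1 := by rintro rfl; exact J.acyclic _ hj
    simp [hc, this]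
  rw [← h3]
  exact le_ciSup (f := fun c => r - J.stoppingCost c p r) ⟨_, by rintro _ ⟨c, rfl⟩; exact h2 c⟩ c

/-! ### Serving a job to completion -/

/-- Expected remaining service time of a job. -/
def fullCost (J : JobType S) (p : JobState S) : ℝ := (J.serviceTime (fun _ => ⊤) p).toReal

theorem fullCost_nonneg (p : JobState S) : 0 ≤ J.fullCost p := ENNReal.toReal_nonneg

theorem fullCost_fin (x : ℝ) : J.fullCost (J.fin, x) = 0 := by
  rw [fullCost, serviceTime_fin]; rfl

/-- Expected remaining service time after completing stage `i`. -/
def nextFullCost (J : JobType S) (i : S) : ℝ := ∑ j, J.trans i j * J.fullCost (j, 0)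

theorem tail_mul_fullCost (hi : i ≠ J.fin) {x : ℝ} (hx : 0 ≤ x) :
    J.tail i x * J.fullCost (i, x) =
      (∫ t in Ioi x, J.tail i t) + J.tail i x * J.nextFullCost i := by
  rcases (tail_nonneg hi x).eq_or_lt with hT | hT
  · rw [← hT, zero_mul, zero_mul, add_zero, eq_comm]
    refine setIntegral_eq_zero_of_forall_eq_zero fun t ht => ?_
    exact le_antisymm ((tail_anti hi hx (le_of_lt ht)).trans hT.symm.le) (tail_nonneg hi t)
  · rw [fullCost, tail_mul_serviceTime hi _ hx hT, tailAfter, workFor, if_pos rfl, if_pos rfl,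
      sub_zero]
    rfl

theorem tail_mul_fullCost_eq (hi : i ≠ J.fin) {x : ℝ} (hx : 0 ≤ x) (d : ℝ≥0∞) :
    J.tail i x * J.fullCost (i, x) = J.workFor i x d +
      (J.tail i x - J.tailAfter i x d) * J.nextFullCost i +
      J.tailAfter i x d * J.fullCost (i, x + d.toReal) := by
  rw [tail_mul_fullCost hi hx, tailAfter, workFor]
  split_ifs with hd
  · ring
  · rw [tail_mul_fullCost hi (by positivity), ← integral_tail_add_Ioi hi hx
      (show x ≤ x + d.toReal by simp)]
    ring

theorem completionProb_top (i : S) :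
    ∀ x, J.Valid (i, x) → (J.completionProb (fun _ => ⊤) (i, x)).toReal = 1 := by
  induction i using J.stage_induction with
  | fin => intro x _; rw [completionProb_fin]; rfl
  | step i hi ih =>
    intro x hv
    obtain ⟨hx, hT⟩ := hv hi
    rw [← mul_right_inj' hT.ne', tail_mul_completionProb hi _ hx hT, tailAfter, if_pos rfl, sub_zero]
    congr 1
    rw [← J.trans_sum i]
    refine Finset.sum_congr rfl fun j _ => ?_
    rcases (J.trans_nonneg i j).eq_or_lt with h | h
    · simp [← h]
    · rw [ih j h 0 (valid_zero j), mul_one]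

theorem optCost_le_fullCost {p : JobState S} (hp : J.Valid p) (r : ℝ) :
    J.optCost p.1 p.2 r ≤ J.fullCost p := by
  have h := optCost_le_stoppingCost (fun _ => ⊤) (r := r) p.1 p.2 hp
  rwa [stoppingCost, completionProb_top p.1 p.2 hp, sub_self, mul_zero, zero_add] at h

/-- For large rewards a job is hardly ever retired, and the optimal cost approaches the expected
remaining service time. -/
theorem tendsto_optCost (i : S) : ∀ x, J.Valid (i, x) →
    Tendsto (J.optCost i x) atTop (𝓝 (J.fullCost (i, x))) := by
  induction i using J.stage_induction with
  | fin =>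
    intro x _
    rw [fullCost_fin, optCost_fin]
    refine tendsto_const_nhds.congr' ?_
    filter_upwards [eventually_ge_atTop 0] with r hr using (min_eq_right hr).symm
  | step i hi ih =>
    intro x hv
    obtain ⟨hx, hT⟩ := hv hi
    have hB : Tendsto (J.nextCost i) atTop (𝓝 (J.nextFullCost i)) := by
      refine tendsto_finsetSum _ fun j _ => ?_
      rcases (J.trans_nonneg i j).eq_or_lt with h | h
      · simp [← h]
      · exact (ih j h 0 (valid_zero j)).const_mul _
    have hρ : Tendsto (fun r => r - J.nextCost i r) atTop atTop := by
      simpa [sub_eq_add_neg] using tendsto_id.atTop_add hB.neg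
    have h1 : Tendsto (fun r => J.fullCost (i, x) -
        ((J.nextFullCost i - J.nextCost i r) +
          (∫ t in Ioi (r - J.nextCost i r), J.tail i t) / J.tail i x)) atTop
        (𝓝 (J.fullCost (i, x) - ((J.nextFullCost i - J.nextFullCost i) + 0 / J.tail i x))) :=
      tendsto_const_nhds.sub ((tendsto_const_nhds.sub hB).add
        (((tendsto_integral_Ioi_tail hi).comp hρ).div_const _))
    rw [sub_self, zero_div, add_zero, sub_zero] at h1
    refine tendsto_of_tendsto_of_tendsto_of_le_of_le' h1 tendsto_const_nhds ?_
      (Eventually.of_forall fun r => optCost_le_fullCost hv r)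
    filter_upwards [hρ.eventually_ge_atTop 0] with r hr
    rw [← mul_le_mul_iff_right₀ hT, tail_mul_optCost' hi r hx, mul_sub, mul_add,
      mul_div_cancel₀ _ hT.ne', tail_mul_fullCost hi hx]
    refine le_rawCost fun y hy => ?_
    have h2 := integral_Ioi_tail_le hi (hx.trans hy) hr
    have h3 := integral_tail_add_Ioi hi hx hy
    linarith

end JobType
end Multistage
end

noncomputable section

namespace Multistage

open Filter Topology
open scoped NNReal

/-! ### Change of time along an effort -/

section TimeChange

variable {u : ℝ → ℝ}

theorem intervalIntegrable_effort (hu : Measurable u) (h0 : ∀ t, 0 ≤ u t) (h1 : ∀ t, u t ≤ 1)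
    (s t : ℝ) : IntervalIntegrable u volume s t := by
  refine (intervalIntegrable_const (c := (1 : ℝ))).mono_fun hu.aestronglyMeasurable ?_
  exact Eventually.of_forall fun τ => by
    simp [abs_of_nonneg (h0 τ), h1 τ]

theorem continuous_effort (hu : Measurable u) (h0 : ∀ t, 0 ≤ u t) (h1 : ∀ t, u t ≤ 1) :
    Continuous fun t => ∫ τ in (0 : ℝ)..t, u τ :=
  intervalIntegral.continuous_primitive (fun a b => intervalIntegrable_effort hu h0 h1 a b) 0

theorem effort_sub (hu : Measurable u) (h0 : ∀ t, 0 ≤ u t) (h1 : ∀ t, u t ≤ 1) (s t : ℝ) :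
    (∫ τ in (0 : ℝ)..t, u τ) - ∫ τ in (0 : ℝ)..s, u τ = ∫ τ in s..t, u τ :=
  intervalIntegral.integral_interval_sub_left (intervalIntegrable_effort hu h0 h1 _ _)
    (intervalIntegrable_effort hu h0 h1 _ _)

theorem monotone_effort (hu : Measurable u) (h0 : ∀ t, 0 ≤ u t) (h1 : ∀ t, u t ≤ 1) :
    Monotone fun t => ∫ τ in (0 : ℝ)..t, u τ := by
  intro s t hst
  rw [← sub_nonneg]
  simp only [effort_sub hu h0 h1]
  exact intervalIntegral.integral_nonneg hst fun τ _ => h0 τ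

/-- Time weighted by the effort is mapped to Lebesgue measure by the accumulated effort. -/
theorem map_effort (hu : Measurable u) (h0 : ∀ t, 0 ≤ u t) (h1 : ∀ t, u t ≤ 1) {s t : ℝ}
    (hst : s ≤ t) :
    ((volume.restrict (Ioc s t)).withDensity fun τ => ENNReal.ofReal (u τ)).map
        (fun t => ∫ τ in (0 : ℝ)..t, u τ) =
      volume.restrict (Ioc (∫ τ in (0 : ℝ)..s, u τ) (∫ τ in (0 : ℝ)..t, u τ)) := by
  set θ : ℝ → ℝ := fun t => ∫ τ in (0 : ℝ)..t, u τ with hθ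
  have hcont : Continuous θ := continuous_effort hu h0 h1
  have hmono : Monotone θ := monotone_effort hu h0 h1
  have hIoc : ∀ a b, a ≤ b →
      ∫⁻ τ in Ioc a b, ENNReal.ofReal (u τ) = ENNReal.ofReal (θ b - θ a) := by
    intro a b hab
    rw [effort_sub hu h0 h1, intervalIntegral.integral_of_le hab,
      ofReal_integral_eq_lintegral_ofReal (intervalIntegrable_effort hu h0 h1 a b).1
        (Eventually.of_forall h0)]
  have hfin : IsFiniteMeasure
      (((volume.restrict (Ioc s t)).withDensity fun τ => ENNReal.ofReal (u τ)).map θ) := by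
    refine ⟨?_⟩
    rw [Measure.map_apply hcont.measurable MeasurableSet.univ, preimage_univ,
      withDensity_apply _ MeasurableSet.univ, Measure.restrict_univ, hIoc s t hst]
    exact ENNReal.ofReal_lt_top
  refine Measure.ext_of_Iic _ _ fun a => ?_
  rw [Measure.map_apply hcont.measurable measurableSet_Iic,
    withDensity_apply _ (hcont.measurable measurableSet_Iic),
    Measure.restrict_restrict (hcont.measurable measurableSet_Iic),
    Measure.restrict_apply measurableSet_Iic]
  rcases lt_or_ge a (θ s) with ha | ha
  · have e1 : θ ⁻¹' Iic a ∩ Ioc s t = ∅ := by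
      ext τ
      simp only [mem_inter_iff, mem_preimage, mem_Iic, mem_Ioc, mem_empty_iff_false, iff_false]
      rintro ⟨h2, h3, -⟩
      exact absurd (ha.trans_le (hmono h3.le)) (not_lt.2 h2)
    have e2 : Iic a ∩ Ioc (θ s) (θ t) = ∅ := by
      ext τ
      simp only [mem_inter_iff, mem_Iic, mem_Ioc, mem_empty_iff_false, iff_false]
      rintro ⟨h2, h3, -⟩
      linarith
    rw [e1, e2]; simp
  · -- the last time in `[s, t]` at which the accumulated effort is at most `a`
    obtain ⟨c, hc, hcmax⟩ : ∃ c, IsGreatest (Icc s t ∩ θ ⁻¹' Iic a) c :=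
      (isCompact_Icc.inter_right (isClosed_Iic.preimage hcont)).exists_isGreatest
        ⟨s, ⟨le_rfl, hst⟩, ha⟩
    have e1 : θ ⁻¹' Iic a ∩ Ioc s t = Ioc s c := by
      ext τ
      constructor
      · rintro ⟨h2, h3⟩
        exact ⟨h3.1, hcmax ⟨⟨h3.1.le, h3.2⟩, h2⟩⟩
      · rintro ⟨h2, h3⟩
        exact ⟨(hmono h3).trans hc.2, h2, h3.trans hc.1.2⟩
    have e2 : Iic a ∩ Ioc (θ s) (θ t) = Ioc (θ s) (θ c) := by
      have : min a (θ t) = θ c := by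
        rcases hc.1.2.eq_or_lt with h | h
        · rw [← h]; exact min_eq_right hc.2
        · have h5 : θ c = a := by
            refine le_antisymm hc.2 (not_lt.1 fun hlt => ?_)
            obtain ⟨d, hd1, hd2⟩ : ∃ d, c < d ∧ d ≤ t ∧ θ d < a := by
              have := (hcont.tendsto c).eventually (gt_mem_nhds hlt)
              have h6 := (this.filter_mono (nhdsWithin_le_nhds (s := Ioi c))).and
                (Ioc_mem_nhdsGT h)
              obtain ⟨d, hd⟩ := h6.exists
              exact ⟨d, hd.2.1, hd.2.2, hd.1⟩
            have := hcmax ⟨⟨hc.1.1.trans hd1.le, hd2.1⟩, hd2.2.le⟩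
            linarith
          rw [h5, min_eq_left]
          rw [← h5]; exact hmono h.le
      rw [inter_comm, Ioc_inter_Iic, inf_comm, this]
    rw [e1, e2, hIoc s c hc.1.1, Real.volume_Ioc]

/-- Substitution of the accumulated effort, which is monotone but need not be injective, in an
integral of a function that need not be continuous. -/
theorem integral_comp_effort (hu : Measurable u) (h0 : ∀ t, 0 ≤ u t) (h1 : ∀ t, u t ≤ 1)
    {φ : ℝ → ℝ} (hφ : Measurable φ) (hφ0 : ∀ y, 0 ≤ φ y)
    (hint : ∀ a b, 0 ≤ a → 0 ≤ b → IntervalIntegrable φ volume a b) {s t : ℝ} (hs : 0 ≤ s)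
    (hst : s ≤ t) :
    IntervalIntegrable (fun τ => u τ * φ (∫ τ in (0 : ℝ)..τ, u τ)) volume s t ∧
    ∫ τ in s..t, u τ * φ (∫ τ in (0 : ℝ)..τ, u τ) =
      ∫ y in (∫ τ in (0 : ℝ)..s, u τ)..(∫ τ in (0 : ℝ)..t, u τ), φ y := by
  set θ : ℝ → ℝ := fun t => ∫ τ in (0 : ℝ)..t, u τ with hθ
  have hcont : Continuous θ := continuous_effort hu h0 h1
  have hmono : Monotone θ := monotone_effort hu h0 h1
  have hθ0 : 0 ≤ θ s := by
    have := hmono hs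
    simpa [hθ] using this
  have hm : Measurable fun τ => u τ * φ (θ τ) := hu.mul (hφ.comp hcont.measurable)
  have key : ∫⁻ τ in Ioc s t, ENNReal.ofReal (u τ * φ (θ τ)) =
      ∫⁻ y in Ioc (θ s) (θ t), ENNReal.ofReal (φ y) := by
    rw [← map_effort hu h0 h1 hst, lintegral_map hφ.ennreal_ofReal hcont.measurable,
      lintegral_withDensity_eq_lintegral_mul _ hu.ennreal_ofReal
        (show Measurable fun a => ENNReal.ofReal (φ (θ a)) from
          (hφ.comp hcont.measurable).ennreal_ofReal)]
    refine lintegral_congr fun τ => ?_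
    rw [ENNReal.ofReal_mul (h0 τ)]; rfl
  have hI := (hint (θ s) (θ t) hθ0 (hθ0.trans (hmono hst))).1
  have hfin : ∫⁻ τ in Ioc s t, ENNReal.ofReal (u τ * φ (θ τ)) < ⊤ := by
    rw [key]
    exact (hasFiniteIntegral_iff_ofReal (Eventually.of_forall hφ0)).1 hI.2
  refine ⟨(intervalIntegrable_iff_integrableOn_Ioc_of_le hst).2 ⟨hm.aestronglyMeasurable,
    (hasFiniteIntegral_iff_ofReal (Eventually.of_forall fun τ => mul_nonneg (h0 τ) (hφ0 _))).2
      hfin⟩, ?_⟩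
  rw [intervalIntegral.integral_of_le hst, intervalIntegral.integral_of_le (hmono hst),
    integral_eq_lintegral_of_nonneg_ae (Eventually.of_forall fun τ => mul_nonneg (h0 τ) (hφ0 _))
      hm.aestronglyMeasurable,
    integral_eq_lintegral_of_nonneg_ae (Eventually.of_forall hφ0) hφ.aestronglyMeasurable, key]

end TimeChange

/-- If on short intervals a function drops by at most an integral with frozen coefficients, then it
drops by at most the integral with varying coefficients. -/
theorem sub_le_sum_integral {Q : Type*} [Fintype Q] {ψ : ℝ → ℝ} {C h : Q → ℝ → ℝ} {b : ℝ}
    (hb : 0 ≤ b) (hψ : ContinuousOn ψ (Icc 0 b)) (hC : ∀ q, ContinuousOn (C q) (Icc 0 b))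
    (hh : ∀ q, IntervalIntegrable (h q) volume 0 b) (h0 : ∀ q t, 0 ≤ h q t)
    (step : ∀ s t, 0 ≤ s → s ≤ t → t ≤ b → ψ s - ψ t ≤ ∑ q, C q s * ∫ τ in s..t, h q τ) :
    ψ 0 - ψ b ≤ ∑ q, ∫ τ in (0 : ℝ)..b, C q τ * h q τ := by
  have hCh : ∀ q, IntervalIntegrable (fun τ => C q τ * h q τ) volume 0 b := fun q =>
    (hh q).continuousOn_mul (by rw [uIcc_of_le hb]; exact hC q)
  have hsub : ∀ {g : ℝ → ℝ}, IntervalIntegrable g volume 0 b → ∀ {s t : ℝ}, 0 ≤ s → s ≤ t →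
      t ≤ b → IntervalIntegrable g volume s t := fun hg s t hs hst ht =>
    hg.mono_set (by
      rw [uIcc_of_le hb, uIcc_of_le hst]; exact Icc_subset_Icc hs ht)
  have hprim : ∀ {g : ℝ → ℝ}, IntervalIntegrable g volume 0 b →
      ContinuousOn (fun t => ∫ τ in (0 : ℝ)..t, g τ) (Icc 0 b) := by
    intro g hg
    have := intervalIntegral.continuousOn_primitive_interval' hg (left_mem_uIcc)
    rwa [uIcc_of_le hb] at this
  have main : ∀ ε > 0, ψ 0 - ψ b ≤
      ∑ q, ((∫ τ in (0 : ℝ)..b, C q τ * h q τ) + ε * ∫ τ in (0 : ℝ)..b, h q τ) := by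
    intro ε hε
    set G : ℝ → ℝ := fun t => ∑ q, ((∫ τ in (0 : ℝ)..t, C q τ * h q τ) +
      ε * ∫ τ in (0 : ℝ)..t, h q τ) with hG
    have hGc : ContinuousOn G (Icc 0 b) := continuousOn_finsetSum _ fun q _ =>
      (hprim (hCh q)).add (continuousOn_const.mul (hprim (hh q)))
    set Z : Set ℝ := {t | ψ 0 - ψ t ≤ G t} with hZ
    suffices h : Icc 0 b ⊆ Z from h ⟨hb, le_rfl⟩
    refine IsClosed.Icc_subset_of_forall_exists_gt ?_ ?_ ?_
    · have : Z ∩ Icc 0 b = Icc 0 b ∩ {t | 0 ≤ G t - (ψ 0 - ψ t)} := by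
        ext t; simp [hZ, and_comm]
      rw [this]
      exact (hGc.sub (continuousOn_const.sub hψ)).preimage_isClosed_of_isClosed isClosed_Icc
        isClosed_Ici
    · simp [hZ, hG]
    · rintro s ⟨hsZ, hs0, hsb⟩ y hy
      have hev : ∀ᶠ t in 𝓝[>] s, ∀ q, C q s ≤ C q t + ε := by
        rw [eventually_all]
        intro q
        have h1 : Tendsto (C q) (𝓝[Icc 0 b] s) (𝓝 (C q s)) := hC q s ⟨hs0, hsb.le⟩
        have h2 : 𝓝[>] s ≤ 𝓝[Icc 0 b] s := by
          rw [nhdsWithin_le_iff]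
          exact mem_of_superset (Ioc_mem_nhdsGT hsb) fun t ht =>
            ⟨hs0.trans ht.1.le, ht.2⟩
        filter_upwards [(h1.mono_left h2).eventually (lt_mem_nhds (show C q s - ε < C q s by
          linarith))] with t ht
        linarith
      obtain ⟨v, hv, hvs⟩ := mem_nhdsGT_iff_exists_Ioc_subset.1 hev
      set t := min v (min b y) with ht
      have hst : s < t := lt_min hv (lt_min hsb hy)
      have htb : t ≤ b := (min_le_right _ _).trans (min_le_left _ _)
      have hty : t ≤ y := (min_le_right _ _).trans (min_le_right _ _)
      refine ⟨t, ?_, hst, hty⟩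
      have hGs : G t = G s + ∑ q, ((∫ τ in s..t, C q τ * h q τ) + ε * ∫ τ in s..t, h q τ) := by
        rw [hG]
        simp only
        rw [← Finset.sum_add_distrib]
        refine Finset.sum_congr rfl fun q _ => ?_
        rw [← intervalIntegral.integral_add_adjacent_intervals
          (hsub (hCh q) le_rfl hs0 hsb.le) (hsub (hCh q) hs0 hst.le htb),
          ← intervalIntegral.integral_add_adjacent_intervals
          (hsub (hh q) le_rfl hs0 hsb.le) (hsub (hh q) hs0 hst.le htb)]
        ring
      have hle : ∑ q, C q s * ∫ τ in s..t, h q τ ≤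
          ∑ q, ((∫ τ in s..t, C q τ * h q τ) + ε * ∫ τ in s..t, h q τ) := by
        refine Finset.sum_le_sum fun q _ => ?_
        have i1 := hsub (hh q) hs0 hst.le htb
        have i2 := hsub (hCh q) hs0 hst.le htb
        rw [← intervalIntegral.integral_const_mul, ← intervalIntegral.integral_const_mul,
          ← intervalIntegral.integral_add i2 (i1.const_mul ε)]
        rw [intervalIntegral.integral_of_le hst.le, intervalIntegral.integral_of_le hst.le]
        refine setIntegral_mono_on (i1.const_mul _).1 (i2.add (i1.const_mul ε)).1
          measurableSet_Ioc fun τ hτ => ?_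
        have h3 : C q s ≤ C q τ + ε := hvs ⟨hτ.1, hτ.2.trans (min_le_left _ _)⟩ q
        nlinarith [h0 q τ]
      have h4 := step s t hs0 hst.le htb
      have h5 : ψ 0 - ψ s ≤ G s := hsZ
      show ψ 0 - ψ t ≤ G t
      rw [hGs]; linarith
  have hlim : Tendsto (fun ε : ℝ => ∑ q, ((∫ τ in (0 : ℝ)..b, C q τ * h q τ) +
      ε * ∫ τ in (0 : ℝ)..b, h q τ)) (𝓝[>] 0)
      (𝓝 (∑ q, ((∫ τ in (0 : ℝ)..b, C q τ * h q τ) + 0 * ∫ τ in (0 : ℝ)..b, h q τ))) := by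
    refine Tendsto.mono_left (Continuous.tendsto ?_ 0) nhdsWithin_le_nhds
    fun_prop
  simp only [zero_mul, add_zero] at hlim
  exact ge_of_tendsto hlim (by filter_upwards [self_mem_nhdsWithin] with ε hε using main ε hε)

/-- A function whose increments are dominated by those of a continuous function is continuous. -/
theorem continuousOn_of_abs_sub_le {ψ G : ℝ → ℝ} (hG : ContinuousOn G (Ici 0))
    (h : ∀ s t, 0 ≤ s → s ≤ t → |ψ s - ψ t| ≤ G t - G s) : ContinuousOn ψ (Ici 0) := by
  intro s hs
  have h1 : ∀ t ∈ Ici (0 : ℝ), dist (ψ t) (ψ s) ≤ dist (G t) (G s) := by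
    intro t ht
    rw [Real.dist_eq, Real.dist_eq]
    rcases le_total s t with hst | hst
    · rw [abs_sub_comm]; exact (h s t hs hst).trans (le_abs_self _)
    · rw [abs_sub_comm (G t)]; exact (h t s ht hst).trans (le_abs_self _)
  refine tendsto_iff_dist_tendsto_zero.2 (squeeze_zero' (Eventually.of_forall fun t => dist_nonneg)
    ?_ (tendsto_iff_dist_tendsto_zero.1 (hG s hs)))
  filter_upwards [self_mem_nhdsWithin] with t ht using h1 t ht

end Multistage
end

noncomputable section

namespace Multistage

open Filter Topology
open scoped NNReal

namespace JobType

/-! ### The pairwise costs -/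

section PairCost

variable {S : Type*} [Fintype S] {J : JobType S} {i : S}

/-- The cost `∫ (d/dr) A_r(p) * (d/dr) A_r(q) dr` due to a pair of jobs. -/
def pairCost (J : JobType S) (p q : JobState S) : ℝ :=
  ∫ r in Ioi (0 : ℝ), J.slope p r * J.slope q r

theorem pairCost_comm (p q : JobState S) : J.pairCost p q = J.pairCost q p := by
  simp only [pairCost, mul_comm]

theorem pairCost_nonneg {p q : JobState S} (hp : J.Valid p) (hq : J.Valid q) :
    0 ≤ J.pairCost p q :=
  setIntegral_nonneg measurableSet_Ioi fun r _ => mul_nonneg (slope_nonneg hp r) (slope_nonneg hq r)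

theorem pairCost_fin_left {p : JobState S} (hp : p.1 = J.fin) (q : JobState S) :
    J.pairCost p q = 0 := by
  refine setIntegral_eq_zero_of_forall_eq_zero fun r hr => ?_
  obtain ⟨i, x⟩ := p
  simp only at hp
  rw [hp, slope_fin (le_of_lt hr), zero_mul]

theorem pairCost_fin_right (p : JobState S) {q : JobState S} (hq : q.1 = J.fin) :
    J.pairCost p q = 0 := by
  rw [pairCost_comm, pairCost_fin_left hq]

theorem integrableOn_slope_mul {p q : JobState S} (hp : J.Valid p) (hq : J.Valid q) :
    IntegrableOn (fun r => J.slope p r * J.slope q r) (Ioi 0) :=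
  (retirementCost_optCost hp).integrableOn_rightSlope_mul (retirementCost_optCost hq)

/-- The pairwise cost is the average of the optimal cost of one job over the reward, drawn from the
law whose tail is the slope of the other job. -/
theorem pairCost_eq {p q : JobState S} (hp : J.Valid p) (hq : J.Valid q) :
    J.pairCost p q = ∫ r, J.optCost p.1 p.2 r ∂(retirementCost_optCost hq).law :=
  (retirementCost_optCost hp).integral_rightSlope_mul (retirementCost_optCost hq)

/-- Serving one job of a pair for a while decreases the pairwise cost at rate one at most. This is the
inequality for a retired job, averaged over the rewards with the law of the other job. -/
theorem tail_mul_pairCost_le (hi : i ≠ J.fin) {x y : ℝ} (hx : 0 ≤ x) (hxy : x ≤ y)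
    {q : JobState S} (hq : J.Valid q) :
    J.tail i x * J.pairCost (i, x) q ≤ (∫ t in x..y, J.tail i t) +
      (J.tail i x - J.tail i y) * (∑ j, J.trans i j * J.pairCost (j, 0) q) +
      J.tail i y * J.pairCost (i, y) q := by
  have hs : 0 ≤ ∑ j, J.trans i j * J.pairCost (j, 0) q := Finset.sum_nonneg fun j _ =>
    mul_nonneg (J.trans_nonneg i j) (pairCost_nonneg (valid_zero j) hq)
  have hT' := tail_anti hi hx hxy
  rcases (tail_nonneg hi x).eq_or_lt with hT | hT
  · have hTy : J.tail i y = 0 := le_antisymm (hT ▸ hT') (tail_nonneg hi y)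
    rw [← hT, hTy]
    simpa using intervalIntegral_tail_nonneg hi hxy
  have hv : J.Valid (i, x) := fun _ => ⟨hx, hT⟩
  have hg := retirementCost_optCost hq
  have hprob := hg.isProbabilityMeasure_law
  have e1 : ∑ j, J.trans i j * J.pairCost (j, 0) q = ∫ r, J.nextCost i r ∂hg.law := by
    simp only [nextCost]
    rw [integral_finsetSum _ fun j _ =>
      ((retirementCost_optCost_zero j).integrable_law hg).const_mul _]
    refine Finset.sum_congr rfl fun j _ => ?_
    rw [integral_const_mul, pairCost_eq (valid_zero j) hq]
  have h2 : Integrable (fun r => (∫ t in x..y, J.tail i t) +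
      (J.tail i x - J.tail i y) * J.nextCost i r) hg.law :=
    (integrable_const _).add (((retirementCost_nextCost i).integrable_law hg).const_mul _)
  have e2 : ∫ r, ((∫ t in x..y, J.tail i t) +
      (J.tail i x - J.tail i y) * J.nextCost i r) ∂hg.law = (∫ t in x..y, J.tail i t) +
      (J.tail i x - J.tail i y) * ∫ r, J.nextCost i r ∂hg.law := by
    rw [integral_add (integrable_const _)
      (((retirementCost_nextCost i).integrable_law hg).const_mul _), integral_const_mul]
    simp
  have h3 : Integrable (fun r => J.tail i y * J.optCost i y r) hg.law ∧
      ∫ r, J.tail i y * J.optCost i y r ∂hg.law = J.tail i y * J.pairCost (i, y) q := by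
    rcases (tail_nonneg hi y).eq_or_lt with hTy | hTy
    · simp [← hTy]
    · have hvy : J.Valid (i, y) := fun _ => ⟨hx.trans hxy, hTy⟩
      rw [pairCost_eq hvy hq, integral_const_mul]
      exact ⟨((retirementCost_optCost hvy).integrable_law hg).const_mul _, rfl⟩
  rw [e1, ← h3.2, ← e2, ← integral_add h2 h3.1, pairCost_eq hv hq, ← integral_const_mul]
  exact integral_mono (((retirementCost_optCost hv).integrable_law hg).const_mul _)
    (h2.add h3.1) fun r => tail_mul_optCost_le hi r hx hxy

theorem tail_mul_pairCost_anti (hi : i ≠ J.fin) {x y : ℝ} (hx : 0 ≤ x) (hxy : x ≤ y)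
    {q : JobState S} (hq : J.Valid q) :
    J.tail i y * J.pairCost (i, y) q ≤ J.tail i x * J.pairCost (i, x) q := by
  rcases (tail_nonneg hi y).eq_or_lt with hTy | hTy
  · rw [← hTy, zero_mul]
    rcases (tail_nonneg hi x).eq_or_lt with hT | hT
    · rw [← hT, zero_mul]
    · exact mul_nonneg hT.le (pairCost_nonneg (fun _ => ⟨hx, hT⟩) hq)
  · have hvy : J.Valid (i, y) := fun _ => ⟨hx.trans hxy, hTy⟩
    have hv := valid_of_le hi hvy hx hxy
    rw [pairCost, pairCost, ← integral_const_mul, ← integral_const_mul]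
    refine integral_mono ((integrableOn_slope_mul hvy hq).const_mul _)
      ((integrableOn_slope_mul hv hq).const_mul _) fun r => ?_
    simp only [← mul_assoc]
    exact mul_le_mul_of_nonneg_right (tail_mul_slope_anti hi r hx hxy) (slope_nonneg hq r)

theorem pairCost_le_fullCost [DecidableEq S] {p q : JobState S} (hp : J.Valid p)
    (hq : J.Valid q) : J.pairCost p q ≤ J.fullCost p := by
  have hg := retirementCost_optCost hq
  have hprob := hg.isProbabilityMeasure_law
  rw [pairCost_eq hp hq]
  calc ∫ r, J.optCost p.1 p.2 r ∂hg.law ≤ ∫ _, J.fullCost p ∂hg.law :=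
        integral_mono ((retirementCost_optCost hp).integrable_law hg) (integrable_const _)
          fun r => optCost_le_fullCost hp r
    _ = J.fullCost p := by simp

theorem tendsto_tail_mul_pairCost [DecidableEq S] (hi : i ≠ J.fin) {q : JobState S}
    (hq : J.Valid q) : Tendsto (fun x => J.tail i x * J.pairCost (i, x) q) atTop (𝓝 0) := by
  have h1 : Tendsto (fun x => (∫ t in Ioi x, J.tail i t) + J.tail i x * J.nextFullCost i) atTop
      (𝓝 (0 + 0 * J.nextFullCost i)) :=
    (tendsto_integral_Ioi_tail hi).add ((tendsto_tail hi).mul_const _)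
  rw [zero_mul, zero_add] at h1
  refine squeeze_zero' ?_ ?_ h1
  · filter_upwards [eventually_ge_atTop 0] with x hx
    rcases (tail_nonneg hi x).eq_or_lt with hT | hT
    · rw [← hT, zero_mul]
    · exact mul_nonneg hT.le (pairCost_nonneg (fun _ => ⟨hx, hT⟩) hq)
  · filter_upwards [eventually_ge_atTop 0] with x hx
    rw [← tail_mul_fullCost hi hx]
    rcases (tail_nonneg hi x).eq_or_lt with hT | hT
    · rw [← hT, zero_mul, zero_mul]
    · exact mul_le_mul_of_nonneg_left (pairCost_le_fullCost (fun _ => ⟨hx, hT⟩) hq) hT.le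

end PairCost

/-- Splitting a sum over pairs into the pairs that contain `c` and the others. -/
theorem sum_pairs_eq {n : ℕ} (g : Fin n → Fin n → ℝ) (c : Fin n) :
    ∑ k, ∑ l ∈ Finset.Ioi k, g k l =
      ∑ l ∈ Finset.univ.erase c, (if c < l then g c l else g l c) +
        ∑ k ∈ Finset.univ.erase c, ∑ l ∈ Finset.univ.erase c, if k < l then g k l else 0 := by
  have h1 : ∀ k, ∑ l ∈ Finset.Ioi k, g k l = ∑ l, if k < l then g k l else 0 := by
    intro k
    rw [← Finset.sum_filter]
    congr 1
    ext l; simp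
  simp_rw [h1]
  rw [← Finset.add_sum_erase Finset.univ _ (Finset.mem_univ c)]
  have h2 : ∀ k, ∑ l, (if k < l then g k l else 0) = (if k < c then g k c else 0) +
      ∑ l ∈ Finset.univ.erase c, if k < l then g k l else 0 := fun k =>
    (Finset.add_sum_erase Finset.univ _ (Finset.mem_univ c)).symm
  simp_rw [h2]
  rw [Finset.sum_add_distrib, if_neg (lt_irrefl c), zero_add, ← add_assoc]
  congr 1
  rw [← Finset.sum_add_distrib]
  refine Finset.sum_congr rfl fun l hl => ?_
  rcases lt_or_gt_of_ne (Finset.ne_of_mem_erase hl) with h | h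
  · simp [h, not_lt.2 h.le]
  · simp [h, not_lt.2 h.le]

section Potential

variable {S : Type*} {n : ℕ}

/-- The system state after each job `k` has received the service `a k`. -/
def shift (s : SysState S n) (a : Fin n → ℝ) : SysState S n := fun k => ((s k).1, (s k).2 + a k)

theorem shift_update (s : SysState S n) (a : Fin n → ℝ) (c : Fin n) (b : ℝ) :
    shift s (Function.update a c b) =
      Function.update (shift s a) c ((s c).1, (s c).2 + b) := by
  ext k : 1
  by_cases h : k = c
  · subst h; simp [shift]
  · simp [shift, h]


variable [Fintype S] {J : JobType S}

/-- The sum of the pairwise costs of a system state. -/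
def totalCost (J : JobType S) (s : SysState S n) : ℝ :=
  ∑ k, ∑ l ∈ Finset.Ioi k, J.pairCost (s k) (s l)

/-- The pairwise costs that do not involve job `c`. -/
def totalCostExcept (J : JobType S) (s : SysState S n) (c : Fin n) : ℝ :=
  ∑ k ∈ Finset.univ.erase c, ∑ l ∈ Finset.univ.erase c,
    if k < l then J.pairCost (s k) (s l) else 0

theorem totalCost_update (s : SysState S n) (c : Fin n) (p : JobState S) :
    J.totalCost (Function.update s c p) =
      ∑ l ∈ Finset.univ.erase c, J.pairCost p (s l) + J.totalCostExcept s c := by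
  rw [totalCost, sum_pairs_eq _ c, totalCostExcept]
  congr 1
  · refine Finset.sum_congr rfl fun l hl => ?_
    have h := Finset.ne_of_mem_erase hl
    rw [Function.update_self, Function.update_of_ne h]
    split_ifs
    · rfl
    · exact pairCost_comm _ _
  · refine Finset.sum_congr rfl fun k hk => Finset.sum_congr rfl fun l hl => ?_
    rw [Function.update_of_ne (Finset.ne_of_mem_erase hk),
      Function.update_of_ne (Finset.ne_of_mem_erase hl)]

theorem totalCost_nonneg {s : SysState S n} (hs : ∀ k, J.Valid (s k)) : 0 ≤ J.totalCost s :=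
  Finset.sum_nonneg fun k _ => Finset.sum_nonneg fun l _ => pairCost_nonneg (hs k) (hs l)

theorem valid_update {s : SysState S n} (hs : ∀ k, J.Valid (s k)) (c : Fin n) {p : JobState S}
    (hp : J.Valid p) (k : Fin n) : J.Valid (Function.update s c p k) := by
  by_cases h : k = c
  · subst h; simpa using hp
  · simpa [h] using hs k

variable [DecidableEq S]

/-- The probability that job `p` finishes no stage during a service time `a`. -/
def survivalFactor (J : JobType S) (p : JobState S) (a : ℝ) : ℝ :=
  if p.1 = J.fin then 1 else J.tail p.1 (p.2 + a) / J.tail p.1 p.2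

/-- The probability that there is no jump while each job `k` receives the service `a k`. -/
def survivalAt (J : JobType S) (s : SysState S n) (a : Fin n → ℝ) : ℝ :=
  ∏ k, J.survivalFactor (s k) (a k)

/-- `survivalAt` without the factor of job `c`. -/
def survivalExcept (J : JobType S) (s : SysState S n) (a : Fin n → ℝ) (c : Fin n) : ℝ :=
  ∏ k ∈ Finset.univ.erase c, J.survivalFactor (s k) (a k)

/-- The sum of the pairwise costs after service `a`, on the event that there is no jump. -/
def potential (J : JobType S) (s : SysState S n) (a : Fin n → ℝ) : ℝ :=
  J.survivalAt s a * J.totalCost (shift s a)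

theorem survivalFactor_nonneg {p : JobState S} (a : ℝ) : 0 ≤ J.survivalFactor p a := by
  rw [survivalFactor]; split_ifs with h
  · exact zero_le_one
  · exact div_nonneg (tail_nonneg h _) (tail_nonneg h _)

theorem survivalFactor_zero {p : JobState S} (hp : J.Valid p) : J.survivalFactor p 0 = 1 := by
  rw [survivalFactor]; split_ifs with h
  · rfl
  · rw [add_zero, div_self (hp h).2.ne']

theorem survivalFactor_anti {p : JobState S} (hp : J.Valid p) {a b : ℝ} (ha : 0 ≤ a)
    (hab : a ≤ b) : J.survivalFactor p b ≤ J.survivalFactor p a := by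
  rw [survivalFactor, survivalFactor]; split_ifs with h
  · exact le_rfl
  · exact div_le_div_of_nonneg_right (tail_anti h (add_nonneg (hp h).1 ha) (by linarith))
      (hp h).2.le

theorem survivalExcept_nonneg (s : SysState S n) (a : Fin n → ℝ) (c : Fin n) :
    0 ≤ J.survivalExcept s a c := Finset.prod_nonneg fun _ _ => survivalFactor_nonneg _

theorem survivalAt_nonneg (s : SysState S n) (a : Fin n → ℝ) :
    0 ≤ J.survivalAt s a := Finset.prod_nonneg fun _ _ => survivalFactor_nonneg _

theorem survivalExcept_anti {s : SysState S n} (hs : ∀ k, J.Valid (s k)) {a b : Fin n → ℝ}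
    (ha : 0 ≤ a) (hab : a ≤ b) (c : Fin n) : J.survivalExcept s b c ≤ J.survivalExcept s a c :=
  Finset.prod_le_prod (fun _ _ => survivalFactor_nonneg _) fun k _ =>
    survivalFactor_anti (hs k) (ha k) (hab k)

theorem survivalAt_eq (s : SysState S n) (a : Fin n → ℝ) (c : Fin n) :
    J.survivalAt s a = J.survivalFactor (s c) (a c) * J.survivalExcept s a c :=
  (Finset.mul_prod_erase Finset.univ _ (Finset.mem_univ c)).symm

theorem survivalExcept_update (s : SysState S n) (a : Fin n → ℝ) (c : Fin n) (p : JobState S)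
    (b : ℝ) : J.survivalExcept (Function.update s c p) (Function.update a c b) c =
      J.survivalExcept s a c := by
  refine Finset.prod_congr rfl fun k hk => ?_
  rw [Function.update_of_ne (Finset.ne_of_mem_erase hk),
    Function.update_of_ne (Finset.ne_of_mem_erase hk)]

/-- Jobs that survive with positive probability are in valid states. -/
theorem valid_shift_of_survivalFactor_ne_zero {p : JobState S} (hp : J.Valid p) {a : ℝ}
    (ha : 0 ≤ a) (h : J.survivalFactor p a ≠ 0) : J.Valid (p.1, p.2 + a) := by
  intro hi
  rw [survivalFactor, if_neg hi] at h
  exact ⟨add_nonneg (hp hi).1 ha, (tail_nonneg hi _).lt_of_ne' (div_ne_zero_iff.1 h).1⟩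

theorem valid_shift_of_survivalExcept_ne_zero {s : SysState S n} (hs : ∀ k, J.Valid (s k))
    {a : Fin n → ℝ} (ha : 0 ≤ a) {c : Fin n} (h : J.survivalExcept s a c ≠ 0) {l : Fin n}
    (hl : l ∈ Finset.univ.erase c) : J.Valid (shift s a l) :=
  valid_shift_of_survivalFactor_ne_zero (hs l) (ha l) (Finset.prod_ne_zero_iff.1 h l hl)

theorem valid_shift_of_survivalAt_ne_zero {s : SysState S n} (hs : ∀ k, J.Valid (s k))
    {a : Fin n → ℝ} (ha : 0 ≤ a) (h : J.survivalAt s a ≠ 0) (l : Fin n) :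
    J.Valid (shift s a l) :=
  valid_shift_of_survivalFactor_ne_zero (hs l) (ha l)
    (Finset.prod_ne_zero_iff.1 h l (Finset.mem_univ l))

theorem potential_update (s : SysState S n) (a : Fin n → ℝ) (c : Fin n) (b : ℝ) :
    J.potential s (Function.update a c b) = J.survivalFactor (s c) b *
      (J.survivalExcept s a c *
        (∑ l ∈ Finset.univ.erase c, J.pairCost ((s c).1, (s c).2 + b) (shift s a l) +
          J.totalCostExcept (shift s a) c)) := by
  have h := survivalExcept_update (J := J) s a c (s c) b
  rw [Function.update_eq_self] at h
  rw [potential, survivalAt_eq s _ c, shift_update, totalCost_update, Function.update_self, h]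
  ring

theorem potential_jump (s : SysState S n) (a : Fin n → ℝ) (c : Fin n) (j : S) :
    J.potential (Function.update s c (j, 0)) (Function.update a c 0) =
      J.survivalExcept s a c *
        (∑ l ∈ Finset.univ.erase c, J.pairCost (j, 0) (shift s a l) +
          J.totalCostExcept (shift s a) c) := by
  have h2 : shift (Function.update s c (j, (0 : ℝ))) (Function.update a c 0) =
      Function.update (shift s a) c (j, 0) := by
    ext k : 1
    by_cases h : k = c
    · subst h; simp [shift]
    · simp [shift, h]
  rw [potential, survivalAt_eq _ _ c, survivalExcept_update, h2, totalCost_update,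
    Function.update_self, Function.update_self, survivalFactor_zero (valid_zero j), one_mul]

/-- The number of jobs in the system, other than job `c`. -/
def numOthers (J : JobType S) (s : SysState S n) (c : Fin n) : ℝ :=
  ∑ l ∈ Finset.univ.erase c, if (s l).1 = J.fin then 0 else 1

theorem numOthers_nonneg (s : SysState S n) (c : Fin n) : 0 ≤ J.numOthers s c :=
  Finset.sum_nonneg fun l _ => by split_ifs <;> norm_num

/-- The expected potential after job `c` completes its stage. -/
def jumpPotential (J : JobType S) (s : SysState S n) (a : Fin n → ℝ) (c : Fin n) : ℝ :=
  ∑ j, J.trans (s c).1 j *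
    J.potential (Function.update s c (j, 0)) (Function.update a c 0)

/-- The decrease of the potential when a single job is served: each of the pairs that contain this job
contributes its service time at most, and the rest flows out through the completion of its stage. -/
theorem potential_update_sub_le {s : SysState S n} (hs : ∀ k, J.Valid (s k)) {a : Fin n → ℝ}
    (ha : 0 ≤ a) {c : Fin n} (hc : (s c).1 ≠ J.fin) {b b' : ℝ} (hb : 0 ≤ b) (hbb : b ≤ b') :
    J.potential s (Function.update a c b) - J.potential s (Function.update a c b') ≤
      J.survivalExcept s a c * J.numOthers s c *
        ((∫ t in (s c).2 + b..(s c).2 + b', J.tail (s c).1 t) / J.tail (s c).1 (s c).2) +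
      J.jumpPotential s a c *
        ((J.tail (s c).1 ((s c).2 + b) - J.tail (s c).1 ((s c).2 + b')) /
          J.tail (s c).1 (s c).2) := by
  obtain ⟨hx, hT⟩ := hs c hc
  have hb0 := add_nonneg hx hb
  have hbb' : (s c).2 + b ≤ (s c).2 + b' := by linarith
  set i := (s c).1 with hi
  set x := (s c).2 with hxx
  set E := J.survivalExcept s a c with hE
  set R := J.totalCostExcept (shift s a) c with hR
  set I := ∫ t in x + b..x + b', J.tail i t with hI
  rw [potential_update, potential_update, jumpPotential]
  simp only [potential_jump, ← hi, ← hxx, ← hE, ← hR]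
  rcases eq_or_ne E 0 with h0 | h0
  · simp [h0]
  have hE0 : 0 ≤ E := survivalExcept_nonneg s a c
  have hv : ∀ l ∈ Finset.univ.erase c, J.Valid (shift s a l) := fun l hl =>
    valid_shift_of_survivalExcept_ne_zero hs ha h0 hl
  have e1 : J.survivalFactor (s c) b = J.tail i (x + b) / J.tail i x := if_neg hc
  have e2 : J.survivalFactor (s c) b' = J.tail i (x + b') / J.tail i x := if_neg hc
  have e3 : ∑ j, J.trans i j * (E * (∑ l ∈ Finset.univ.erase c,
      J.pairCost (j, 0) (shift s a l) + R)) = E * (∑ l ∈ Finset.univ.erase c,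
        (∑ j, J.trans i j * J.pairCost (j, 0) (shift s a l)) + R) := by
    rw [Finset.sum_comm]
    simp_rw [← Finset.mul_sum]
    have : E * R = ∑ j, J.trans i j * (E * R) := by
      rw [← Finset.sum_mul, J.trans_sum, one_mul]
    rw [mul_add, this, Finset.mul_sum, ← Finset.sum_add_distrib]
    refine Finset.sum_congr rfl fun j _ => ?_
    ring
  have key : ∑ l ∈ Finset.univ.erase c, J.tail i (x + b) *
      J.pairCost (i, x + b) (shift s a l) ≤
      J.numOthers s c * I + (J.tail i (x + b) - J.tail i (x + b')) *
        (∑ l ∈ Finset.univ.erase c, ∑ j, J.trans i j * J.pairCost (j, 0) (shift s a l)) +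
      ∑ l ∈ Finset.univ.erase c, J.tail i (x + b') *
        J.pairCost (i, x + b') (shift s a l) := by
    rw [numOthers, Finset.sum_mul, Finset.mul_sum, ← Finset.sum_add_distrib,
      ← Finset.sum_add_distrib]
    refine Finset.sum_le_sum fun l hl => ?_
    by_cases hl' : (s l).1 = J.fin
    · have : (shift s a l).1 = J.fin := hl'
      simp [pairCost_fin_right _ this, hl']
    · rw [if_neg hl', one_mul]
      exact tail_mul_pairCost_le hc hb0 hbb' (hv l hl)
  rw [← Finset.mul_sum, ← Finset.mul_sum] at key
  rw [e1, e2, e3, ← sub_nonneg]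
  have := mul_nonneg (div_nonneg hE0 hT.le) (sub_nonneg.2 key)
  refine this.trans_eq ?_
  field_simp
  ring

theorem potential_update_anti {s : SysState S n} (hs : ∀ k, J.Valid (s k)) {a : Fin n → ℝ}
    (ha : 0 ≤ a) (c : Fin n) {b b' : ℝ} (hb : 0 ≤ b) (hbb : b ≤ b') :
    J.potential s (Function.update a c b') ≤ J.potential s (Function.update a c b) := by
  rw [potential_update, potential_update]
  by_cases hc : (s c).1 = J.fin
  · rw [survivalFactor, survivalFactor, if_pos hc, if_pos hc]
    have h0 : ∀ y q, J.pairCost ((s c).1, y) q = 0 := fun y q =>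
      pairCost_fin_left (p := ((s c).1, y)) hc q
    simp only [h0]
    exact le_rfl
  rcases eq_or_ne (J.survivalExcept s a c) 0 with h0 | h0
  · simp [h0]
  have hv : ∀ l ∈ Finset.univ.erase c, J.Valid (shift s a l) := fun l hl =>
    valid_shift_of_survivalExcept_ne_zero hs ha h0 hl
  obtain ⟨hx, hT⟩ := hs c hc
  have hR : 0 ≤ J.totalCostExcept (shift s a) c := by
    refine Finset.sum_nonneg fun k hk => Finset.sum_nonneg fun l hl => ?_
    split_ifs
    · exact pairCost_nonneg (hv k hk) (hv l hl)
    · exact le_rfl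
  have h1 := mul_le_mul_of_nonneg_right (survivalFactor_anti (hs c) hb hbb) hR
  have h2 : J.survivalFactor (s c) b' *
      ∑ l ∈ Finset.univ.erase c, J.pairCost ((s c).1, (s c).2 + b') (shift s a l) ≤
      J.survivalFactor (s c) b *
      ∑ l ∈ Finset.univ.erase c, J.pairCost ((s c).1, (s c).2 + b) (shift s a l) := by
    rw [Finset.mul_sum, Finset.mul_sum]
    refine Finset.sum_le_sum fun l hl => ?_
    rw [survivalFactor, survivalFactor, if_neg hc, if_neg hc, div_mul_eq_mul_div,
      div_mul_eq_mul_div]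
    exact div_le_div_of_nonneg_right (tail_mul_pairCost_anti hc (add_nonneg hx hb)
      (by linarith) (hv l hl)) hT.le
  have h3 := mul_le_mul_of_nonneg_left (add_le_add h2 h1) (survivalExcept_nonneg (J := J) s a c)
  linarith

theorem piecewise_nonneg {a b : Fin n → ℝ} (ha : 0 ≤ a) (hb : 0 ≤ b) (A : Finset (Fin n)) :
    0 ≤ A.piecewise b a := fun k => by
  by_cases h : k ∈ A
  · simpa [h] using hb k
  · simpa [h] using ha k

theorem potential_anti {s : SysState S n} (hs : ∀ k, J.Valid (s k)) {a b : Fin n → ℝ}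
    (ha : 0 ≤ a) (hab : a ≤ b) : J.potential s b ≤ J.potential s a := by
  have h : ∀ A : Finset (Fin n), J.potential s (A.piecewise b a) ≤ J.potential s a := by
    intro A
    induction A using Finset.induction_on with
    | empty => simp
    | insert c A hc ih =>
      refine le_trans ?_ ih
      rw [Finset.piecewise_insert]
      have h1 := potential_update_anti hs (piecewise_nonneg ha (ha.trans hab) A) c (ha c) (hab c)
      have h2 : Function.update (A.piecewise b a) c (a c) = A.piecewise b a := by
        rw [Function.update_eq_self_iff]; simp [hc]
      rwa [h2] at h1
  simpa using h Finset.univ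

theorem jumpPotential_anti {s : SysState S n} (hs : ∀ k, J.Valid (s k)) {a b : Fin n → ℝ}
    (ha : 0 ≤ a) (hab : a ≤ b) (c : Fin n) : J.jumpPotential s b c ≤ J.jumpPotential s a c := by
  refine Finset.sum_le_sum fun j _ => mul_le_mul_of_nonneg_left ?_ (J.trans_nonneg _ j)
  refine potential_anti (valid_update hs c (valid_zero j)) (fun k => ?_) (fun k => ?_)
  · by_cases h : k = c
    · subst h; simp
    · simpa [h] using ha k
  · by_cases h : k = c
    · subst h; simp
    · simpa [h] using hab k

/-- If only jobs that are present are served, the potential decreases at most by the cost paid and by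
what flows out through jumps, both estimated at the beginning. -/
theorem potential_sub_le {s : SysState S n} (hs : ∀ k, J.Valid (s k)) {a b : Fin n → ℝ}
    (ha : 0 ≤ a) (hab : a ≤ b) (hfin : ∀ k, (s k).1 = J.fin → a k = b k) :
    J.potential s a - J.potential s b ≤ ∑ c, if (s c).1 = J.fin then 0 else
      (J.survivalExcept s a c * J.numOthers s c *
        ((∫ t in (s c).2 + a c..(s c).2 + b c, J.tail (s c).1 t) / J.tail (s c).1 (s c).2) +
      J.jumpPotential s a c *
        ((J.tail (s c).1 ((s c).2 + a c) - J.tail (s c).1 ((s c).2 + b c)) /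
          J.tail (s c).1 (s c).2)) := by
  have h : ∀ A : Finset (Fin n), J.potential s a - J.potential s (A.piecewise b a) ≤
      ∑ c ∈ A, if (s c).1 = J.fin then 0 else
      (J.survivalExcept s a c * J.numOthers s c *
        ((∫ t in (s c).2 + a c..(s c).2 + b c, J.tail (s c).1 t) / J.tail (s c).1 (s c).2) +
      J.jumpPotential s a c *
        ((J.tail (s c).1 ((s c).2 + a c) - J.tail (s c).1 ((s c).2 + b c)) /
          J.tail (s c).1 (s c).2)) := by
    intro A
    induction A using Finset.induction_on with
    | empty => simp
    | insert c A hc ih =>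
      rw [Finset.piecewise_insert, Finset.sum_insert hc]
      have hA0 := piecewise_nonneg ha (ha.trans hab) A
      have hA : a ≤ A.piecewise b a := fun k => by
        by_cases h : k ∈ A
        · simpa [h] using hab k
        · simp [h]
      have h2 : Function.update (A.piecewise b a) c (a c) = A.piecewise b a := by
        rw [Function.update_eq_self_iff]; simp [hc]
      by_cases hf : (s c).1 = J.fin
      · rw [if_pos hf, ← hfin c hf, h2, zero_add]; exact ih
      · rw [if_neg hf]
        have h3 := potential_update_sub_le hs hA0 hf (ha c) (hab c)
        rw [h2] at h3
        obtain ⟨hx, hT⟩ := hs c hf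
        have hxa := add_nonneg hx (ha c)
        have hxab : (s c).2 + a c ≤ (s c).2 + b c := by linarith [hab c]
        have h4 : 0 ≤ (∫ t in (s c).2 + a c..(s c).2 + b c, J.tail (s c).1 t) /
            J.tail (s c).1 (s c).2 := div_nonneg (intervalIntegral_tail_nonneg hf hxab) hT.le
        have h5 : 0 ≤ (J.tail (s c).1 ((s c).2 + a c) - J.tail (s c).1 ((s c).2 + b c)) /
            J.tail (s c).1 (s c).2 := div_nonneg (sub_nonneg.2 (tail_anti hf hxa hxab)) hT.le
        have h6 := mul_le_mul_of_nonneg_right (mul_le_mul_of_nonneg_right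
          (survivalExcept_anti hs ha hA c) (numOthers_nonneg (J := J) s c)) h4
        have h7 := mul_le_mul_of_nonneg_right (jumpPotential_anti hs ha hA c) h5
        linarith
  simpa using h Finset.univ

end Potential

end JobType
end Multistage
end

noncomputable section

namespace Multistage

open Filter Topology
open scoped NNReal

namespace JobType

/-! ### The pairwise cost is a lower bound -/

section Rank

variable {S : Type*} [Fintype S] (J : JobType S)

/-- The number of stages that can be reached from a stage bounds the number of jumps of a job. -/
def rank (i : S) : ℕ :=
  Set.ncard {j | Relation.TransGen (fun a b => a ≠ J.fin ∧ 0 < J.trans a b) i j}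

variable {J}

theorem rank_lt {i j : S} (hi : i ≠ J.fin) (hj : 0 < J.trans i j) : J.rank j < J.rank i := by
  refine Set.ncard_lt_ncard ?_ (Set.toFinite _)
  refine ⟨fun k hk => Relation.TransGen.head ⟨hi, hj⟩ hk, fun h => ?_⟩
  exact J.acyclic j (h (Relation.TransGen.single ⟨hi, hj⟩))

theorem eq_fin_of_rank_eq_zero {i : S} (h : J.rank i = 0) : i = J.fin := by
  by_contra hi
  have h1 : ∑ j, J.trans i j ≠ 0 := by rw [J.trans_sum]; exact one_ne_zero
  obtain ⟨j, -, hj⟩ := Finset.exists_ne_zero_of_sum_ne_zero h1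
  have := rank_lt hi ((J.trans_nonneg i j).lt_of_ne' hj)
  omega

end Rank

variable {S : Type*} [Fintype S] {J : JobType S}

theorem intervalIntegrable_liveDensity {i : S} (hi : i ≠ J.fin) {x y : ℝ} (hx : 0 ≤ x)
    (hy : 0 ≤ y) : IntervalIntegrable (J.liveDensity i) volume x y := by
  refine (intervalIntegrable_density hi hx hy).congr_ae ?_
  have h := hazard_mul_tail_ae hi
  exact (ae_restrict_of_ae_restrict_of_subset
    (show uIoc x y ⊆ Ioi 0 from fun t ht => lt_of_le_of_lt (le_min hx hy) ht.1) h).mono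
      fun t ht => ht.symm

theorem measurable_liveDensity {i : S} (hi : i ≠ J.fin) :
    Measurable fun y => J.liveDensity i (max y 0) :=
  (((J.density_measurable i hi).comp (measurable_id.max measurable_const)).div
    (measurable_tail hi)).mul (measurable_tail hi)

theorem continuousOn_tail_comp {i : S} (hi : i ≠ J.fin) {x : ℝ} (hx : 0 ≤ x) {θ : ℝ → ℝ}
    (hθ : Continuous θ) (hm : Monotone θ) (h0 : 0 ≤ θ 0) :
    ContinuousOn (fun t => J.tail i (x + θ t)) (Ici 0) :=
  (continuousOn_tail hi).comp (continuous_const.add hθ).continuousOn fun _ ht =>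
    add_nonneg hx (h0.trans (hm ht))

/-- `integral_comp_effort` for a density of the age of a job that starts at age `x`.  Nothing is known
about `φ` at negative ages, whence the `max` in the measurability assumption. -/
theorem integral_effort_scaled {φ : ℝ → ℝ} (hφ : Measurable fun y => φ (max y 0))
    (hφ0 : ∀ y, 0 ≤ φ y)
    (hint : ∀ a b, 0 ≤ a → 0 ≤ b → IntervalIntegrable φ volume a b) {u : ℝ → ℝ}
    (hu : Measurable u) (h0 : ∀ t, 0 ≤ u t) (h1 : ∀ t, u t ≤ 1) {x T : ℝ} (hx : 0 ≤ x)
    (hT : 0 < T) {s t : ℝ} (hs : 0 ≤ s) (hst : s ≤ t) :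
    IntervalIntegrable (fun τ => u τ * (φ (x + ∫ τ in (0 : ℝ)..τ, u τ) / T)) volume s t ∧
    ∫ τ in s..t, u τ * (φ (x + ∫ τ in (0 : ℝ)..τ, u τ) / T) =
      (∫ y in x + (∫ τ in (0 : ℝ)..s, u τ)..x + (∫ τ in (0 : ℝ)..t, u τ), φ y) / T := by
  set θ : ℝ → ℝ := fun t => ∫ τ in (0 : ℝ)..t, u τ with hθ
  have hmono : Monotone θ := monotone_effort hu h0 h1
  have hθ0 : ∀ t, 0 ≤ t → 0 ≤ θ t := fun t ht => by
    have := hmono ht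
    simpa [hθ] using this
  have hmax : ∀ y, 0 ≤ y → max (x + y) 0 = x + y := fun y hy =>
    max_eq_left (add_nonneg hx hy)
  obtain ⟨h2, h3⟩ := integral_comp_effort hu h0 h1 (φ := fun y => φ (max (x + y) 0) / T)
    ((hφ.comp (measurable_const.add measurable_id)).div_const T)
    (fun y => div_nonneg (hφ0 _) hT.le) (fun a b ha hb => by
      have h4 := ((hint (x + a) (x + b) (add_nonneg hx ha) (add_nonneg hx hb)).comp_add_left
        (c := x)).div_const T
      simp only [add_sub_cancel_left] at h4
      refine h4.congr fun y hy => ?_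
      have : 0 ≤ y := (le_min ha hb).trans hy.1.le
      simp only [hmax y this]) hs hst
  have e1 : ∀ τ ∈ uIoc s t, u τ * (φ (max (x + θ τ) 0) / T) = u τ * (φ (x + θ τ) / T) := by
    intro τ hτ
    rw [uIoc_of_le hst] at hτ
    rw [hmax _ (hθ0 τ (hs.trans hτ.1.le))]
  refine ⟨h2.congr e1, ?_⟩
  rw [← intervalIntegral.integral_comp_add_left (fun y => φ y) x, ← intervalIntegral.integral_div]
  have e2 : ∫ y in θ s..θ t, φ (x + y) / T = ∫ y in θ s..θ t, φ (max (x + y) 0) / T := by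
    refine intervalIntegral.integral_congr fun y hy => ?_
    rw [uIcc_of_le (hmono hst)] at hy
    simp only [hmax y ((hθ0 s hs).trans hy.1)]
  rw [e2, ← h3]
  refine intervalIntegral.integral_congr_ae (Eventually.of_forall fun τ hτ => (e1 τ hτ).symm)

variable {n : ℕ} [DecidableEq S]

theorem continuousOn_survivalFactor {p : JobState S} (hp : J.Valid p) {θ : ℝ → ℝ}
    (hθ : Continuous θ) (hm : Monotone θ) (h0 : 0 ≤ θ 0) :
    ContinuousOn (fun t => J.survivalFactor p (θ t)) (Ici 0) := by
  by_cases hi : p.1 = J.fin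
  · simp only [survivalFactor, if_pos hi]; exact continuousOn_const
  · simp only [survivalFactor, if_neg hi]
    exact (continuousOn_tail_comp hi (hp hi).1 hθ hm h0).div_const _

theorem continuousOn_survivalExcept {s : SysState S n} (hs : ∀ k, J.Valid (s k))
    {θ : ℝ → Fin n → ℝ} (hθ : ∀ k, Continuous fun t => θ t k) (hm : Monotone θ) (h0 : 0 ≤ θ 0)
    (c : Fin n) : ContinuousOn (fun t => J.survivalExcept s (θ t) c) (Ici 0) :=
  continuousOn_finsetProd _ fun k _ =>
    continuousOn_survivalFactor (hs k) (hθ k) (fun _ _ h => hm h k) (h0 k)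

theorem continuousOn_survivalAt {s : SysState S n} (hs : ∀ k, J.Valid (s k))
    {θ : ℝ → Fin n → ℝ} (hθ : ∀ k, Continuous fun t => θ t k) (hm : Monotone θ) (h0 : 0 ≤ θ 0) :
    ContinuousOn (fun t => J.survivalAt s (θ t)) (Ici 0) :=
  continuousOn_finsetProd _ fun k _ =>
    continuousOn_survivalFactor (hs k) (hθ k) (fun _ _ h => hm h k) (h0 k)

theorem continuousOn_potential {s : SysState S n} (hs : ∀ k, J.Valid (s k))
    {θ : ℝ → Fin n → ℝ} (hθ : ∀ k, Continuous fun t => θ t k) (hm : Monotone θ) (h0 : 0 ≤ θ 0)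
    (hfin : ∀ k, (s k).1 = J.fin → ∀ t t', θ t k = θ t' k) :
    ContinuousOn (fun t => J.potential s (θ t)) (Ici 0) := by
  refine continuousOn_of_abs_sub_le (G := fun t => ∑ c, if (s c).1 = J.fin then 0 else
    (J.survivalExcept s 0 c * J.numOthers s c * (θ t c / J.tail (s c).1 (s c).2) -
      J.jumpPotential s 0 c * (J.tail (s c).1 ((s c).2 + θ t c) / J.tail (s c).1 (s c).2))) ?_ ?_
  · refine continuousOn_finsetSum _ fun c _ => ?_
    split_ifs with hc
    · exact continuousOn_const
    · exact (continuousOn_const.mul ((hθ c).continuousOn.div_const _)).sub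
        (continuousOn_const.mul ((continuousOn_tail_comp hc (hs c hc).1 (hθ c)
          (fun _ _ h => hm h c) (h0 c)).div_const _))
  · intro t t' ht htt
    have hθt : 0 ≤ θ t := h0.trans (hm ht)
    rw [abs_of_nonneg (sub_nonneg.2 (potential_anti hs hθt (hm htt)))]
    refine (potential_sub_le hs hθt (hm htt) fun k hk => hfin k hk t t').trans ?_
    rw [← Finset.sum_sub_distrib]
    refine Finset.sum_le_sum fun c _ => ?_
    split_ifs with hc
    · simp
    obtain ⟨hx, hT⟩ := hs c hc
    have hle : (s c).2 + θ t c ≤ (s c).2 + θ t' c := by linarith [hm htt c]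
    have hxa := add_nonneg hx (hθt c)
    have h1 : (∫ y in (s c).2 + θ t c..(s c).2 + θ t' c, J.tail (s c).1 y) ≤ θ t' c - θ t c := by
      calc _ ≤ ∫ y in (s c).2 + θ t c..(s c).2 + θ t' c, (1 : ℝ) :=
            intervalIntegral.integral_mono_on hle
              (intervalIntegrable_tail hc hxa (hxa.trans hle)) intervalIntegrable_const
              fun y hy => tail_le_one hc (hxa.trans hy.1)
        _ = _ := by simp
    have h2 := div_le_div_of_nonneg_right h1 hT.le
    have h4 : 0 ≤ (∫ y in (s c).2 + θ t c..(s c).2 + θ t' c, J.tail (s c).1 y) /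
        J.tail (s c).1 (s c).2 := div_nonneg (intervalIntegral_tail_nonneg hc hle) hT.le
    have h5 : 0 ≤ (J.tail (s c).1 ((s c).2 + θ t c) - J.tail (s c).1 ((s c).2 + θ t' c)) /
        J.tail (s c).1 (s c).2 := div_nonneg (sub_nonneg.2 (tail_anti hc hxa hle)) hT.le
    have hN := numOthers_nonneg (J := J) s c
    have h6 := mul_le_mul_of_nonneg_right (mul_le_mul_of_nonneg_right
      (survivalExcept_anti hs le_rfl hθt c) hN) h4
    have h7 := mul_le_mul_of_nonneg_right (jumpPotential_anti hs le_rfl hθt c) h5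
    have h8 := mul_le_mul_of_nonneg_left h2
      (mul_nonneg (survivalExcept_nonneg (J := J) s 0 c) hN)
    rw [sub_div] at h7 h8 ⊢
    linarith

theorem continuousOn_jumpPotential {s : SysState S n} (hs : ∀ k, J.Valid (s k))
    {θ : ℝ → Fin n → ℝ} (hθ : ∀ k, Continuous fun t => θ t k) (hm : Monotone θ) (h0 : 0 ≤ θ 0)
    (hfin : ∀ k, (s k).1 = J.fin → ∀ t t', θ t k = θ t' k) (c : Fin n) :
    ContinuousOn (fun t => J.jumpPotential s (θ t) c) (Ici 0) := by
  refine continuousOn_finsetSum _ fun j _ => continuousOn_const.mul ?_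
  refine continuousOn_potential (θ := fun t => Function.update (θ t) c 0)
    (valid_update hs c (valid_zero j)) (fun k => ?_) (fun t t' h k => ?_) (fun k => ?_)
    fun k hk t t' => ?_
  all_goals by_cases hkc : k = c
  · subst hkc; simp only [Function.update_self]; exact continuous_const
  · simp only [Function.update_of_ne hkc]; exact hθ k
  · subst hkc; simp
  · simpa [hkc] using hm h k
  · subst hkc; simp
  · simpa [hkc] using h0 k
  · subst hkc; simp
  · simp only [Function.update_of_ne hkc] at hk ⊢
    exact hfin k hk t t'

/-- The rate at which cost is paid and at which the potential flows out through jumps. -/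
def outflow (J : JobType S) (s : SysState S n) (u : Fin n → ℝ → ℝ) (t : ℝ) : ℝ :=
  ∑ c, if (s c).1 = J.fin then 0 else
    (J.survivalExcept s (fun k => ∫ τ in (0 : ℝ)..t, u k τ) c * J.numOthers s c *
      (u c t * (J.tail (s c).1 ((s c).2 + ∫ τ in (0 : ℝ)..t, u c τ) / J.tail (s c).1 (s c).2)) +
    J.jumpPotential s (fun k => ∫ τ in (0 : ℝ)..t, u k τ) c *
      (u c t * (J.liveDensity (s c).1 ((s c).2 + ∫ τ in (0 : ℝ)..t, u c τ) /
        J.tail (s c).1 (s c).2)))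

/-- Along any way of sharing the effort, the potential decreases at most by its outflow. -/
theorem potential_sub_le_integral {s : SysState S n} (hs : ∀ k, J.Valid (s k))
    {u : Fin n → ℝ → ℝ} (hu : ∀ k, Measurable (u k)) (h0 : ∀ k t, 0 ≤ u k t)
    (h1 : ∀ k t, u k t ≤ 1) (hfin : ∀ k, (s k).1 = J.fin → ∀ t, u k t = 0) {b : ℝ} (hb : 0 ≤ b) :
    IntervalIntegrable (J.outflow s u) volume 0 b ∧
    J.potential s 0 - J.potential s (fun k => ∫ τ in (0 : ℝ)..b, u k τ) ≤
      ∫ t in (0 : ℝ)..b, J.outflow s u t := by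
  set θ : ℝ → Fin n → ℝ := fun t k => ∫ τ in (0 : ℝ)..t, u k τ with hθdef
  have hθ : ∀ k, Continuous fun t => θ t k := fun k => continuous_effort (hu k) (h0 k) (h1 k)
  have hm : Monotone θ := fun t t' h k => monotone_effort (hu k) (h0 k) (h1 k) h
  have hθ0 : θ 0 = 0 := by ext k; simp [hθdef]
  have hfin' : ∀ k, (s k).1 = J.fin → ∀ t t', θ t k = θ t' k := fun k hk t t' => by
    simp [hθdef, hfin k hk]
  set C : Fin n ⊕ Fin n → ℝ → ℝ := Sum.elim
    (fun c t => J.survivalExcept s (θ t) c * J.numOthers s c)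
    (fun c t => J.jumpPotential s (θ t) c) with hC
  set h : Fin n ⊕ Fin n → ℝ → ℝ := Sum.elim
    (fun c t => if (s c).1 = J.fin then 0 else
      u c t * (J.tail (s c).1 ((s c).2 + θ t c) / J.tail (s c).1 (s c).2))
    (fun c t => if (s c).1 = J.fin then 0 else
      u c t * (J.liveDensity (s c).1 ((s c).2 + θ t c) / J.tail (s c).1 (s c).2)) with hh
  have hout : ∀ t, J.outflow s u t = ∑ q, C q t * h q t := by
    intro t
    rw [Fintype.sum_sum_type, ← Finset.sum_add_distrib]
    refine Finset.sum_congr rfl fun c _ => ?_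
    by_cases hc : (s c).1 = J.fin
    · simp [hh, hc]
    · simp [hh, hC, hc, hθdef]
  have hint1 : ∀ c, (s c).1 ≠ J.fin → ∀ {t t' : ℝ}, 0 ≤ t → t ≤ t' → _ := fun c hc {t t'} ht htt =>
    integral_effort_scaled (measurable_tail hc) (tail_nonneg hc)
      (fun a b ha hb => intervalIntegrable_tail hc ha hb) (hu c) (h0 c) (h1 c) (hs c hc).1
      (hs c hc).2 ht htt
  have hint2 : ∀ c, (s c).1 ≠ J.fin → ∀ {t t' : ℝ}, 0 ≤ t → t ≤ t' → _ := fun c hc {t t'} ht htt =>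
    integral_effort_scaled (measurable_liveDensity hc) (liveDensity_nonneg hc)
      (fun a b ha hb => intervalIntegrable_liveDensity hc ha hb) (hu c) (h0 c) (h1 c) (hs c hc).1
      (hs c hc).2 ht htt
  have hcont : ∀ q, ContinuousOn (C q) (Icc 0 b) := by
    rintro (c | c)
    · exact ((continuousOn_survivalExcept hs hθ hm hθ0.symm.le c).mul continuousOn_const).mono
        Icc_subset_Ici_self
    · exact (continuousOn_jumpPotential hs hθ hm hθ0.symm.le hfin' c).mono Icc_subset_Ici_self
  have hhint : ∀ q, IntervalIntegrable (h q) volume 0 b := by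
    rintro (c | c)
    · by_cases hc : (s c).1 = J.fin
      · simp only [hh, Sum.elim_inl, if_pos hc]; exact intervalIntegrable_const
      · simp only [hh, Sum.elim_inl, if_neg hc]; exact (hint1 c hc le_rfl hb).1
    · by_cases hc : (s c).1 = J.fin
      · simp only [hh, Sum.elim_inr, if_pos hc]; exact intervalIntegrable_const
      · simp only [hh, Sum.elim_inr, if_neg hc]; exact (hint2 c hc le_rfl hb).1
  have hCh : ∀ q ∈ Finset.univ, IntervalIntegrable (fun t => C q t * h q t) volume 0 b :=
    fun q _ => (hhint q).continuousOn_mul (by rw [uIcc_of_le hb]; exact hcont q)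
  have hout' : J.outflow s u = fun t => ∑ q, C q t * h q t := funext hout
  rw [hout']
  have hsum : (fun t => ∑ q, C q t * h q t) = ∑ q, fun t => C q t * h q t := by
    ext t; rw [Finset.sum_apply]
  refine ⟨hsum ▸ IntervalIntegrable.sum _ hCh, ?_⟩
  rw [intervalIntegral.integral_finsetSum hCh, ← hθ0]
  refine sub_le_sum_integral (ψ := fun t => J.potential s (θ t)) hb
    ((continuousOn_potential hs hθ hm hθ0.symm.le hfin').mono Icc_subset_Ici_self) hcont hhint
    ?_ fun t t' ht htt htb => ?_
  · rintro (c | c) t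
    · simp only [hh, Sum.elim_inl]; split_ifs with hc
      · exact le_rfl
      · exact mul_nonneg (h0 c t) (div_nonneg (tail_nonneg hc _) (tail_nonneg hc _))
    · simp only [hh, Sum.elim_inr]; split_ifs with hc
      · exact le_rfl
      · exact mul_nonneg (h0 c t) (div_nonneg (liveDensity_nonneg hc _) (tail_nonneg hc _))
  · have hθt : 0 ≤ θ t := hθ0.symm.le.trans (hm ht)
    refine (potential_sub_le hs hθt (hm htt) fun k hk => hfin' k hk t t').trans_eq ?_
    rw [Fintype.sum_sum_type, ← Finset.sum_add_distrib]
    refine Finset.sum_congr rfl fun c _ => ?_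
    by_cases hc : (s c).1 = J.fin
    · simp [hh, hc]
    · simp only [hh, hC, Sum.elim_inl, Sum.elim_inr, if_neg hc]
      rw [(hint1 c hc ht htt).2, (hint2 c hc ht htt).2, ← tail_sub_tail_live hc
        (add_nonneg (hs c hc).1 (hθt c)) (by linarith [hm htt c])]

theorem potential_nonneg {s : SysState S n} (hs : ∀ k, J.Valid (s k)) {a : Fin n → ℝ}
    (ha : 0 ≤ a) : 0 ≤ J.potential s a := by
  rcases eq_or_ne (J.survivalAt s a) 0 with h | h
  · rw [potential, h, zero_mul]
  · exact mul_nonneg (survivalAt_nonneg s a) (totalCost_nonneg fun l =>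
      valid_shift_of_survivalAt_ne_zero hs ha h l)

theorem tendsto_potential_update {s : SysState S n} (hs : ∀ k, J.Valid (s k)) {c : Fin n}
    (hc : (s c).1 ≠ J.fin) :
    Tendsto (fun y => J.potential s (Function.update 0 c y)) atTop (𝓝 0) := by
  have hv : ∀ l, J.Valid (shift s 0 l) := fun l => by
    have : shift s 0 l = s l := by simp [shift]
    rw [this]; exact hs l
  have hshift : Tendsto (fun y : ℝ => (s c).2 + y) atTop atTop :=
    tendsto_atTop_add_const_left _ _ tendsto_id
  have h1 : Tendsto (fun y => J.survivalExcept s 0 c / J.tail (s c).1 (s c).2 *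
      (∑ l ∈ Finset.univ.erase c, J.tail (s c).1 ((s c).2 + y) *
        J.pairCost ((s c).1, (s c).2 + y) (shift s 0 l) +
        J.tail (s c).1 ((s c).2 + y) * J.totalCostExcept (shift s 0) c)) atTop
      (𝓝 (J.survivalExcept s 0 c / J.tail (s c).1 (s c).2 *
        (∑ l ∈ Finset.univ.erase c, 0 + 0 * J.totalCostExcept (shift s 0) c))) :=
    ((tendsto_finsetSum _ fun l _ => (tendsto_tail_mul_pairCost hc (hv l)).comp hshift).add
      (((tendsto_tail hc).comp hshift).mul_const _)).const_mul _
  simp only [Finset.sum_const_zero, zero_mul, add_zero, mul_zero] at h1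
  refine h1.congr fun y => ?_
  rw [potential_update, survivalFactor, if_neg hc, ← Finset.mul_sum]
  ring

/-- The potential vanishes in the long run, as some job receives much service. -/
theorem tendsto_potential {s : SysState S n} (hs : ∀ k, J.Valid (s k)) {θ : ℝ → Fin n → ℝ}
    (hθ0 : ∀ t, 0 ≤ t → 0 ≤ θ t) (hfin : ∀ k, (s k).1 = J.fin → ∀ t, θ t k = 0)
    (hsum : ∀ t, ∑ k, θ t k = t) : Tendsto (fun t => J.potential s (θ t)) atTop (𝓝 0) := by
  have hupd : ∀ (k : Fin n) (y : ℝ), 0 ≤ y → 0 ≤ Function.update (0 : Fin n → ℝ) k y :=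
    fun k y hy l => by
      by_cases h : l = k
      · subst h; simpa using hy
      · simp [h]
  have h1 : Tendsto (fun t : ℝ => ∑ k, if (s k).1 = J.fin then 0 else
      J.potential s (Function.update 0 k (t / (n + 1)))) atTop (𝓝 (∑ k : Fin n, 0)) := by
    refine tendsto_finsetSum _ fun k _ => ?_
    split_ifs with hk
    · exact tendsto_const_nhds
    · exact (tendsto_potential_update hs hk).comp (tendsto_id.atTop_div_const (by positivity))
  rw [Finset.sum_const_zero] at h1
  refine squeeze_zero' ?_ ?_ h1
  · filter_upwards [eventually_ge_atTop 0] with t ht using potential_nonneg hs (hθ0 t ht)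
  · filter_upwards [eventually_gt_atTop 0] with t ht
    obtain ⟨k, hk⟩ : ∃ k, t / (n + 1) ≤ θ t k := by
      by_contra! hcon
      have h2 : ∑ k, θ t k ≤ ∑ k : Fin n, t / (n + 1) :=
        Finset.sum_le_sum fun k _ => (hcon k).le
      rw [hsum, Finset.sum_const, Finset.card_univ, Fintype.card_fin, nsmul_eq_mul,
        ← mul_div_assoc, le_div_iff₀ (by positivity)] at h2
      linarith
    have hkf : (s k).1 ≠ J.fin := fun h => by
      rw [hfin k h t] at hk
      have : 0 < t / (n + 1) := by positivity
      linarith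
    have hle : Function.update (0 : Fin n → ℝ) k (t / (n + 1)) ≤ θ t := fun l => by
      by_cases h : l = k
      · subst h; simpa using hk
      · simpa [h] using hθ0 t ht.le l
    have ht' : 0 ≤ t / ((n : ℝ) + 1) := by positivity
    refine (potential_anti hs (hupd k _ ht') hle).trans ?_
    refine le_trans (by rw [if_neg hkf]) (Finset.single_le_sum (f := fun k =>
      if (s k).1 = J.fin then 0 else J.potential s (Function.update 0 k (t / (n + 1))))
      (fun l _ => ?_) (Finset.mem_univ k))
    split_ifs
    · exact le_rfl
    · exact potential_nonneg hs (hupd l _ ht')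

end JobType
end Multistage
end

noncomputable section

namespace Multistage

open Filter Topology
open scoped NNReal

/-! ### The pairwise costs bound every policy without bypassing -/

variable {S : Type*} [Fintype S] {J : JobType S} {n : ℕ}

theorem measurable_fin_cons (m : ℕ) (τ : ℝ) :
    Measurable fun t : Fin m → ℝ => (Fin.cons τ t : Fin (m + 1) → ℝ) := by
  refine measurable_pi_iff.2 fun i => ?_
  induction i using Fin.cases with
  | zero => simp
  | succ i => simpa using measurable_pi_apply i

namespace JobType

namespace Admissible

variable {s : SysState S n} {π : Policy S n} (h : J.Admissible s π)
include h

theorem after (k : Fin n) (j : S) (τ : ℝ) {s' : SysState S n}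
    (hs' : (fun l => (s' l).1) = Function.update (fun l => (s l).1) k j) :
    J.Admissible s' (π.after k j τ) where
  measurable_serve e l := by
    have h1 := h.measurable_serve ((k, j) :: e) l
    exact h1.comp (((measurable_fin_cons e.length τ).comp measurable_fst).prodMk measurable_snd)
  measurable_bypass e l := by
    have h1 := h.measurable_bypass ((k, j) :: e) l
    exact h1.comp (((measurable_fin_cons e.length τ).comp measurable_fst).prodMk measurable_snd)
  serve_nonneg e t := h.serve_nonneg ((k, j) :: e) _
  bypass_nonneg e t := h.bypass_nonneg ((k, j) :: e) _
  present e t τ' l hl := by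
    rw [hs'] at hl
    exact h.present ((k, j) :: e) _ τ' l hl
  total e t τ' hl := by
    rw [hs'] at hl
    exact h.total ((k, j) :: e) _ τ' hl

theorem measurable_serveNow (k : Fin n) : Measurable fun t => π.serveNow t k :=
  (h.measurable_serve [] k).comp (measurable_const.prodMk measurable_id)

theorem measurable_bypassNow (k : Fin n) : Measurable fun t => π.bypassNow t k :=
  (h.measurable_bypass [] k).comp (measurable_const.prodMk measurable_id)

theorem serveNow_of_fin {k : Fin n} (hk : (s k).1 = J.fin) (t : ℝ) : π.serveNow t k = 0 :=
  (h.present [] _ t k hk).1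

theorem bypassNow_of_fin {k : Fin n} (hk : (s k).1 = J.fin) (t : ℝ) : π.bypassNow t k = 0 :=
  (h.present [] _ t k hk).2

theorem sum_now (hex : ∃ k, (s k).1 ≠ J.fin) (t : ℝ) :
    ∑ k, (π.serveNow t k + π.bypassNow t k) = 1 := h.total [] _ t hex

theorem now_le_one (k : Fin n) (t : ℝ) : π.serveNow t k + π.bypassNow t k ≤ 1 := by
  by_cases hk : (s k).1 = J.fin
  · rw [h.serveNow_of_fin hk, h.bypassNow_of_fin hk]; norm_num
  · rw [← h.sum_now ⟨k, hk⟩ t]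
    exact Finset.single_le_sum (f := fun k => π.serveNow t k + π.bypassNow t k)
      (fun l _ => add_nonneg (h.serve_nonneg [] _ t l) (h.bypass_nonneg [] _ t l))
      (Finset.mem_univ k)

theorem serveNow_le_one (k : Fin n) (t : ℝ) : π.serveNow t k ≤ 1 :=
  (le_add_of_nonneg_right (h.bypass_nonneg [] _ t k)).trans (h.now_le_one k t)

theorem bypassNow_le_one (k : Fin n) (t : ℝ) : π.bypassNow t k ≤ 1 :=
  (le_add_of_nonneg_left (h.serve_nonneg [] _ t k)).trans (h.now_le_one k t)

end Admissible

theorem stateAfter_stages (s : SysState S n) (π : Policy S n) (t : ℝ) (k : Fin n) (j : S) :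
    (fun l => (stateAfter s π t k j l).1) = Function.update (fun l => (s l).1) k j := by
  ext l
  by_cases h : l = k
  · subst h; simp [stateAfter]
  · simp [stateAfter, h]

theorem totalCost_eq_zero {s : SysState S n} (h : ∀ k, (s k).1 = J.fin) : J.totalCost s = 0 :=
  Finset.sum_eq_zero fun k _ => Finset.sum_eq_zero fun _ _ => pairCost_fin_left (h k) _

theorem sum_rank_stateAfter_lt (s : SysState S n) (π : Policy S n) (t : ℝ) {k : Fin n} {j : S}
    (hk : (s k).1 ≠ J.fin) (hj : 0 < J.trans (s k).1 j) :
    ∑ l, J.rank (stateAfter s π t k j l).1 < ∑ l, J.rank (s l).1 := by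
  refine Finset.sum_lt_sum (fun l _ => ?_) ⟨k, Finset.mem_univ k, ?_⟩
  · by_cases h : l = k
    · subst h; simpa [stateAfter] using (rank_lt hk hj).le
    · simp [stateAfter, h]
  · simpa [stateAfter] using rank_lt hk hj

section Served

variable {s : SysState S n} {π : Policy S n}

theorem served_nonneg (hπ : J.Admissible s π) {t : ℝ} (ht : 0 ≤ t) : 0 ≤ π.served t := fun l =>
  intervalIntegral.integral_nonneg ht fun τ _ => hπ.serve_nonneg [] _ τ l

theorem served_continuous (hπ : J.Admissible s π) (k : Fin n) :
    Continuous fun t => π.served t k :=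
  continuous_effort (hπ.measurable_serveNow k) (fun t => hπ.serve_nonneg [] _ t k)
    (hπ.serveNow_le_one k)

theorem served_monotone (hπ : J.Admissible s π) : Monotone π.served := fun _ _ h k =>
  monotone_effort (hπ.measurable_serveNow k) (fun t => hπ.serve_nonneg [] _ t k)
    (hπ.serveNow_le_one k) h

theorem served_zero : π.served 0 = 0 := by ext k; simp [Policy.served]

end Served

variable [DecidableEq S]

theorem potential_zero {s : SysState S n} (hs : ∀ k, J.Valid (s k)) :
    J.potential s 0 = J.totalCost s := by
  have h1 : shift s 0 = s := by ext k : 1; simp [shift]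
  have h2 : J.survivalAt s 0 = 1 := Finset.prod_eq_one fun k _ => survivalFactor_zero (hs k)
  rw [potential, h1, h2, one_mul]

theorem survival_eq (r : ℝ) (s : SysState S n) (π : Policy S n) (t : ℝ) :
    J.survival r s π t = J.survivalAt s (π.served t) *
      Real.exp (-((∫ τ in (0 : ℝ)..t, ∑ k, π.bypassNow τ k) / r)) := rfl

theorem numOthers_eq {s : SysState S n} {c : Fin n} (hc : (s c).1 ≠ J.fin) :
    J.numOthers s c = ((J.numJobs s - 1 : ℕ) : ℝ) := by
  have h1 : (J.numJobs s : ℝ) = J.numOthers s c + 1 := by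
    rw [numJobs, Finset.card_filter, Nat.cast_sum, numOthers,
      ← Finset.sum_erase_add Finset.univ _ (Finset.mem_univ c)]
    simp [hc, ite_not]
  have h2 : 1 ≤ J.numJobs s := Finset.card_pos.2 ⟨c, by simp [hc]⟩
  rw [Nat.cast_sub h2, h1]; simp

section ServeOnly

variable {s : SysState S n} {π : Policy S n}

theorem outflow_eq (hπ : J.Admissible s π) (hb : ∀ e t τ k, π.bypass e t τ k = 0)
    (hex : ∃ k, (s k).1 ≠ J.fin) (t : ℝ) :
    J.outflow s (fun k t => π.serveNow t k) t =
      ((J.numJobs s - 1 : ℕ) : ℝ) * J.survival 1 s π t +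
        ∑ k, ∑ j, J.survival 1 s π t * J.jumpRate 1 s π t k j *
          J.totalCost (stateAfter s π t k j) := by
  have hbn : ∀ t k, π.bypassNow t k = 0 := fun t k => hb [] _ t k
  have hsurv : J.survival 1 s π t = J.survivalAt s (π.served t) := by
    simp [survival_eq, hbn]
  have hsum : ∑ k, π.serveNow t k = 1 := by simpa [hbn] using hπ.sum_now hex t
  have e1 : ((J.numJobs s - 1 : ℕ) : ℝ) * J.survival 1 s π t =
      ∑ k, π.serveNow t k * (((J.numJobs s - 1 : ℕ) : ℝ) * J.survivalAt s (π.served t)) := by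
    rw [← Finset.sum_mul, hsum, one_mul, hsurv]
  rw [e1, hsurv, ← Finset.sum_add_distrib]
  refine Finset.sum_congr rfl fun c _ => ?_
  by_cases hc : (s c).1 = J.fin
  · simp [hc, hπ.serveNow_of_fin hc, jumpRate, hbn]
  · rw [if_neg hc, numOthers_eq hc]
    have hθ : (fun k => ∫ τ in (0 : ℝ)..t, π.serveNow τ k) = π.served t := rfl
    have hθc : (∫ τ in (0 : ℝ)..t, π.serveNow τ c) = π.served t c := rfl
    rw [hθ, hθc, survivalAt_eq s (π.served t) c, survivalFactor, if_neg hc, jumpPotential]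
    have hlive : J.liveDensity (s c).1 ((s c).2 + π.served t c) =
      J.hazard (s c).1 ((s c).2 + π.served t c) * J.tail (s c).1 ((s c).2 + π.served t c) := rfl
    congr 1
    · ring
    · rw [Finset.sum_mul]
      refine Finset.sum_congr rfl fun j _ => ?_
      have hafter : stateAfter s π t c j =
          Function.update (shift s (π.served t)) c (j, 0) := rfl
      rw [potential_jump, hafter, totalCost_update, hlive, jumpRate]
      simp only [hbn, zero_div, ite_self, add_zero]
      ring

/-- States that are entered with positive probability are valid. -/
theorem valid_stateAfter (hs : ∀ k, J.Valid (s k)) (hπ : J.Admissible s π) {t : ℝ} (ht : 0 ≤ t)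
    (h : J.survivalAt s (π.served t) ≠ 0) (k : Fin n) (j : S) (l : Fin n) :
    J.Valid (stateAfter s π t k j l) := by
  refine valid_update (fun l => ?_) k (valid_zero j) l
  refine valid_shift_of_survivalAt_ne_zero hs (fun l => ?_) h l
  exact intervalIntegral.integral_nonneg ht fun τ _ => hπ.serve_nonneg [] _ τ l

/-- Every policy without bypassing costs at least the sum of the pairwise costs. -/
theorem ofReal_totalCost_le_costUpTo (m : ℕ) : ∀ (s : SysState S n) (π : Policy S n),
    (∀ k, J.Valid (s k)) → J.Admissible s π → (∀ e t τ k, π.bypass e t τ k = 0) →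
    ∑ k, J.rank (s k).1 ≤ m →
    ENNReal.ofReal (J.totalCost s) ≤
      J.costUpTo (fun N => ((N - 1 : ℕ) : ℝ≥0∞)) 1 m s π := by
  induction m with
  | zero =>
    intro s π _ _ _ hm
    rw [totalCost_eq_zero fun k => eq_fin_of_rank_eq_zero (by
      have := Finset.sum_eq_zero_iff.1 (Nat.le_zero.1 hm) k (Finset.mem_univ k)
      exact this)]
    simp
  | succ m ih =>
    intro s π hs hπ hb hm
    by_cases hex : ∃ k, (s k).1 ≠ J.fin
    swap
    · push Not at hex
      rw [totalCost_eq_zero hex]; simp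
    set u : Fin n → ℝ → ℝ := fun k t => π.serveNow t k with hu
    have hbn : ∀ t k, π.bypassNow t k = 0 := fun t k => hb [] _ t k
    have hsurv : ∀ t, J.survival 1 s π t = J.survivalAt s (π.served t) := fun t => by
      simp [survival_eq, hbn]
    have hterm : ∀ t, 0 < t → ∀ k j,
        0 ≤ J.survival 1 s π t * J.jumpRate 1 s π t k j ∧
        (J.survival 1 s π t * J.jumpRate 1 s π t k j ≠ 0 →
          (∀ l, J.Valid (stateAfter s π t k j l)) ∧
          ENNReal.ofReal (J.totalCost (stateAfter s π t k j)) ≤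
            J.costUpTo (fun N => ((N - 1 : ℕ) : ℝ≥0∞)) 1 m (stateAfter s π t k j)
              (π.after k j t)) := by
      intro t ht k j
      have hrate : J.jumpRate 1 s π t k j = π.serveNow t k *
          (J.trans (s k).1 j * J.hazard (s k).1 ((s k).2 + π.served t k)) := by
        simp [jumpRate, hbn]
      rw [hrate, hsurv]
      by_cases hk : (s k).1 = J.fin
      · simp [hπ.serveNow_of_fin hk]
      refine ⟨mul_nonneg (survivalAt_nonneg _ _) (mul_nonneg (hπ.serve_nonneg [] _ t k)
        (mul_nonneg (J.trans_nonneg _ _) (div_nonneg (J.density_nonneg _ hk _)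
          (tail_nonneg hk _)))), fun hne => ?_⟩
      have h1 : J.survivalAt s (π.served t) ≠ 0 := left_ne_zero_of_mul hne
      have h2 : J.trans (s k).1 j ≠ 0 :=
        left_ne_zero_of_mul (right_ne_zero_of_mul (right_ne_zero_of_mul hne))
      have hv := valid_stateAfter hs hπ ht.le h1 k j
      refine ⟨hv, ih _ _ hv (hπ.after k j t (stateAfter_stages s π t k j))
        (fun e t' τ l => hb _ _ _ _) ?_⟩
      have := sum_rank_stateAfter_lt s π t hk ((J.trans_nonneg _ _).lt_of_ne' h2)
      omega
    have hterm0 : ∀ t, 0 < t → ∀ k j, 0 ≤ J.survival 1 s π t * J.jumpRate 1 s π t k j *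
        J.totalCost (stateAfter s π t k j) := by
      intro t ht k j
      rcases eq_or_ne (J.survival 1 s π t * J.jumpRate 1 s π t k j) 0 with h | h
      · rw [h, zero_mul]
      · exact mul_nonneg (hterm t ht k j).1 (totalCost_nonneg ((hterm t ht k j).2 h).1)
    have hpt : ∀ t ∈ Ioi (0 : ℝ), ENNReal.ofReal (J.outflow s u t) ≤
        ((J.numJobs s - 1 : ℕ) : ℝ≥0∞) * ENNReal.ofReal (J.survival 1 s π t) +
        ∑ k, ∑ j, ENNReal.ofReal (J.survival 1 s π t * J.jumpRate 1 s π t k j) *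
          J.costUpTo (fun N => ((N - 1 : ℕ) : ℝ≥0∞)) 1 m (stateAfter s π t k j)
            (π.after k j t) := by
      intro t ht
      have h0 : 0 ≤ J.survival 1 s π t := by rw [hsurv]; exact survivalAt_nonneg _ _
      rw [outflow_eq hπ hb hex, ENNReal.ofReal_add (mul_nonneg (Nat.cast_nonneg _) h0)
        (Finset.sum_nonneg fun k _ => Finset.sum_nonneg fun j _ => hterm0 t ht k j),
        ENNReal.ofReal_mul (Nat.cast_nonneg _), ENNReal.ofReal_natCast,
        ENNReal.ofReal_sum_of_nonneg fun k _ => Finset.sum_nonneg fun j _ => hterm0 t ht k j]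
      refine add_le_add le_rfl (Finset.sum_le_sum fun k _ => ?_)
      rw [ENNReal.ofReal_sum_of_nonneg fun j _ => hterm0 t ht k j]
      refine Finset.sum_le_sum fun j _ => ?_
      rw [ENNReal.ofReal_mul (hterm t ht k j).1]
      rcases eq_or_ne (J.survival 1 s π t * J.jumpRate 1 s π t k j) 0 with h | h
      · simp [h]
      · exact mul_le_mul_right ((hterm t ht k j).2 h).2 _
    have hout0 : ∀ t ∈ Ioi (0 : ℝ), 0 ≤ J.outflow s u t := by
      intro t ht
      have h0 : 0 ≤ J.survival 1 s π t := by rw [hsurv]; exact survivalAt_nonneg _ _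
      rw [outflow_eq hπ hb hex]
      exact add_nonneg (mul_nonneg (Nat.cast_nonneg _) h0)
        (Finset.sum_nonneg fun k _ => Finset.sum_nonneg fun j _ => hterm0 t ht k j)
    have hcost : ∫⁻ t in Ioi (0 : ℝ), ENNReal.ofReal (J.outflow s u t) ≤
        J.costUpTo (fun N => ((N - 1 : ℕ) : ℝ≥0∞)) 1 (m + 1) s π := by
      refine (setLIntegral_mono' measurableSet_Ioi hpt).trans_eq ?_
      rw [lintegral_add_left', costUpTo]
      refine AEMeasurable.const_mul (AEMeasurable.ennreal_ofReal ?_) _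
      rw [show J.survival 1 s π = fun t => J.survivalAt s (π.served t) from funext hsurv]
      exact ((continuousOn_survivalAt hs (served_continuous hπ) (served_monotone hπ)
        served_zero.symm.le).mono Ioi_subset_Ici_self).aemeasurable measurableSet_Ioi
    have hbound : ∀ b, 0 ≤ b → ENNReal.ofReal (J.totalCost s) ≤
        ENNReal.ofReal (J.potential s (π.served b)) +
          J.costUpTo (fun N => ((N - 1 : ℕ) : ℝ≥0∞)) 1 (m + 1) s π := by
      intro b hb'
      obtain ⟨hi, hle⟩ := potential_sub_le_integral hs (u := u) hπ.measurable_serveNow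
        (fun k t => hπ.serve_nonneg [] _ t k) hπ.serveNow_le_one
        (fun k hk t => hπ.serveNow_of_fin hk t) hb'
      rw [potential_zero hs] at hle
      have h1 : J.totalCost s ≤ J.potential s (π.served b) +
          ∫ t in (0 : ℝ)..b, J.outflow s u t := by
        have : J.potential s (π.served b) =
          J.potential s (fun k => ∫ τ in (0 : ℝ)..b, u k τ) := rfl
        linarith
      refine (ENNReal.ofReal_le_ofReal h1).trans (ENNReal.ofReal_add_le.trans ?_)
      refine add_le_add le_rfl (le_trans ?_ hcost)
      rw [intervalIntegral.integral_of_le hb', ofReal_integral_eq_lintegral_ofReal hi.1]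
      · exact lintegral_mono_set Ioc_subset_Ioi_self
      · filter_upwards [ae_restrict_mem measurableSet_Ioc] with t ht using hout0 t ht.1
    have hlim : Tendsto (fun b => ENNReal.ofReal (J.potential s (π.served b)) +
        J.costUpTo (fun N => ((N - 1 : ℕ) : ℝ≥0∞)) 1 (m + 1) s π) atTop
        (𝓝 (ENNReal.ofReal 0 + J.costUpTo (fun N => ((N - 1 : ℕ) : ℝ≥0∞)) 1 (m + 1) s π)) := by
      refine Tendsto.add (ENNReal.tendsto_ofReal (tendsto_potential hs
        (fun t ht => served_nonneg hπ ht) (fun k hk t => ?_) fun t => ?_)) tendsto_const_nhds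
      · simp [Policy.served, hπ.serveNow_of_fin hk]
      · have hsum : ∀ τ, ∑ k, π.serveNow τ k = 1 := fun τ => by
          simpa [hbn] using hπ.sum_now hex τ
        simp only [Policy.served]
        rw [← intervalIntegral.integral_finsetSum fun k _ =>
          intervalIntegrable_effort (hπ.measurable_serveNow k)
            (fun t => hπ.serve_nonneg [] _ t k) (hπ.serveNow_le_one k) 0 t]
        simp [hsum]
    rw [ENNReal.ofReal_zero, zero_add] at hlim
    exact ge_of_tendsto hlim (by filter_upwards [eventually_ge_atTop 0] with b h using hbound b h)

end ServeOnly

end JobType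
end Multistage
end

noncomputable section

namespace Multistage

open Filter Topology
open scoped NNReal

namespace JobType

/-! ### The optimal stopping cost is a lower bound for serving and bypassing one job -/

variable {S : Type*} [Fintype S] {J : JobType S} {i : S}

/-- The rate at which cost accrues to a job that has received service `θ` and bypassing `β`, while
it is served at rate `u`: its survival probability, and the optimal cost of the next stage whenever
a stage is completed. -/
def bypassOutflow (J : JobType S) (i : S) (x r : ℝ) (u v : ℝ → ℝ) (t : ℝ) : ℝ :=
  J.tail i (x + ∫ τ in (0 : ℝ)..t, u τ) / J.tail i x *
      Real.exp (-((∫ τ in (0 : ℝ)..t, v τ) / r)) +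
    u t * (J.liveDensity i (x + ∫ τ in (0 : ℝ)..t, u τ) / J.tail i x) *
      Real.exp (-((∫ τ in (0 : ℝ)..t, v τ) / r)) * J.nextCost i r

theorem integral_exp_effort {v : ℝ → ℝ} (hv : Measurable v) (h0 : ∀ t, 0 ≤ v t)
    (h1 : ∀ t, v t ≤ 1) {r : ℝ} (hr : 0 < r) {s t : ℝ} (hs : 0 ≤ s) (hst : s ≤ t) :
    IntervalIntegrable (fun τ => v τ * (Real.exp (-((∫ τ in (0 : ℝ)..τ, v τ) / r)) / r))
      volume s t ∧
    ∫ τ in s..t, v τ * (Real.exp (-((∫ τ in (0 : ℝ)..τ, v τ) / r)) / r) =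
      Real.exp (-((∫ τ in (0 : ℝ)..s, v τ) / r)) -
        Real.exp (-((∫ τ in (0 : ℝ)..t, v τ) / r)) := by
  have hc : Continuous fun y : ℝ => Real.exp (-(y / r)) / r := by fun_prop
  obtain ⟨h2, h3⟩ := integral_comp_effort hv h0 h1 hc.measurable (fun y => by positivity)
    (fun a b _ _ => hc.intervalIntegrable a b) hs hst
  refine ⟨h2, h3.trans ?_⟩
  have hd : ∀ y : ℝ, HasDerivAt (fun y => -Real.exp (-(y / r))) (Real.exp (-(y / r)) / r) y := by
    intro y
    have h4 : HasDerivAt (fun y : ℝ => -(y / r)) (-(1 / r)) y :=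
      ((hasDerivAt_id' y).div_const r).fun_neg
    exact h4.exp.fun_neg.congr_deriv (by ring)
  rw [intervalIntegral.integral_eq_sub_of_hasDerivAt (fun y _ => hd y)
    (hc.intervalIntegrable _ _)]
  ring

theorem optCost_of_fin {p : JobState S} (h : p.1 = J.fin) {r : ℝ} (hr : 0 ≤ r) :
    J.optCost p.1 p.2 r = 0 := by
  rw [h, optCost_fin]; exact min_eq_right hr

theorem tail_mul_optCost_zero (hi : i ≠ J.fin) {x : ℝ} (hx : 0 ≤ x) :
    J.tail i x * J.optCost i x 0 = 0 := by
  rcases (tail_nonneg hi x).eq_or_lt with h | h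
  · rw [← h, zero_mul]
  · rw [(retirementCost_optCost (p := (i, x)) fun _ => ⟨hx, h⟩).eq_self 0 le_rfl, mul_zero]

theorem tail_mul_optCost_anti (hi : i ≠ J.fin) {x y r : ℝ} (hx : 0 ≤ x) (hxy : x ≤ y)
    (hr : 0 ≤ r) : J.tail i y * J.optCost i y r ≤ J.tail i x * J.optCost i x r := by
  have h := tail_mul_optCost_sub_le (J := J) hi hx hxy hr
  rwa [tail_mul_optCost_zero hi hx, tail_mul_optCost_zero hi (hx.trans hxy), sub_zero,
    sub_zero] at h

theorem tail_mul_optCost_nonneg (hi : i ≠ J.fin) {x r : ℝ} (hx : 0 ≤ x) (hr : 0 ≤ r) :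
    0 ≤ J.tail i x * J.optCost i x r := by
  rw [tail_mul_optCost' hi r hx]
  exact rawCost_nonneg hi hx ((retirementCost_nextCost i).nonneg hr) hr

theorem tail_mul_optCost_le_mul (hi : i ≠ J.fin) {x : ℝ} (r : ℝ) (hx : 0 ≤ x) :
    J.tail i x * J.optCost i x r ≤ r * J.tail i x := by
  rw [tail_mul_optCost' hi r hx]
  simpa using rawCost_le hi (J.nextCost i r) r hx le_rfl

theorem tendsto_tail_mul_optCost (hi : i ≠ J.fin) {r : ℝ} (hr : 0 ≤ r) :
    Tendsto (fun x => J.tail i x * J.optCost i x r) atTop (𝓝 0) := by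
  refine squeeze_zero' ?_ ?_ (by simpa using (tendsto_tail hi).const_mul r)
  · filter_upwards [eventually_ge_atTop 0] with x hx using tail_mul_optCost_nonneg hi hx hr
  · filter_upwards [eventually_ge_atTop 0] with x hx using tail_mul_optCost_le_mul hi r hx

section Bypass

variable {x r : ℝ} (hi : i ≠ J.fin) (hx : 0 ≤ x) (hT : 0 < J.tail i x) (hr : 0 < r)
  {u v : ℝ → ℝ} (hu : Measurable u) (hu0 : ∀ t, 0 ≤ u t) (hv : Measurable v) (hv0 : ∀ t, 0 ≤ v t)
  (huv : ∀ t, u t + v t = 1)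
include hi hx hT hr hu hu0 hv hv0 huv

/-- While a single job is served at rate `u` and bypassed at rate `v`, its optimal stopping cost, on the
event that nothing has happened yet, decreases at most by its outflow. -/
theorem bypass_sub_le_integral {b : ℝ} (hb : 0 ≤ b) :
    IntervalIntegrable (J.bypassOutflow i x r u v) volume 0 b ∧
    J.optCost i x r -
        J.tail i (x + ∫ τ in (0 : ℝ)..b, u τ) * J.optCost i (x + ∫ τ in (0 : ℝ)..b, u τ) r /
          J.tail i x * Real.exp (-((∫ τ in (0 : ℝ)..b, v τ) / r)) ≤
      ∫ t in (0 : ℝ)..b, J.bypassOutflow i x r u v t := by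
  have hu1 : ∀ t, u t ≤ 1 := fun t => by linarith [huv t, hv0 t]
  have hv1 : ∀ t, v t ≤ 1 := fun t => by linarith [huv t, hu0 t]
  set θ : ℝ → ℝ := fun t => ∫ τ in (0 : ℝ)..t, u τ with hθdef
  set E : ℝ → ℝ := fun t => Real.exp (-((∫ τ in (0 : ℝ)..t, v τ) / r)) with hEdef
  have hθ : Continuous θ := continuous_effort hu hu0 hu1
  have hm : Monotone θ := monotone_effort hu hu0 hu1
  have hθ0 : θ 0 = 0 := by simp [hθdef]
  have hE : Continuous E := by
    have := continuous_effort hv hv0 hv1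
    fun_prop
  have hEpos : ∀ t, 0 < E t := fun t => Real.exp_pos _
  have hE0 : E 0 = 1 := by simp [hEdef]
  have hθn : ∀ t, 0 ≤ t → 0 ≤ x + θ t := fun t ht => by
    have := hm ht; rw [hθ0] at this; linarith
  have hB : 0 ≤ J.nextCost i r := (retirementCost_nextCost i).nonneg hr.le
  have hint1 : ∀ {t t' : ℝ}, 0 ≤ t → t ≤ t' → _ := fun {t t'} ht htt =>
    integral_effort_scaled (measurable_tail hi) (tail_nonneg hi)
      (fun a b ha hb => intervalIntegrable_tail hi ha hb) hu hu0 hu1 hx hT ht htt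
  have hint2 : ∀ {t t' : ℝ}, 0 ≤ t → t ≤ t' → _ := fun {t t'} ht htt =>
    integral_effort_scaled (measurable_liveDensity hi) (liveDensity_nonneg hi)
      (fun a b ha hb => intervalIntegrable_liveDensity hi ha hb) hu hu0 hu1 hx hT ht htt
  have hint3 : ∀ {t t' : ℝ}, 0 ≤ t → t ≤ t' → _ := fun {t t'} ht htt =>
    integral_exp_effort hv hv0 hv1 hr ht htt
  set g : ℝ → ℝ := fun t => J.tail i (x + θ t) * J.optCost i (x + θ t) r with hg
  have htail : ContinuousOn (fun t => J.tail i (x + θ t)) (Ici 0) :=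
    continuousOn_tail_comp hi hx hθ hm hθ0.symm.le
  have hgstep : ∀ s t, 0 ≤ s → s ≤ t → g s - g t ≤ (∫ y in x + θ s..x + θ t, J.tail i y) +
      (J.tail i (x + θ s) - J.tail i (x + θ t)) * J.nextCost i r := fun s t hs hst => by
    have := tail_mul_optCost_le hi r (hθn s hs) (add_le_add (le_refl x) (hm hst))
    simp only [hg]; linarith
  have hganti : ∀ s t, 0 ≤ s → s ≤ t → g t ≤ g s := fun s t hs hst =>
    tail_mul_optCost_anti hi (hθn s hs) (add_le_add (le_refl x) (hm hst)) hr.le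
  have hgcont : ContinuousOn g (Ici 0) := by
    refine continuousOn_of_abs_sub_le (G := fun t => x + θ t -
      J.tail i (x + θ t) * J.nextCost i r) ?_ fun s t hs hst => ?_
    · exact (continuous_const.add hθ).continuousOn.sub (htail.mul continuousOn_const)
    · rw [abs_of_nonneg (sub_nonneg.2 (hganti s t hs hst))]
      have h1 : ∫ y in x + θ s..x + θ t, J.tail i y ≤ (x + θ t - (x + θ s)) := by
        have h2 := hm hst
        calc _ ≤ ∫ y in x + θ s..x + θ t, (1 : ℝ) :=
              intervalIntegral.integral_mono_on (by linarith)
                (intervalIntegrable_tail hi (hθn s hs) (hθn t (hs.trans hst)))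
                intervalIntegrable_const fun y hy => tail_le_one hi ((hθn s hs).trans hy.1)
          _ = _ := by simp
      linarith [hgstep s t hs hst]
  set C : Fin 3 → ℝ → ℝ := ![E, fun t => E t * J.nextCost i r,
    fun t => r * (J.tail i (x + θ t) / J.tail i x)] with hC
  set h : Fin 3 → ℝ → ℝ := ![fun t => u t * (J.tail i (x + θ t) / J.tail i x),
    fun t => u t * (J.liveDensity i (x + θ t) / J.tail i x),
    fun t => v t * (E t / r)] with hh
  have hout : J.bypassOutflow i x r u v = fun t => ∑ q, C q t * h q t := by
    ext t
    simp only [Fin.sum_univ_three, hC, hh, Matrix.cons_val_zero, Matrix.cons_val_one,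
      Matrix.cons_val, bypassOutflow]
    have h1 : J.tail i (x + θ t) / J.tail i x * E t =
        J.tail i (x + θ t) / J.tail i x * E t * (u t + v t) := by rw [huv, mul_one]
    change J.tail i (x + θ t) / J.tail i x * E t +
      u t * (J.liveDensity i (x + θ t) / J.tail i x) * E t * J.nextCost i r = _
    rw [h1]
    field_simp
    ring
  have hcont : ∀ q, ContinuousOn (C q) (Icc 0 b) := by
    intro q
    refine ContinuousOn.mono ?_ Icc_subset_Ici_self
    fin_cases q
    · exact hE.continuousOn
    · exact (hE.mul continuous_const).continuousOn
    · exact continuousOn_const.mul (htail.div_const _)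
  have hhint : ∀ q, IntervalIntegrable (h q) volume 0 b := by
    intro q
    fin_cases q
    · exact (hint1 le_rfl hb).1
    · exact (hint2 le_rfl hb).1
    · exact (hint3 le_rfl hb).1
  have hCh : ∀ q ∈ Finset.univ, IntervalIntegrable (fun t => C q t * h q t) volume 0 b :=
    fun q _ => (hhint q).continuousOn_mul (by rw [uIcc_of_le hb]; exact hcont q)
  have hsum : (fun t => ∑ q, C q t * h q t) = ∑ q, fun t => C q t * h q t := by
    ext t; rw [Finset.sum_apply]
  rw [hout]
  refine ⟨hsum ▸ IntervalIntegrable.sum _ hCh, ?_⟩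
  rw [intervalIntegral.integral_finsetSum hCh]
  have key := sub_le_sum_integral (ψ := fun t => g t / J.tail i x * E t) hb
    (((hgcont.div_const _).mul hE.continuousOn).mono Icc_subset_Ici_self) hcont hhint ?_ ?_
  · have h0 : g 0 / J.tail i x * E 0 = J.optCost i x r := by
      simp only [hg, hθ0, hE0, add_zero, mul_one]
      field_simp
    rw [h0] at key
    exact key
  · intro q t
    fin_cases q
    · exact mul_nonneg (hu0 t) (div_nonneg (tail_nonneg hi _) hT.le)
    · exact mul_nonneg (hu0 t) (div_nonneg (liveDensity_nonneg hi _) hT.le)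
    · exact mul_nonneg (hv0 t) (div_nonneg (hEpos t).le hr.le)
  · intro s t hs hst htb
    simp only [Fin.sum_univ_three, hC, hh, Matrix.cons_val_zero, Matrix.cons_val_one,
      Matrix.cons_val]
    rw [(hint1 hs hst).2, (hint2 hs hst).2, (hint3 hs hst).2,
      ← tail_sub_tail_live hi (hθn s hs) (by linarith [hm hst])]
    have h1 : g t / J.tail i x * (E s - E t) ≤
        r * (J.tail i (x + θ s) / J.tail i x) * (E s - E t) := by
      refine mul_le_mul_of_nonneg_right ?_ (sub_nonneg.2 ?_)
      · rw [← mul_div_assoc]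
        refine div_le_div_of_nonneg_right ((hganti s t hs hst).trans ?_) hT.le
        exact tail_mul_optCost_le_mul hi r (hθn s hs)
      · exact Real.exp_le_exp.2 (neg_le_neg (div_le_div_of_nonneg_right
          (monotone_effort hv hv0 hv1 hst) hr.le))
    have h2 : E s * ((g s - g t) / J.tail i x) ≤
        E s * (((∫ y in x + θ s..x + θ t, J.tail i y) +
          (J.tail i (x + θ s) - J.tail i (x + θ t)) * J.nextCost i r) / J.tail i x) :=
      mul_le_mul_of_nonneg_left (div_le_div_of_nonneg_right (hgstep s t hs hst) hT.le)
        (hEpos s).le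
    change g s / J.tail i x * E s - g t / J.tail i x * E t ≤
      E s * ((∫ y in x + θ s..x + θ t, J.tail i y) / J.tail i x) +
      E s * J.nextCost i r * ((J.tail i (x + θ s) - J.tail i (x + θ t)) / J.tail i x) +
      r * (J.tail i (x + θ s) / J.tail i x) * (E s - E t)
    calc _ = E s * ((g s - g t) / J.tail i x) + g t / J.tail i x * (E s - E t) := by ring
      _ ≤ _ := add_le_add h2 h1
      _ = _ := by ring

/-- In the long run the service or the bypassing received by the job is unbounded, and either of them
drives its expected optimal stopping cost to zero. -/
theorem tendsto_bypass :
    Tendsto (fun b => J.tail i (x + ∫ τ in (0 : ℝ)..b, u τ) *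
        J.optCost i (x + ∫ τ in (0 : ℝ)..b, u τ) r /
          J.tail i x * Real.exp (-((∫ τ in (0 : ℝ)..b, v τ) / r))) atTop (𝓝 0) := by
  have hu1 : ∀ t, u t ≤ 1 := fun t => by linarith [huv t, hv0 t]
  have hv1 : ∀ t, v t ≤ 1 := fun t => by linarith [huv t, hu0 t]
  have hsum : ∀ t, (∫ τ in (0 : ℝ)..t, u τ) + ∫ τ in (0 : ℝ)..t, v τ = t := fun t => by
    rw [← intervalIntegral.integral_add (intervalIntegrable_effort hu hu0 hu1 0 t)
      (intervalIntegrable_effort hv hv0 hv1 0 t)]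
    simp [huv]
  have hhalf : Tendsto (fun b : ℝ => b / 2) atTop atTop := tendsto_id.atTop_div_const (by norm_num)
  have l1 : Tendsto (fun b : ℝ => J.tail i (x + b / 2) * J.optCost i (x + b / 2) r /
      J.tail i x) atTop (𝓝 0) := by
    simpa using ((tendsto_tail_mul_optCost hi hr.le).comp
      (tendsto_atTop_add_const_left _ x hhalf)).div_const (J.tail i x)
  have l2 : Tendsto (fun b : ℝ => r * Real.exp (-(b / 2 / r))) atTop (𝓝 0) := by
    have := (Real.tendsto_exp_neg_atTop_nhds_zero.comp (hhalf.atTop_div_const hr)).const_mul r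
    simpa using this
  have l3 := l1.add l2
  rw [add_zero] at l3
  have hθ0 : ∀ b, 0 ≤ b → 0 ≤ ∫ τ in (0 : ℝ)..b, u τ := fun b hb =>
    intervalIntegral.integral_nonneg hb fun τ _ => hu0 τ
  have hβ0 : ∀ b, 0 ≤ b → 0 ≤ ∫ τ in (0 : ℝ)..b, v τ := fun b hb =>
    intervalIntegral.integral_nonneg hb fun τ _ => hv0 τ
  refine squeeze_zero' ?_ ?_ l3
  · filter_upwards [eventually_ge_atTop 0] with b hb
    exact mul_nonneg (div_nonneg (tail_mul_optCost_nonneg hi (add_nonneg hx (hθ0 b hb)) hr.le)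
      hT.le) (Real.exp_pos _).le
  · filter_upwards [eventually_ge_atTop 0] with b hb
    have hpos : ∀ y, 0 ≤ y → 0 ≤ J.tail i (x + y) * J.optCost i (x + y) r / J.tail i x :=
      fun y hy => div_nonneg (tail_mul_optCost_nonneg hi (add_nonneg hx hy) hr.le) hT.le
    rcases le_total (b / 2) (∫ τ in (0 : ℝ)..b, u τ) with h | h
    · refine le_trans (mul_le_of_le_one_right (hpos _ (hθ0 b hb)) ?_) (le_trans
        (div_le_div_of_nonneg_right (tail_mul_optCost_anti hi (by linarith)
          (add_le_add (le_refl x) h) hr.le) hT.le) (le_add_of_nonneg_right (by positivity)))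
      exact Real.exp_le_one_iff.2 (neg_nonpos.2 (div_nonneg (hβ0 b hb) hr.le))
    · have h' : b / 2 ≤ ∫ τ in (0 : ℝ)..b, v τ := by linarith [hsum b]
      refine le_trans (mul_le_mul ?_ (Real.exp_le_exp.2 (neg_le_neg
        (div_le_div_of_nonneg_right h' hr.le))) (Real.exp_pos _).le hr.le)
        (le_add_of_nonneg_left (hpos _ (by linarith)))
      rw [div_le_iff₀ hT]
      refine (tail_mul_optCost_anti hi hx (by linarith [hθ0 b hb]) hr.le).trans ?_
      exact tail_mul_optCost_le_mul hi r hx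

end Bypass

variable [DecidableEq S]

/-- Serving and bypassing a single job takes at least the optimal stopping cost. -/
theorem ofReal_optCost_le_costUpTo {r : ℝ} (hr : 0 < r) (m : ℕ) :
    ∀ (s : SysState S 1) (π : Policy S 1), J.Valid (s 0) → J.Admissible s π →
    J.rank (s 0).1 ≤ m →
    ENNReal.ofReal (J.optCost (s 0).1 (s 0).2 r) ≤
      J.costUpTo (fun N => if N = 0 then 0 else 1) r m s π := by
  induction m with
  | zero =>
    intro s π _ _ hm
    rw [optCost_of_fin (eq_fin_of_rank_eq_zero (Nat.le_zero.1 hm)) hr.le]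
    simp
  | succ m ih =>
    intro s π hs hπ hm
    by_cases hi : (s 0).1 = J.fin
    · rw [optCost_of_fin hi hr.le]; simp
    obtain ⟨hx, hT⟩ := hs hi
    set u : ℝ → ℝ := fun t => π.serveNow t 0 with hu
    set v : ℝ → ℝ := fun t => π.bypassNow t 0 with hv
    set K := J.costUpTo (fun N => if N = 0 then 0 else 1) r (m + 1) s π with hK
    have hum : Measurable u := hπ.measurable_serveNow 0
    have hvm : Measurable v := hπ.measurable_bypassNow 0
    have hu0 : ∀ t, 0 ≤ u t := fun t => hπ.serve_nonneg [] _ t 0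
    have hv0 : ∀ t, 0 ≤ v t := fun t => hπ.bypass_nonneg [] _ t 0
    have huv : ∀ t, u t + v t = 1 := fun t => by
      simpa using hπ.sum_now ⟨0, hi⟩ t
    have hN : J.numJobs s ≠ 0 := (Finset.card_pos.2 ⟨0, by simp [hi]⟩).ne'
    have hsurv : ∀ t, J.survival r s π t =
        J.tail (s 0).1 ((s 0).2 + ∫ τ in (0 : ℝ)..t, u τ) / J.tail (s 0).1 (s 0).2 *
          Real.exp (-((∫ τ in (0 : ℝ)..t, v τ) / r)) := fun t => by
      simp [survival, hi, hu, hv, Policy.served]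
    have hsurv0 : ∀ t, 0 ≤ J.survival r s π t := fun t => by
      rw [hsurv]
      exact mul_nonneg (div_nonneg (tail_nonneg hi _) hT.le) (Real.exp_pos _).le
    have hθ0 : ∀ t, 0 < t → 0 ≤ ∫ τ in (0 : ℝ)..t, u τ := fun t ht =>
      intervalIntegral.integral_nonneg ht.le fun τ _ => hu0 τ
    have hafter : ∀ t j, stateAfter s π t 0 j 0 = (j, 0) := fun t j => by simp [stateAfter]
    have hpt : ∀ t ∈ Ioi (0 : ℝ), 0 ≤ J.bypassOutflow (s 0).1 (s 0).2 r u v t ∧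
        ENNReal.ofReal (J.bypassOutflow (s 0).1 (s 0).2 r u v t) ≤
        (if J.numJobs s = 0 then 0 else 1) * ENNReal.ofReal (J.survival r s π t) +
        ∑ k, ∑ j, ENNReal.ofReal (J.survival r s π t * J.jumpRate r s π t k j) *
          J.costUpTo (fun N => if N = 0 then 0 else 1) r m (stateAfter s π t k j)
            (π.after k j t) := by
      intro t ht
      have hhz : 0 ≤ J.hazard (s 0).1 ((s 0).2 + π.served t 0) :=
        div_nonneg (J.density_nonneg _ hi _) (tail_nonneg hi _)
      have hform : J.bypassOutflow (s 0).1 (s 0).2 r u v t = J.survival r s π t +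
          ∑ j, J.survival r s π t * (u t * (J.trans (s 0).1 j *
            J.hazard (s 0).1 ((s 0).2 + π.served t 0))) * J.optCost j 0 r := by
        rw [bypassOutflow, ← hsurv, nextCost, Finset.mul_sum]
        congr 1
        refine Finset.sum_congr rfl fun j _ => ?_
        rw [hsurv, liveDensity]
        change _ = J.tail (s 0).1 ((s 0).2 + π.served t 0) / J.tail (s 0).1 (s 0).2 * _ * _ * _
        change u t * (J.hazard (s 0).1 ((s 0).2 + π.served t 0) *
          J.tail (s 0).1 ((s 0).2 + π.served t 0) / J.tail (s 0).1 (s 0).2) * _ * _ = _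
        ring
      have hopt : ∀ j, 0 ≤ J.optCost j 0 r := fun j =>
        (retirementCost_optCost_zero j).nonneg hr.le
      have hterm : ∀ j, 0 ≤ J.survival r s π t * (u t * (J.trans (s 0).1 j *
            J.hazard (s 0).1 ((s 0).2 + π.served t 0))) := fun j =>
        mul_nonneg (hsurv0 t) (mul_nonneg (hu0 t) (mul_nonneg (J.trans_nonneg _ _) hhz))
      have hsum0 := Finset.sum_nonneg fun j (_ : j ∈ Finset.univ) =>
        mul_nonneg (hterm j) (hopt j)
      refine ⟨by rw [hform]; exact add_nonneg (hsurv0 t) hsum0, ?_⟩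
      rw [hform, ENNReal.ofReal_add (hsurv0 t) hsum0, if_neg hN, one_mul,
        ENNReal.ofReal_sum_of_nonneg fun j _ => mul_nonneg (hterm j) (hopt j)]
      refine add_le_add le_rfl ?_
      rw [Fin.sum_univ_one]
      refine Finset.sum_le_sum fun j _ => ?_
      rw [ENNReal.ofReal_mul (hterm j)]
      rcases eq_or_ne (J.trans (s 0).1 j) 0 with hj | hj
      · simp [hj]
      refine mul_le_mul' (ENNReal.ofReal_le_ofReal (mul_le_mul_of_nonneg_left ?_ (hsurv0 t))) ?_
      · refine le_add_of_nonneg_right ?_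
        split_ifs
        · exact div_nonneg (hv0 t) hr.le
        · exact le_rfl
      · have := ih (stateAfter s π t 0 j) (π.after 0 j t) (by rw [hafter]; exact valid_zero j)
          (hπ.after 0 j t (stateAfter_stages s π t 0 j)) (by
            rw [hafter]
            have := rank_lt hi ((J.trans_nonneg _ _).lt_of_ne' hj)
            show J.rank j ≤ m
            omega)
        rwa [hafter] at this
    have hcost : ∫⁻ t in Ioi (0 : ℝ), ENNReal.ofReal (J.bypassOutflow (s 0).1 (s 0).2 r u v t) ≤
        K := by
      refine (setLIntegral_mono' measurableSet_Ioi fun t ht => (hpt t ht).2).trans_eq ?_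
      rw [lintegral_add_left', hK, costUpTo]
      refine AEMeasurable.const_mul (AEMeasurable.ennreal_ofReal ?_) _
      rw [show J.survival r s π = _ from funext hsurv]
      have hu1 : ∀ t, u t ≤ 1 := fun t => by linarith [huv t, hv0 t]
      have hv1 : ∀ t, v t ≤ 1 := fun t => by linarith [huv t, hu0 t]
      have hcv := continuous_effort hvm hv0 hv1
      refine ContinuousOn.aemeasurable ?_ measurableSet_Ioi
      refine ContinuousOn.mono (s := Ici 0) ?_ Ioi_subset_Ici_self
      refine ((continuousOn_tail_comp hi hx (continuous_effort hum hu0 hu1)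
        (monotone_effort hum hu0 hu1) (by simp)).div_const _).mul ?_
      exact Continuous.continuousOn (by fun_prop)
    have hbound : ∀ b, 0 ≤ b → ENNReal.ofReal (J.optCost (s 0).1 (s 0).2 r) ≤
        ENNReal.ofReal (J.tail (s 0).1 ((s 0).2 + ∫ τ in (0 : ℝ)..b, u τ) *
        J.optCost (s 0).1 ((s 0).2 + ∫ τ in (0 : ℝ)..b, u τ) r /
          J.tail (s 0).1 (s 0).2 * Real.exp (-((∫ τ in (0 : ℝ)..b, v τ) / r))) + K := by
      intro b hb
      obtain ⟨hint, hle⟩ := bypass_sub_le_integral hi hx hT hr hum hu0 hvm hv0 huv hb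
      refine (ENNReal.ofReal_le_ofReal (sub_le_iff_le_add'.1 hle)).trans
        (ENNReal.ofReal_add_le.trans (add_le_add le_rfl (le_trans ?_ hcost)))
      rw [intervalIntegral.integral_of_le hb, ofReal_integral_eq_lintegral_ofReal hint.1]
      · exact lintegral_mono_set Ioc_subset_Ioi_self
      · filter_upwards [ae_restrict_mem measurableSet_Ioc] with t ht using (hpt t ht.1).1
    have hlim := (ENNReal.tendsto_ofReal
      (tendsto_bypass hi hx hT hr hum hu0 hvm hv0 huv)).add_const K
    rw [ENNReal.ofReal_zero, zero_add] at hlim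
    exact ge_of_tendsto hlim (by filter_upwards [eventually_ge_atTop 0] with b h using hbound b h)

end JobType
end Multistage
end

noncomputable section

namespace Multistage

open Filter Topology
open scoped NNReal

namespace JobType

/-! ### Policies that work in phases -/

variable {S : Type*} [Fintype S] [DecidableEq S] {J : JobType S} {n : ℕ}

/-- The duration of a phase that serves a job in state `p`; it is empty if the job has left. -/
def phaseAge (J : JobType S) (d : S → ℝ → ℝ≥0∞) (p : JobState S) : ℝ≥0∞ :=
  if p.1 = J.fin then 0 else d p.1 p.2

/-- The effort of a policy that starts with the phase "spend the effort `start` until job `k` has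
aged by `phaseAge`", and then continues according to `next`.  The phase starts afresh after each
jump that occurs during it.  The history of jumps is replayed from the first one. -/
def phaseEffort (J : JobType S) (k : Fin n) (d : S → ℝ → ℝ≥0∞) (start : Fin n → ℝ)
    (next : SysState S n → (e : List (Fin n × S)) → (Fin e.length → ℝ) → ℝ → Fin n → ℝ) :
    (e : List (Fin n × S)) → SysState S n → (Fin e.length → ℝ) → ℝ → Fin n → ℝ
  | [], s, t, τ =>
    if ENNReal.ofReal τ < J.phaseAge d (s k) then start
    else next (shift s (Pi.single k (J.phaseAge d (s k)).toReal)) [] t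
      (τ - (J.phaseAge d (s k)).toReal)
  | (k', j) :: e, s, t, τ =>
    if ENNReal.ofReal ((t : Fin (e.length + 1) → ℝ) 0) < J.phaseAge d (s k) then
      phaseEffort J k d start next e
        (Function.update (shift s (Pi.single k ((t : Fin (e.length + 1) → ℝ) 0))) k' (j, 0))
        (Fin.tail (t : Fin (e.length + 1) → ℝ)) τ
    else next (shift s (Pi.single k (J.phaseAge d (s k)).toReal)) ((k', j) :: e)
      (Fin.cons ((t : Fin (e.length + 1) → ℝ) 0 - (J.phaseAge d (s k)).toReal)
        (Fin.tail (t : Fin (e.length + 1) → ℝ))) τ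

/-- Serve job `k` until it has aged by `phaseAge`, and continue with the policy that `P` assigns to
the state reached. -/
def phase (J : JobType S) (k : Fin n) (d : S → ℝ → ℝ≥0∞) (P : SysState S n → Policy S n)
    (s : SysState S n) : Policy S n where
  serve e := J.phaseEffort k d (Pi.single k 1) (fun s => (P s).serve) e s
  bypass e := J.phaseEffort k d 0 (fun s => (P s).bypass) e s

/-- An assignment of an admissible policy to every state, in a measurable way. -/
structure IsStrategy (J : JobType S) (P : SysState S n → Policy S n) : Prop where
  admissible : ∀ s, J.Admissible s (P s)
  measurable_serve : ∀ (σ : Fin n → S) (e : List (Fin n × S)) (k : Fin n),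
    Measurable fun q : (Fin n → ℝ) × (Fin e.length → ℝ) × ℝ =>
      (P fun l => (σ l, q.1 l)).serve e q.2.1 q.2.2 k
  measurable_bypass : ∀ (σ : Fin n → S) (e : List (Fin n × S)) (k : Fin n),
    Measurable fun q : (Fin n → ℝ) × (Fin e.length → ℝ) × ℝ =>
      (P fun l => (σ l, q.1 l)).bypass e q.2.1 q.2.2 k

theorem measurable_phaseEffort (k : Fin n) {d : S → ℝ → ℝ≥0∞} (hd : ∀ i, Measurable (d i))
    (start : Fin n → ℝ)
    {next : SysState S n → (e : List (Fin n × S)) → (Fin e.length → ℝ) → ℝ → Fin n → ℝ}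
    (hnext : ∀ (σ : Fin n → S) (e : List (Fin n × S)) (l : Fin n), Measurable fun q : (Fin n → ℝ) × (Fin e.length → ℝ) × ℝ =>
      next (fun l => (σ l, q.1 l)) e q.2.1 q.2.2 l) (l : Fin n) (e : List (Fin n × S)) :
    ∀ σ : Fin n → S, Measurable fun q : (Fin n → ℝ) × (Fin e.length → ℝ) × ℝ =>
      J.phaseEffort k d start next e (fun l => (σ l, q.1 l)) q.2.1 q.2.2 l := by
  have hage : ∀ σ : Fin n → S, Measurable fun x : Fin n → ℝ => J.phaseAge d (σ k, x k) := by
    intro σ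
    simp only [phaseAge]
    by_cases h : σ k = J.fin
    · simp [h]
    · simp only [if_neg h]; exact (hd _).comp (measurable_pi_apply k)
  have hshift : ∀ {α : Type} [MeasurableSpace α] {f : α → Fin n → ℝ} {g : α → ℝ},
      Measurable f → Measurable g →
      Measurable fun a => fun l => f a l + (Pi.single k (g a) : Fin n → ℝ) l := by
    intro α _ f g hf hg
    refine measurable_pi_iff.2 fun l => ((measurable_pi_apply l).comp hf).add ?_
    by_cases h : l = k
    · subst h; simpa using hg
    · simp [h]
  induction e with
  | nil =>
    intro σ
    have h1 : Measurable fun q : (Fin n → ℝ) × (Fin 0 → ℝ) × ℝ =>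
        J.phaseAge d (σ k, q.1 k) := (hage σ).comp measurable_fst
    have h2 := (hnext σ [] l).comp ((hshift measurable_fst h1.ennreal_toReal).prodMk
      ((measurable_fst.comp measurable_snd).prodMk
        ((measurable_snd.comp measurable_snd).sub h1.ennreal_toReal)))
    simp only [phaseEffort, ite_apply]
    exact Measurable.ite (measurableSet_lt (ENNReal.measurable_ofReal.comp
      (measurable_snd.comp measurable_snd)) h1) measurable_const h2
  | cons p e ih =>
    obtain ⟨k', j⟩ := p
    intro σ
    have h1 : Measurable fun q : (Fin n → ℝ) × (Fin (e.length + 1) → ℝ) × ℝ =>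
        J.phaseAge d (σ k, q.1 k) := (hage σ).comp measurable_fst
    have ht : Measurable fun q : (Fin n → ℝ) × (Fin (e.length + 1) → ℝ) × ℝ => q.2.1 :=
      measurable_fst.comp measurable_snd
    have ht0 : Measurable fun q : (Fin n → ℝ) × (Fin (e.length + 1) → ℝ) × ℝ => q.2.1 0 :=
      (measurable_pi_apply 0).comp ht
    have htl : Measurable fun q : (Fin n → ℝ) × (Fin (e.length + 1) → ℝ) × ℝ =>
        Fin.tail q.2.1 :=
      measurable_pi_iff.2 fun m => (measurable_pi_apply m.succ).comp ht
    have hτ : Measurable fun q : (Fin n → ℝ) × (Fin (e.length + 1) → ℝ) × ℝ => q.2.2 :=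
      measurable_snd.comp measurable_snd
    have hcons : Measurable fun q : (Fin n → ℝ) × (Fin (e.length + 1) → ℝ) × ℝ =>
        (Fin.cons (q.2.1 0 - (J.phaseAge d (σ k, q.1 k)).toReal) (Fin.tail q.2.1) :
          Fin (e.length + 1) → ℝ) := by
      refine measurable_pi_iff.2 fun m => ?_
      induction m using Fin.cases with
      | zero => exact ht0.sub h1.ennreal_toReal
      | succ m => exact (measurable_pi_apply m).comp htl
    have h2 := (hnext σ ((k', j) :: e) l).comp ((hshift measurable_fst h1.ennreal_toReal).prodMk
      (hcons.prodMk hτ))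
    have h3 : Measurable fun q : (Fin n → ℝ) × (Fin (e.length + 1) → ℝ) × ℝ =>
        Function.update (fun m => q.1 m + (Pi.single k (q.2.1 0) : Fin n → ℝ) m) k' 0 := by
      refine measurable_pi_iff.2 fun m => ?_
      by_cases h : m = k'
      · subst h; simp
      · simp only [Function.update_of_ne h]
        exact (measurable_pi_apply m).comp (hshift measurable_fst ht0)
    have h4 := (ih (Function.update σ k' j)).comp (h3.prodMk (htl.prodMk hτ))
    have h5 : ∀ q : (Fin n → ℝ) × (Fin (e.length + 1) → ℝ) × ℝ,
        Function.update (shift (fun m => (σ m, q.1 m)) (Pi.single k (q.2.1 0))) k' (j, 0) =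
        fun m => (Function.update σ k' j m,
          Function.update (fun m => q.1 m + (Pi.single k (q.2.1 0) : Fin n → ℝ) m) k' 0 m) := by
      intro q
      ext1 m
      by_cases h : m = k'
      · subst h; simp
      · simp [h, shift]
    simp only [phaseEffort, ite_apply]
    refine Measurable.ite (measurableSet_lt (ENNReal.measurable_ofReal.comp ht0) h1) ?_ h2
    refine Eq.mp (congrArg Measurable (funext fun q => ?_)) h4
    exact congrArg (fun s => J.phaseEffort k d start next e s (Fin.tail q.2.1) q.2.2 l) (h5 q).symm

/-- A phase does nothing but spend the effort `start` on a job that is present, and continue with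
`next`. -/
theorem phaseEffort_cases (k : Fin n) (d : S → ℝ → ℝ≥0∞) (e : List (Fin n × S)) :
    ∀ (s : SysState S n) (t : Fin e.length → ℝ) (τ : ℝ),
      (stagesAfter (fun l => (s l).1) e k ≠ J.fin ∧
        ∀ start next, J.phaseEffort k d start next e s t τ = start) ∨
      ∃ s' e' t' τ', stagesAfter (fun l => (s' l).1) e' = stagesAfter (fun l => (s l).1) e ∧
        ∀ start next, J.phaseEffort k d start next e s t τ = next s' e' t' τ' := by
  induction e with
  | nil =>
    intro s t τ
    by_cases h : ENNReal.ofReal τ < J.phaseAge d (s k)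
    · refine Or.inl ⟨fun hk => ?_, fun start next => by rw [phaseEffort, if_pos h]⟩
      have hk' : (s k).1 = J.fin := hk
      simp [phaseAge, hk'] at h
    · exact Or.inr ⟨shift s (Pi.single k (J.phaseAge d (s k)).toReal), [], t, _, rfl,
        fun start next => by rw [phaseEffort, if_neg h]⟩
  | cons p e ih =>
    obtain ⟨k', j⟩ := p
    intro s t τ
    by_cases h : ENNReal.ofReal ((t : Fin (e.length + 1) → ℝ) 0) < J.phaseAge d (s k)
    · have hst : ∀ a, (fun l => (Function.update (shift s a) k' (j, (0 : ℝ)) l).1) =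
          Function.update (fun l => (s l).1) k' j := by
        intro a
        ext l
        by_cases hl : l = k'
        · subst hl; simp
        · simp [hl, shift]
      have := ih (Function.update (shift s (Pi.single k ((t : Fin (e.length + 1) → ℝ) 0))) k'
        (j, 0)) (Fin.tail (t : Fin (e.length + 1) → ℝ)) τ
      rw [hst] at this
      simp only [phaseEffort, if_pos h]
      exact this
    · exact Or.inr ⟨shift s (Pi.single k (J.phaseAge d (s k)).toReal), (k', j) :: e, _, _, rfl,
        fun start next => by rw [phaseEffort, if_neg h]⟩

theorem isStrategy_phase (k : Fin n) {d : S → ℝ → ℝ≥0∞} (hd : ∀ i, Measurable (d i))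
    {P : SysState S n → Policy S n} (hP : J.IsStrategy P) : J.IsStrategy (J.phase k d P) := by
  have h1 := measurable_phaseEffort (J := J) k hd (Pi.single k 1)
    (next := fun s => (P s).serve) hP.measurable_serve
  have h2 := measurable_phaseEffort (J := J) k hd 0 (next := fun s => (P s).bypass) hP.measurable_bypass
  refine ⟨fun s => ⟨fun e l => ?_, fun e l => ?_, fun e t τ l => ?_, fun e t τ l => ?_,
    fun e t τ l hl => ?_, fun e t τ hex => ?_⟩, fun σ e l => h1 l e σ, fun σ e l => h2 l e σ⟩
  · exact (h1 l e fun m => (s m).1).comp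
      ((measurable_const (a := fun m => (s m).2)).prodMk measurable_id)
  · exact (h2 l e fun m => (s m).1).comp
      ((measurable_const (a := fun m => (s m).2)).prodMk measurable_id)
  all_goals
    simp only [phase]
    rcases phaseEffort_cases (J := J) k d e s t τ with ⟨hk, h⟩ | ⟨s', e', t', τ', hst, h⟩
  · rw [h]; exact (Pi.single_nonneg.2 zero_le_one : (0 : Fin n → ℝ) ≤ Pi.single k 1) l
  · rw [h]; exact (hP.admissible s').serve_nonneg e' t' τ' l
  · rw [h]; exact le_rfl
  · rw [h]; exact (hP.admissible s').bypass_nonneg e' t' τ' l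
  · rw [h, h]
    have : l ≠ k := fun hlk => hk (hlk ▸ hl)
    simp [this]
  · rw [h, h]; exact (hP.admissible s').present e' t' τ' l (by rw [hst]; exact hl)
  · simp [h]
  · rw [h, h]; exact (hP.admissible s').total e' t' τ' (by rw [hst]; exact hex)

end JobType
end Multistage
end

noncomputable section

namespace Multistage

open Filter Topology
open scoped NNReal

/-! ### The cost of a policy that starts with a phase -/

/-- Integral of a function that is constant during a phase of length `D` and follows `g` after it. -/
theorem integral_of_phase {f g : ℝ → ℝ} {a : ℝ} {D : ℝ≥0∞} (hD : D ≠ ⊤)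
    (h1 : ∀ τ, ENNReal.ofReal τ < D → f τ = a)
    (h2 : ∀ τ, 0 ≤ τ → f (D.toReal + τ) = g τ)
    {t : ℝ} (ht : 0 ≤ t) (hg : IntervalIntegrable g volume 0 t) :
    ∫ τ in (0 : ℝ)..D.toReal + t, f τ = D.toReal * a + ∫ τ in (0 : ℝ)..t, g τ := by
  have hD0 : 0 ≤ D.toReal := ENNReal.toReal_nonneg
  have e1 : EqOn f (fun _ => a) (Ioo 0 D.toReal) := fun τ hτ =>
    h1 τ ((ENNReal.ofReal_lt_iff_lt_toReal hτ.1.le hD).2 hτ.2)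
  have e2 : EqOn f (fun τ => g (τ - D.toReal)) (Icc D.toReal (D.toReal + t)) := fun τ hτ =>
    by simpa using h2 (τ - D.toReal) (sub_nonneg.2 hτ.1)
  have hg' : IntervalIntegrable (fun τ => g (τ - D.toReal)) volume D.toReal (D.toReal + t) := by
    simpa [add_comm] using hg.comp_sub_right D.toReal
  have i1 : IntervalIntegrable f volume 0 D.toReal := by
    rw [intervalIntegrable_iff_integrableOn_Ioo_of_le hD0]
    exact (integrableOn_const (by simp)).congr_fun e1.symm measurableSet_Ioo
  have i2 : IntervalIntegrable f volume D.toReal (D.toReal + t) := by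
    rw [intervalIntegrable_iff_integrableOn_Icc_of_le (by linarith)] at hg' ⊢
    exact hg'.congr_fun e2.symm measurableSet_Icc
  rw [← intervalIntegral.integral_add_adjacent_intervals i1 i2]
  congr 1
  · rw [intervalIntegral.integral_of_le hD0, integral_Ioc_eq_integral_Ioo,
      setIntegral_congr_fun measurableSet_Ioo e1]
    simp [hD0]
  · rw [intervalIntegral.integral_congr (g := fun τ => g (τ - D.toReal))
      (by rw [uIcc_of_le (by linarith)]; exact e2)]
    rw [intervalIntegral.integral_comp_sub_right]
    simp

namespace JobType

variable {S : Type*} [Fintype S] [DecidableEq S] {J : JobType S} {n : ℕ} {k : Fin n}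
  {d : S → ℝ → ℝ≥0∞} {P : SysState S n → Policy S n} {s : SysState S n}

section Before

variable {t : ℝ} (ht : ENNReal.ofReal t < J.phaseAge d (s k))
include ht

theorem serveNow_phase_of_lt : (J.phase k d P s).serveNow t = Pi.single k 1 := by
  unfold Policy.serveNow phase
  simp only [phaseEffort, if_pos ht]

theorem bypassNow_phase_of_lt : (J.phase k d P s).bypassNow t = 0 := by
  unfold Policy.bypassNow phase
  simp only [phaseEffort, if_pos ht]

theorem served_phase_of_lt (h0 : 0 ≤ t) : (J.phase k d P s).served t = Pi.single k t := by
  ext l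
  have h : ∀ τ ∈ uIcc 0 t, (J.phase k d P s).serveNow τ l = (Pi.single k 1 : Fin n → ℝ) l := by
    intro τ hτ
    rw [uIcc_of_le h0] at hτ
    rw [serveNow_phase_of_lt ((ENNReal.ofReal_le_ofReal hτ.2).trans_lt ht)]
  rw [Policy.served, intervalIntegral.integral_congr h, intervalIntegral.integral_const]
  by_cases hl : l = k
  · subst hl; simp
  · simp [hl]

theorem survival_phase_of_lt (h0 : 0 ≤ t) (hs : ∀ k, J.Valid (s k)) (r : ℝ) :
    J.survival r s (J.phase k d P s) t = J.survivalFactor (s k) t := by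
  have h : ∀ τ ∈ uIcc 0 t, ∑ l, (J.phase k d P s).bypassNow τ l = 0 := by
    intro τ hτ
    rw [uIcc_of_le h0] at hτ
    rw [bypassNow_phase_of_lt ((ENNReal.ofReal_le_ofReal hτ.2).trans_lt ht)]
    simp
  rw [survival_eq, served_phase_of_lt ht h0, intervalIntegral.integral_congr h,
    survivalAt_eq s _ k, survivalExcept, Finset.prod_eq_one fun l hl => ?_]
  · simp
  · rw [Pi.single_eq_of_ne (Finset.ne_of_mem_erase hl), survivalFactor_zero (hs l)]

theorem jumpRate_phase_of_lt (h0 : 0 ≤ t) (r : ℝ) (l : Fin n) (j : S) :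
    J.jumpRate r s (J.phase k d P s) t l j =
      if l = k then J.trans (s k).1 j * J.hazard (s k).1 ((s k).2 + t) else 0 := by
  rw [jumpRate, served_phase_of_lt ht h0, serveNow_phase_of_lt ht, bypassNow_phase_of_lt ht]
  by_cases hl : l = k
  · subst hl; simp
  · simp [hl]

theorem stateAfter_phase_of_lt (h0 : 0 ≤ t) (j : S) :
    stateAfter s (J.phase k d P s) t k j = Function.update s k (j, 0) := by
  ext1 l
  rw [stateAfter, served_phase_of_lt ht h0]
  by_cases hl : l = k
  · subst hl; simp
  · simp [hl]

theorem after_phase_of_lt (j : S) :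
    (J.phase k d P s).after k j t = J.phase k d P (Function.update s k (j, 0)) := by
  have h : Function.update (shift s (Pi.single k t)) k (j, 0) = Function.update s k (j, 0) := by
    ext1 l
    by_cases hl : l = k
    · subst hl; simp
    · simp [hl, shift]
  unfold Policy.after phase
  congr 1 <;> ext e t' τ l <;> simp [phaseEffort, ht, h]

end Before

/-- The state at the end of a phase without jumps. -/
def phaseEnd (J : JobType S) (k : Fin n) (d : S → ℝ → ℝ≥0∞) (s : SysState S n) : SysState S n :=
  shift s (Pi.single k (J.phaseAge d (s k)).toReal)

theorem survivalFactor_add {p : JobState S} (hp : J.Valid p) {a b : ℝ} (ha : 0 ≤ a) (hb : 0 ≤ b) :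
    J.survivalFactor p (a + b) = J.survivalFactor p a * J.survivalFactor (p.1, p.2 + a) b := by
  unfold survivalFactor
  by_cases hi : p.1 = J.fin
  · simp [hi]
  simp only [if_neg hi, ← add_assoc]
  obtain ⟨hx, hT⟩ := hp hi
  rcases eq_or_ne (J.tail p.1 (p.2 + a)) 0 with h | h
  · have h1 := tail_anti hi (add_nonneg hx ha) (le_add_of_nonneg_right hb : p.2 + a ≤ p.2 + a + b)
    rw [h] at h1
    rw [le_antisymm h1 (tail_nonneg hi _), h]
    simp
  · field_simp

/-- The probability that no jump occurs during and after a phase factors at the end of the phase. -/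
theorem survivalAt_single_add (hs : ∀ k, J.Valid (s k)) {a : ℝ} (ha : 0 ≤ a) {b : Fin n → ℝ}
    (hb : 0 ≤ b) : J.survivalAt s (Pi.single k a + b) =
      J.survivalFactor (s k) a * J.survivalAt (shift s (Pi.single k a)) b := by
  rw [survivalAt_eq s _ k, survivalAt_eq _ b k, ← mul_assoc, Pi.add_apply, Pi.single_eq_same,
    survivalFactor_add (hs k) ha (hb k)]
  congr 1
  · simp [shift]
  · refine Finset.prod_congr rfl fun l hl => ?_
    simp [shift, Finset.ne_of_mem_erase hl]

section After

variable {t : ℝ} (hD : J.phaseAge d (s k) ≠ ⊤) (ht : 0 ≤ t)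
include hD ht

theorem not_lt_phaseAge :
    ¬ ENNReal.ofReal ((J.phaseAge d (s k)).toReal + t) < J.phaseAge d (s k) := by
  rw [not_lt, ENNReal.le_ofReal_iff_toReal_le hD (by positivity)]
  linarith

theorem serveNow_phase_add : (J.phase k d P s).serveNow ((J.phaseAge d (s k)).toReal + t) =
    (P (J.phaseEnd k d s)).serveNow t := by
  ext l
  unfold Policy.serveNow phase
  simp only [phaseEffort, if_neg (not_lt_phaseAge hD ht), add_sub_cancel_left]
  rfl

theorem bypassNow_phase_add : (J.phase k d P s).bypassNow ((J.phaseAge d (s k)).toReal + t) =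
    (P (J.phaseEnd k d s)).bypassNow t := by
  ext l
  unfold Policy.bypassNow phase
  simp only [phaseEffort, if_neg (not_lt_phaseAge hD ht), add_sub_cancel_left]
  rfl

theorem after_phase_add (l : Fin n) (j : S) :
    (J.phase k d P s).after l j ((J.phaseAge d (s k)).toReal + t) =
      (P (J.phaseEnd k d s)).after l j t := by
  unfold Policy.after phase
  congr 1 <;> ext e t' τ m <;>
    simp only [phaseEffort, Fin.cons_zero, if_neg (not_lt_phaseAge hD ht), add_sub_cancel_left,
      Fin.tail_cons] <;> rfl

variable (hP : J.IsStrategy P)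
include hP

theorem served_phase_add : (J.phase k d P s).served ((J.phaseAge d (s k)).toReal + t) =
    Pi.single k (J.phaseAge d (s k)).toReal + (P (J.phaseEnd k d s)).served t := by
  ext l
  have hA := hP.admissible (J.phaseEnd k d s)
  rw [Policy.served, integral_of_phase (g := fun t => (P (J.phaseEnd k d s)).serveNow t l)
    (a := (Pi.single k 1 : Fin n → ℝ) l) hD
    (fun τ hτ => by rw [serveNow_phase_of_lt hτ])
    (fun τ hτ => by rw [serveNow_phase_add hD hτ]) ht
    (intervalIntegrable_effort (hA.measurable_serveNow l) (fun t => hA.serve_nonneg [] _ t l)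
      (hA.serveNow_le_one l) 0 t)]
  · rw [Pi.add_apply, Policy.served]
    congr 1
    by_cases hl : l = k
    · subst hl; simp
    · simp [hl]

theorem survival_phase_add (hs : ∀ k, J.Valid (s k)) (r : ℝ) :
    J.survival r s (J.phase k d P s) ((J.phaseAge d (s k)).toReal + t) =
      J.survivalFactor (s k) (J.phaseAge d (s k)).toReal *
        J.survival r (J.phaseEnd k d s) (P (J.phaseEnd k d s)) t := by
  have hA := hP.admissible (J.phaseEnd k d s)
  rw [survival_eq, survival_eq, served_phase_add hD ht hP,
    integral_of_phase (g := fun t => ∑ l, (P (J.phaseEnd k d s)).bypassNow t l)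
    (a := 0) hD (fun τ hτ => by simp [bypassNow_phase_of_lt hτ])
    (fun τ hτ => by rw [bypassNow_phase_add hD hτ]) ht ?_,
    survivalAt_single_add hs ENNReal.toReal_nonneg (served_nonneg hA ht)]
  · rw [mul_zero, zero_add, mul_assoc]; rfl
  · have : (fun t => ∑ l, (P (J.phaseEnd k d s)).bypassNow t l) =
        ∑ l, fun t => (P (J.phaseEnd k d s)).bypassNow t l := by ext t; simp
    rw [this]
    exact IntervalIntegrable.sum _ fun l _ => intervalIntegrable_effort (hA.measurable_bypassNow l)
      (fun t => hA.bypass_nonneg [] _ t l) (hA.bypassNow_le_one l) 0 t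

theorem jumpRate_phase_add (r : ℝ) (l : Fin n) (j : S) :
    J.jumpRate r s (J.phase k d P s) ((J.phaseAge d (s k)).toReal + t) l j =
      J.jumpRate r (J.phaseEnd k d s) (P (J.phaseEnd k d s)) t l j := by
  rw [jumpRate, jumpRate, served_phase_add hD ht hP, serveNow_phase_add hD ht,
    bypassNow_phase_add hD ht, Pi.add_apply, ← add_assoc]
  rfl

theorem stateAfter_phase_add (l : Fin n) (j : S) :
    stateAfter s (J.phase k d P s) ((J.phaseAge d (s k)).toReal + t) l j =
      stateAfter (J.phaseEnd k d s) (P (J.phaseEnd k d s)) t l j := by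
  rw [stateAfter, stateAfter, served_phase_add hD ht hP]
  simp only [Pi.add_apply, ← add_assoc]
  rfl

end After

theorem phaseAge_of_ne (hk : (s k).1 ≠ J.fin) : J.phaseAge d (s k) = d (s k).1 (s k).2 :=
  if_neg hk

theorem numJobs_phaseEnd : J.numJobs (J.phaseEnd k d s) = J.numJobs s := rfl

/-- The cost of a policy that starts with a phase: the cost during the phase, the cost after the
first jump if that occurs during the phase, and otherwise the cost after the phase.  An inequality
suffices, and it holds without measurability of the cost after the first jump. -/
theorem costUpTo_phase_le (hs : ∀ k, J.Valid (s k)) (hP : J.IsStrategy P) (c : ℕ → ℝ≥0∞) (r : ℝ)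
    (hk : (s k).1 ≠ J.fin) (m : ℕ) :
    J.costUpTo c r (m + 1) s (J.phase k d P s) ≤
      c (J.numJobs s) * ENNReal.ofReal
        (J.workFor (s k).1 (s k).2 (J.phaseAge d (s k)) / J.tail (s k).1 (s k).2) +
      ENNReal.ofReal ((J.tail (s k).1 (s k).2 - J.tailAfter (s k).1 (s k).2 (J.phaseAge d (s k))) /
          J.tail (s k).1 (s k).2) *
        ∑ j, ENNReal.ofReal (J.trans (s k).1 j) * J.costUpTo c r m (Function.update s k (j, 0))
          (J.phase k d P (Function.update s k (j, 0))) +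
      ENNReal.ofReal (J.tailAfter (s k).1 (s k).2 (J.phaseAge d (s k)) / J.tail (s k).1 (s k).2) *
        J.costUpTo c r (m + 1) (J.phaseEnd k d s) (P (J.phaseEnd k d s)) := by
  obtain ⟨hx, hT⟩ := hs k hk
  set i := (s k).1 with hi
  set x := (s k).2 with hxdef
  set T := J.tail i x with hTdef
  set D := J.phaseAge d (s k) with hD
  set A : Set ℝ := {t : ℝ | 0 < t ∧ ENNReal.ofReal t < D} with hA
  have hAm : MeasurableSet A :=
    measurableSet_Ioi.inter (measurableSet_lt ENNReal.measurable_ofReal measurable_const)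
  have hsf : ∀ a, J.survivalFactor (s k) a = J.tail i (x + a) / T := fun a => if_neg hk
  -- the part of each integral that comes from the time after the phase
  have hsplit : ∀ F : ℝ → ℝ≥0∞, (D = ⊤ → ∫⁻ t in Ioi (0 : ℝ), F t = ∫⁻ t in A, F t) ∧
      (D ≠ ⊤ → ∫⁻ t in Ioi (0 : ℝ), F t ≤
        (∫⁻ t in A, F t) + ∫⁻ t in Ioi (0 : ℝ), F (D.toReal + t)) := by
    intro F
    refine ⟨fun h => ?_, fun h => ?_⟩
    · congr 2
      ext t
      simp [hA, h]
    · have h1 : ∫⁻ t in Ioi (0 : ℝ), F (D.toReal + t) = ∫⁻ t in Ici D.toReal, F t := by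
        rw [setLIntegral_congr Ioi_ae_eq_Ici.symm, ← setLIntegral_add_left D.toReal F]
        congr 2
        ext t; simp
      rw [h1]
      refine le_trans (lintegral_mono_set fun t ht => ?_) (lintegral_union_le _ _ _)
      rcases lt_or_ge t D.toReal with h2 | h2
      · exact Or.inl ⟨ht, (ENNReal.ofReal_lt_iff_lt_toReal (le_of_lt ht) h).2 h2⟩
      · exact Or.inr h2
  set G : ℝ → ℝ≥0∞ := fun t => ∑ l, ∑ j,
    ENNReal.ofReal (J.survival r s (J.phase k d P s) t * J.jumpRate r s (J.phase k d P s) t l j) *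
      J.costUpTo c r m (stateAfter s (J.phase k d P s) t l j) ((J.phase k d P s).after l j t)
    with hG
  set U : ℝ≥0∞ := ∑ j, ENNReal.ofReal (J.trans i j) * J.costUpTo c r m
    (Function.update s k (j, 0)) (J.phase k d P (Function.update s k (j, 0))) with hU
  have hbefore1 : ∫⁻ t in A, c (J.numJobs s) *
      ENNReal.ofReal (J.survival r s (J.phase k d P s) t) =
        c (J.numJobs s) * ENNReal.ofReal (J.workFor i x D / T) := by
    rw [← lintegral_before_tail hk hx hT D, ← lintegral_const_mul'' _ ?_]
    · refine setLIntegral_congr_fun hAm fun t ht => ?_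
      rw [survival_phase_of_lt ht.2 ht.1.le hs, hsf]
    · refine AEMeasurable.congr (f := fun t => ENNReal.ofReal (J.tail i (max (x + t) 0) / T))
        (ENNReal.measurable_ofReal.comp (((measurable_tail hk).comp
          (measurable_const_add x)).div_const T)).aemeasurable ?_
      filter_upwards [ae_restrict_mem hAm] with t ht
      rw [max_eq_left (add_nonneg hx ht.1.le)]
  have hbefore2 : ∫⁻ t in A, G t = ENNReal.ofReal ((T - J.tailAfter i x D) / T) * U := by
    rw [← lintegral_before_density hk hx hT D, ← lintegral_mul_const'' _ ?_]
    · have hae : ∀ᵐ t ∂(volume.restrict A), J.hazard i (x + t) * J.tail i (x + t) =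
          J.density i (x + t) := by
        have h1 := (measurePreserving_add_left volume x).quasiMeasurePreserving.ae
          ((ae_restrict_iff' measurableSet_Ioi).1 (hazard_mul_tail_ae (J := J) hk))
        filter_upwards [ae_restrict_of_ae h1, ae_restrict_mem hAm] with t ht htA
        exact ht (add_pos_of_nonneg_of_pos hx htA.1)
      refine lintegral_congr_ae ?_
      filter_upwards [hae, ae_restrict_mem hAm] with t ht htA
      simp only [hG]
      rw [Finset.sum_eq_single k]
      · rw [hU, Finset.mul_sum]
        refine Finset.sum_congr rfl fun j _ => ?_
        rw [survival_phase_of_lt htA.2 htA.1.le hs, hsf, jumpRate_phase_of_lt htA.2 htA.1.le,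
          if_pos rfl, stateAfter_phase_of_lt htA.2 htA.1.le, after_phase_of_lt htA.2,
          ← mul_assoc (ENNReal.ofReal (J.density i (x + t) / J.tail i x)),
          ← ENNReal.ofReal_mul (div_nonneg (J.density_nonneg i hk _) hT.le), ← ht]
        congr 2
        change J.tail i (x + t) / T * (J.trans i j * J.hazard i (x + t)) = _
        ring
      · intro l _ hl
        refine Finset.sum_eq_zero fun j _ => ?_
        rw [jumpRate_phase_of_lt htA.2 htA.1.le, if_neg hl]
        simp
      · simp
    · exact ENNReal.measurable_ofReal.comp_aemeasurable (((J.density_measurable i hk).comp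
        (measurable_const_add x)).div_const T).aemeasurable
  rw [costUpTo]
  by_cases htop : D = ⊤
  · rw [(hsplit _).1 htop, (hsplit _).1 htop, hbefore1, hbefore2]
    exact le_self_add
  have hratio0 : 0 ≤ J.survivalFactor (s k) D.toReal := survivalFactor_nonneg _
  have hratio : J.survivalFactor (s k) D.toReal = J.tailAfter i x D / T := by
    rw [hsf, tailAfter, if_neg htop]
  refine (add_le_add ((hsplit _).2 htop) ((hsplit _).2 htop)).trans ?_
  rw [hbefore1, hbefore2, add_add_add_comm]
  refine add_le_add le_rfl ?_
  rw [costUpTo, mul_add, ← hratio, ← lintegral_const_mul' _ _ ENNReal.ofReal_ne_top,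
    ← lintegral_const_mul' _ _ ENNReal.ofReal_ne_top]
  refine add_le_add (le_of_eq ?_) (le_of_eq ?_)
  · refine setLIntegral_congr_fun measurableSet_Ioi fun t ht => ?_
    rw [survival_phase_add htop (le_of_lt ht) hP hs, ENNReal.ofReal_mul hratio0, numJobs_phaseEnd]
    ring
  · refine setLIntegral_congr_fun measurableSet_Ioi fun t ht => ?_
    simp only [Finset.mul_sum]
    refine Finset.sum_congr rfl fun l _ => Finset.sum_congr rfl fun j _ => ?_
    rw [survival_phase_add htop (le_of_lt ht) hP hs, jumpRate_phase_add htop (le_of_lt ht) hP,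
      stateAfter_phase_add htop (le_of_lt ht) hP, after_phase_add htop (le_of_lt ht), mul_assoc,
      ENNReal.ofReal_mul hratio0, mul_assoc]

theorem phase_of_fin (hk : (s k).1 = J.fin) : J.phase k d P s = P s := by
  have h0 : J.phaseAge d (s k) = 0 := if_pos hk
  have h1 : shift s 0 = s := by ext1 l; simp [shift]
  unfold phase
  rcases hπ : P s with ⟨f, g⟩
  congr 1
  · funext e t τ l
    rcases e with _ | ⟨⟨k', j⟩, e⟩
    · simp [phaseEffort, h0, h1, hπ]
    · simp [phaseEffort, h0, h1, hπ]
  · funext e t τ l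
    rcases e with _ | ⟨⟨k', j⟩, e⟩
    · simp [phaseEffort, h0, h1, hπ]
    · simp [phaseEffort, h0, h1, hπ]

end JobType
end Multistage
end

noncomputable section

namespace Multistage

open Filter Topology
open scoped NNReal

namespace JobType

/-! ### Verification of upper bounds -/

variable {S : Type*} [Fintype S] [DecidableEq S] {J : JobType S} {n : ℕ}

theorem costUpTo_of_all_fin {s : SysState S n} (h : ∀ k, (s k).1 = J.fin) {π : Policy S n}
    (hπ : J.Admissible s π) {c : ℕ → ℝ≥0∞} (hc : c 0 = 0) (r : ℝ) (m : ℕ) :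
    J.costUpTo c r m s π = 0 := by
  have hN : J.numJobs s = 0 := by
    rw [numJobs, Finset.card_eq_zero, Finset.filter_eq_empty_iff]
    exact fun k _ hk => hk (h k)
  cases m with
  | zero => rfl
  | succ m =>
    rw [costUpTo, hN, hc]
    simp [jumpRate, hπ.serveNow_of_fin (h _), hπ.bypassNow_of_fin (h _)]

/-- Effort `1` on the first job that is present. -/
def firstPresent (J : JobType S) (s : SysState S n) (e : List (Fin n × S)) (k : Fin n) : ℝ :=
  if stagesAfter (fun l => (s l).1) e k ≠ J.fin ∧
    ∀ l < k, stagesAfter (fun l => (s l).1) e l = J.fin then 1 else 0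

theorem firstPresent_nonneg (s : SysState S n) (e : List (Fin n × S)) (k : Fin n) :
    0 ≤ J.firstPresent s e k := by
  unfold firstPresent; split_ifs <;> norm_num

theorem firstPresent_of_fin {s : SysState S n} {e : List (Fin n × S)} {k : Fin n}
    (h : stagesAfter (fun l => (s l).1) e k = J.fin) : J.firstPresent s e k = 0 :=
  if_neg fun h' => h'.1 h

theorem sum_firstPresent {s : SysState S n} {e : List (Fin n × S)}
    (h : ∃ k, stagesAfter (fun l => (s l).1) e k ≠ J.fin) : ∑ k, J.firstPresent s e k = 1 := by
  obtain ⟨k, hk, hmin⟩ := (wellFounded_lt (α := Fin n)).has_min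
    {k | stagesAfter (fun l => (s l).1) e k ≠ J.fin} h
  have hmin' : ∀ l < k, stagesAfter (fun l => (s l).1) e l = J.fin := fun l hl => by
    by_contra hne
    exact hmin l hne hl
  rw [Finset.sum_eq_single k]
  · exact if_pos ⟨hk, hmin'⟩
  · intro l _ hl
    refine if_neg fun h' => ?_
    rcases lt_or_gt_of_ne hl with h1 | h1
    · exact h'.1 (hmin' l h1)
    · exact hk (h'.2 k h1)
  · simp

/-- Serve the first job that is present. -/
def serveFirst (J : JobType S) (s : SysState S n) : Policy S n where
  serve e _ _ := J.firstPresent s e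
  bypass _ _ _ _ := 0

/-- Bypass the first job that is present. -/
def bypassFirst (J : JobType S) (s : SysState S n) : Policy S n where
  serve _ _ _ _ := 0
  bypass e _ _ := J.firstPresent s e

theorem isStrategy_serveFirst : J.IsStrategy (J.serveFirst (n := n)) where
  admissible s :=
    { measurable_serve := fun _ _ => measurable_const
      measurable_bypass := fun _ _ => measurable_const
      serve_nonneg := fun e _ _ k => firstPresent_nonneg s e k
      bypass_nonneg := fun _ _ _ _ => le_rfl
      present := fun _ _ _ _ h => ⟨firstPresent_of_fin h, rfl⟩
      total := fun _ _ _ h => by simpa [serveFirst] using sum_firstPresent h }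
  measurable_serve σ e k := measurable_const (a := J.firstPresent (fun l => (σ l, 0)) e k)
  measurable_bypass _ _ _ := measurable_const

theorem isStrategy_bypassFirst : J.IsStrategy (J.bypassFirst (n := n)) where
  admissible s :=
    { measurable_serve := fun _ _ => measurable_const
      measurable_bypass := fun _ _ => measurable_const
      serve_nonneg := fun _ _ _ _ => le_rfl
      bypass_nonneg := fun e _ _ k => firstPresent_nonneg s e k
      present := fun _ _ _ _ h => ⟨rfl, firstPresent_of_fin h⟩
      total := fun _ _ _ h => by simpa [bypassFirst] using sum_firstPresent h }
  measurable_serve _ _ _ := measurable_const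
  measurable_bypass σ e k := measurable_const (a := J.firstPresent (fun l => (σ l, 0)) e k)

theorem phaseEnd_eq_update (k : Fin n) (d : S → ℝ → ℝ≥0∞) {s : SysState S n}
    (hk : (s k).1 ≠ J.fin) : J.phaseEnd k d s =
      Function.update s k ((s k).1, (s k).2 + (d (s k).1 (s k).2).toReal) := by
  ext1 l
  by_cases hl : l = k
  · subst hl; simp [phaseEnd, shift, phaseAge_of_ne hk]
  · simp [phaseEnd, shift, hl]

/-- Verification of an upper bound `V` for the cost of a policy that starts with a phase, given an
upper bound `V'` for the cost of its continuation. -/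
theorem costUpTo_phase_le_of_potential {k : Fin n} {d : S → ℝ → ℝ≥0∞}
    {P : SysState S n → Policy S n} (hP : J.IsStrategy P) {c : ℕ → ℝ≥0∞} {c' : ℕ → ℝ}
    (hc : ∀ N, c N = ENNReal.ofReal (c' N)) (hc0 : ∀ N, 0 ≤ c' N) (r : ℝ)
    {I : SysState S n → Prop} {V V' : SysState S n → ℝ}
    (hI : ∀ s, I s → ∀ k, J.Valid (s k))
    (hjump : ∀ s, I s → ∀ j, I (Function.update s k (j, 0)))
    (hV : ∀ s, I s → 0 ≤ V s)
    (hfin : ∀ s, I s → (s k).1 = J.fin → V' s ≤ V s ∧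
      ∀ m, J.costUpTo c r m s (P s) ≤ ENNReal.ofReal (V' s))
    (hend : ∀ s, I s → (s k).1 ≠ J.fin →
      J.tailAfter (s k).1 (s k).2 (d (s k).1 (s k).2) ≠ 0 → 0 ≤ V' (J.phaseEnd k d s) ∧
      ∀ m, J.costUpTo c r m (J.phaseEnd k d s) (P (J.phaseEnd k d s)) ≤
        ENNReal.ofReal (V' (J.phaseEnd k d s)))
    (hstep : ∀ s, I s → (s k).1 ≠ J.fin →
      c' (J.numJobs s) * J.workFor (s k).1 (s k).2 (d (s k).1 (s k).2) +
        (J.tail (s k).1 (s k).2 - J.tailAfter (s k).1 (s k).2 (d (s k).1 (s k).2)) *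
          ∑ j, J.trans (s k).1 j * V (Function.update s k (j, 0)) +
        J.tailAfter (s k).1 (s k).2 (d (s k).1 (s k).2) * V' (J.phaseEnd k d s) ≤
      J.tail (s k).1 (s k).2 * V s) (m : ℕ) :
    ∀ s, I s → J.costUpTo c r m s (J.phase k d P s) ≤ ENNReal.ofReal (V s) := by
  induction m with
  | zero => intro s _; exact zero_le
  | succ m ih =>
    intro s hs
    by_cases hk : (s k).1 = J.fin
    · rw [phase_of_fin hk]
      exact ((hfin s hs hk).2 _).trans (ENNReal.ofReal_le_ofReal (hfin s hs hk).1)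
    obtain ⟨hx, hT⟩ := hI s hs k hk
    have h1 := costUpTo_phase_le (d := d) (hI s hs) hP c r hk m
    rw [phaseAge_of_ne hk] at h1
    have h2 := hstep s hs hk
    have h3 := hend s hs hk
    set i := (s k).1
    set x := (s k).2
    set T := J.tail i x
    set W := J.workFor i x (d i x)
    set A := J.tailAfter i x (d i x)
    have hW : 0 ≤ W := workFor_nonneg hk _ _
    have hA0 : 0 ≤ A := tailAfter_nonneg hk _ _
    have hA : A ≤ T := tailAfter_le hk hx _
    have e1 : ∑ j, ENNReal.ofReal (J.trans i j) * J.costUpTo c r m (Function.update s k (j, 0))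
        (J.phase k d P (Function.update s k (j, 0))) ≤
        ENNReal.ofReal (∑ j, J.trans i j * V (Function.update s k (j, 0))) := by
      rw [ENNReal.ofReal_sum_of_nonneg fun j _ =>
        mul_nonneg (J.trans_nonneg _ _) (hV _ (hjump s hs j))]
      refine Finset.sum_le_sum fun j _ => ?_
      rw [ENNReal.ofReal_mul (J.trans_nonneg _ _)]
      exact mul_le_mul_right (ih _ (hjump s hs j)) _
    have e2 : ENNReal.ofReal (A / T) * J.costUpTo c r (m + 1) (J.phaseEnd k d s)
        (P (J.phaseEnd k d s)) ≤ ENNReal.ofReal (A / T * V' (J.phaseEnd k d s)) ∧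
        0 ≤ A / T * V' (J.phaseEnd k d s) := by
      rcases eq_or_ne A 0 with hA1 | hA1
      · simp [hA1]
      · refine ⟨?_, mul_nonneg (div_nonneg hA0 hT.le) (h3 hA1).1⟩
        rw [ENNReal.ofReal_mul (div_nonneg hA0 hT.le)]
        exact mul_le_mul_right ((h3 hA1).2 _) _
    have hsum : 0 ≤ ∑ j, J.trans i j * V (Function.update s k (j, 0)) :=
      Finset.sum_nonneg fun j _ => mul_nonneg (J.trans_nonneg _ _) (hV _ (hjump s hs j))
    refine h1.trans ((add_le_add (add_le_add le_rfl (mul_le_mul_right e1 _)) e2.1).trans ?_)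
    rw [hc, ← ENNReal.ofReal_mul (hc0 _),
      ← ENNReal.ofReal_mul (div_nonneg (sub_nonneg.2 hA) hT.le),
      ← ENNReal.ofReal_add (mul_nonneg (hc0 _) (div_nonneg hW hT.le))
        (mul_nonneg (div_nonneg (sub_nonneg.2 hA) hT.le) hsum),
      ← ENNReal.ofReal_add (add_nonneg (mul_nonneg (hc0 _) (div_nonneg hW hT.le))
        (mul_nonneg (div_nonneg (sub_nonneg.2 hA) hT.le) hsum)) e2.2]
    refine ENNReal.ofReal_le_ofReal ?_
    rw [← sub_nonneg] at h2 ⊢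
    refine le_of_le_of_eq (div_nonneg h2 hT.le) ?_
    field_simp

/-! ### An optimal policy for serving and bypassing one job -/

/-- A job that is bypassed all the time leaves after an exponential time of mean `r`. -/
theorem costUpTo_bypassFirst_le {r : ℝ} (hr : 0 < r) (s : SysState S 1) (hs : J.Valid (s 0))
    (m : ℕ) : J.costUpTo (fun N => if N = 0 then 0 else 1) r m s (J.bypassFirst s) ≤
      ENNReal.ofReal r := by
  by_cases hi : (s 0).1 = J.fin
  · rw [costUpTo_of_all_fin (fun k => by rw [Subsingleton.elim k 0]; exact hi)
      (isStrategy_bypassFirst.admissible s) (by simp)]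
    exact zero_le
  obtain ⟨hx, hT⟩ := hs hi
  cases m with
  | zero => exact zero_le
  | succ m =>
    have hserve : ∀ t k, (J.bypassFirst s).serveNow t k = 0 := fun _ _ => rfl
    have hbyp : ∀ t k, (J.bypassFirst s).bypassNow t k = 1 := fun t k => by
      rw [Subsingleton.elim k 0]
      refine if_pos ⟨hi, fun l hl => ?_⟩
      rw [Subsingleton.elim l 0] at hl
      exact absurd hl (lt_irrefl _)
    have hserved : ∀ t k, (J.bypassFirst s).served t k = 0 := fun t k => by
      simp [Policy.served, hserve]
    have hsurv : ∀ t, J.survival r s (J.bypassFirst s) t = Real.exp (-(1 / r) * t) := fun t => by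
      simp only [survival, Fin.prod_univ_one, Fin.sum_univ_one, if_neg hi, hserved, hbyp, add_zero,
        div_self hT.ne', one_mul, intervalIntegral.integral_const, sub_zero, smul_eq_mul, mul_one]
      congr 1; ring
    have hN : J.numJobs s ≠ 0 := (Finset.card_pos.2 ⟨0, by simp [hi]⟩).ne'
    have h2 : ∫⁻ t in Ioi (0 : ℝ), ∑ k, ∑ j,
        ENNReal.ofReal (J.survival r s (J.bypassFirst s) t *
          J.jumpRate r s (J.bypassFirst s) t k j) *
        J.costUpTo (fun N => if N = 0 then 0 else 1) r m (stateAfter s (J.bypassFirst s) t k j)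
          ((J.bypassFirst s).after k j t) = 0 := by
      refine (lintegral_congr fun t => ?_).trans lintegral_zero
      refine Finset.sum_eq_zero fun k _ => Finset.sum_eq_zero fun j _ => ?_
      by_cases hj : j = J.fin
      · rw [costUpTo_of_all_fin (fun l => ?_) ((isStrategy_bypassFirst.admissible s).after k j t
          (stateAfter_stages s _ t k j)) (by simp), mul_zero]
        rw [Subsingleton.elim l k]
        simpa [stateAfter] using hj
      · simp [jumpRate, hserve, hj]
    rw [costUpTo, h2, add_zero, if_neg hN]
    simp only [one_mul, hsurv]
    have hint := integrableOn_exp_mul_Ioi (a := -(1 / r)) (by simpa using hr) 0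
    rw [← ofReal_integral_eq_lintegral_ofReal hint
      (ae_of_all _ fun t => (Real.exp_pos _).le), integral_exp_mul_Ioi (by simpa using hr)]
    refine ENNReal.ofReal_le_ofReal (le_of_eq ?_)
    simp

/-- Serving a single job until its giving-up age, and bypassing it from then on, is optimal. -/
theorem costA_eq {r : ℝ} (hr : 0 < r) {p : JobState S} (hp : J.Valid p) :
    J.costA r (fun _ : Fin 1 => p) = ENNReal.ofReal (J.optCost p.1 p.2 r) := by
  set c : ℕ → ℝ≥0∞ := fun N => if N = 0 then 0 else 1 with hc
  refine le_antisymm ?_ ?_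
  · have hstrat : J.IsStrategy (J.phase (0 : Fin 1) (fun i x => J.giveUp i r x) J.bypassFirst) :=
      isStrategy_phase 0 (fun i => measurable_giveUp i r) isStrategy_bypassFirst
    refine iInf₂_le_of_le _ (hstrat.admissible _) (iSup_le fun m => ?_)
    refine costUpTo_phase_le_of_potential (c := c) (c' := fun N => if N = 0 then 0 else 1)
      isStrategy_bypassFirst (fun N => ?_) (fun N => ?_) r (I := fun s => ∀ k, J.Valid (s k))
      (V := fun s => J.optCost (s 0).1 (s 0).2 r)
      (V' := fun s => if (s 0).1 = J.fin then 0 else r) (fun _ h => h)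
      (fun s hs j => valid_update hs 0 (valid_zero j))
      (fun s hs => (retirementCost_optCost (hs 0)).nonneg hr.le) (fun s hs hk => ?_)
      (fun s hs hk hA => ?_) (fun s hs hk => ?_) m _ (fun _ => hp)
    · simp only [hc]; split_ifs <;> simp
    · split_ifs <;> norm_num
    · rw [hk, if_pos rfl]
      refine ⟨by rw [optCost_fin]; simp [hr.le], fun m => ?_⟩
      rw [costUpTo_of_all_fin (fun k => by rw [Subsingleton.elim k 0]; exact hk)
        (isStrategy_bypassFirst.admissible s) (by simp [hc])]
      exact zero_le
    · have hfin : (J.phaseEnd 0 (fun i x => J.giveUp i r x) s 0).1 ≠ J.fin := hk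
      rw [if_neg hfin]
      refine ⟨hr.le, fun m => costUpTo_bypassFirst_le hr _ ?_ m⟩
      rw [phaseEnd_eq_update _ _ hk, Function.update_self]
      exact ((tailAfter_giveUp_cases hk (hs 0 hk).1).resolve_left hA).1
    · have hfin : (J.phaseEnd 0 (fun i x => J.giveUp i r x) s 0).1 ≠ J.fin := hk
      have hN : J.numJobs s ≠ 0 := (Finset.card_pos.2 ⟨0, by simp [hk]⟩).ne'
      rw [if_neg hfin, if_neg hN, one_mul, tail_mul_optCost_eq hk hr.le le_rfl (hs 0 hk).1]
      simp only [Function.update_self]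
      refine add_le_add le_rfl ?_
      rcases tailAfter_giveUp_cases hk (r := r) (hs 0 hk).1 with h | ⟨hv, h⟩
      · rw [h, zero_mul, zero_mul]
      · have := (retirementCost_optCost hv).eq_self_of_rightSlope_eq_one h
        rw [this]
  · refine le_iInf₂ fun π hπ => ?_
    refine le_trans ?_ (le_iSup _ (J.rank p.1))
    exact ofReal_optCost_le_costUpTo hr _ (fun _ => p) π hp hπ le_rfl

end JobType
end Multistage
end

noncomputable section

namespace Multistage

open Filter Topology
open scoped NNReal

namespace JobType

/-! ### Serving the jobs in turn up to a common giving-up level -/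

variable {S : Type*} [Fintype S] [DecidableEq S] {J : JobType S} {n : ℕ}

/-- Indicator of the job being in the system. -/
def isPresent (J : JobType S) (p : JobState S) : ℝ := if p.1 = J.fin then 0 else 1

theorem isPresent_nonneg (p : JobState S) : 0 ≤ J.isPresent p := by
  unfold isPresent; split_ifs <;> norm_num

theorem isPresent_le_one (p : JobState S) : J.isPresent p ≤ 1 := by
  unfold isPresent; split_ifs <;> norm_num

theorem isPresent_of_fin {p : JobState S} (h : p.1 = J.fin) : J.isPresent p = 0 := if_pos h

theorem isPresent_of_ne {p : JobState S} (h : p.1 ≠ J.fin) : J.isPresent p = 1 := if_neg h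

/-- Serve the jobs `k - 1, …, 0` in turn, job `l` until it has aged by `d`, and then follow `P`. -/
def serveDown (J : JobType S) (d : S → ℝ → ℝ≥0∞) (P : SysState S n → Policy S n) :
    ℕ → SysState S n → Policy S n
  | 0 => P
  | k + 1 => if h : k < n then J.phase ⟨k, h⟩ d (serveDown J d P k) else serveDown J d P k

theorem isStrategy_serveDown {d : S → ℝ → ℝ≥0∞} (hd : ∀ i, Measurable (d i))
    {P : SysState S n → Policy S n} (hP : J.IsStrategy P) (k : ℕ) :
    J.IsStrategy (J.serveDown d P k) := by
  induction k with
  | zero => exact hP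
  | succ k ih =>
    rw [serveDown]
    split_ifs
    · exact isStrategy_phase _ hd ih
    · exact ih

/-- The data used to bound the cost of serving all jobs once, each until its age has grown by `d` in
the current stage: the expected cost `a p` of this service to a job in state `p`, including a terminal
cost of giving up, and a remaining cost `R p q` for each pair of jobs, which does not increase on
average while one of the jobs is served.  `Z p` says that the job has left or has reached the end of
its service. -/
structure Level (J : JobType S) (d : S → ℝ → ℝ≥0∞) (a : JobState S → ℝ)
    (R : JobState S → JobState S → ℝ) (Z : JobState S → Prop) : Prop where
  measurable_age : ∀ i, Measurable (d i)
  nonneg : ∀ p, J.Valid p → 0 ≤ a p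
  service : ∀ i x, i ≠ J.fin → J.Valid (i, x) →
    J.workFor i x (d i x) + (J.tail i x - J.tailAfter i x (d i x)) * (∑ j, J.trans i j * a (j, 0)) +
      J.tailAfter i x (d i x) * a (i, x + (d i x).toReal) = J.tail i x * a (i, x)
  rest_nonneg : ∀ p q, J.Valid p → J.Valid q → 0 ≤ R p q
  rest_left : ∀ i x q, i ≠ J.fin → J.Valid (i, x) → J.Valid q →
    (J.tail i x - J.tailAfter i x (d i x)) * (∑ j, J.trans i j * R (j, 0) q) +
      J.tailAfter i x (d i x) * R (i, x + (d i x).toReal) q ≤ J.tail i x * R (i, x) q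
  rest_right : ∀ i x q, i ≠ J.fin → J.Valid (i, x) → J.Valid q →
    (J.tail i x - J.tailAfter i x (d i x)) * (∑ j, J.trans i j * R q (j, 0)) +
      J.tailAfter i x (d i x) * R q (i, x + (d i x).toReal) ≤ J.tail i x * R q (i, x)
  finished : ∀ i x, i ≠ J.fin → J.Valid (i, x) → J.tailAfter i x (d i x) ≠ 0 →
    J.Valid (i, x + (d i x).toReal) ∧ Z (i, x + (d i x).toReal)
  finished_fin : ∀ p, p.1 = J.fin → Z p
  exchange : ∀ p q, J.Valid p → J.Valid q → Z p → a q * J.isPresent p ≤ a p * J.isPresent q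

/-- The contribution of a pair of jobs to the cost bound.  Of a pair, the job with the larger index is
served first, while the other waits; once this is done, i.e. if the larger index is at least `k`,
the pair waits for the other job. -/
def levelPair (J : JobType S) (a : JobState S → ℝ) (R : JobState S → JobState S → ℝ) (k : ℕ)
    (s : SysState S n) (j l : Fin n) : ℝ :=
  (if (l : ℕ) < k then a (s l) * J.isPresent (s j) else a (s j) * J.isPresent (s l)) +
    R (s j) (s l)

/-- The cost bound when the jobs `k - 1, …, 0` are still to be served. -/
def levelCost (J : JobType S) (a : JobState S → ℝ) (R : JobState S → JobState S → ℝ) (k : ℕ)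
    (s : SysState S n) : ℝ :=
  ∑ j, ∑ l ∈ Finset.Ioi j, J.levelPair a R k s j l

namespace Level

variable {d : S → ℝ → ℝ≥0∞} {a : JobState S → ℝ} {R : JobState S → JobState S → ℝ}
  {Z : JobState S → Prop} (H : J.Level d a R Z)
include H

theorem levelCost_nonneg (k : ℕ) {s : SysState S n} (hs : ∀ k, J.Valid (s k)) :
    0 ≤ J.levelCost a R k s := by
  refine Finset.sum_nonneg fun j _ => Finset.sum_nonneg fun l _ => ?_
  refine add_nonneg ?_ (H.rest_nonneg _ _ (hs j) (hs l))
  split_ifs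
  · exact mul_nonneg (H.nonneg _ (hs l)) (isPresent_nonneg _)
  · exact mul_nonneg (H.nonneg _ (hs j)) (isPresent_nonneg _)

theorem levelCost_le_succ {k : Fin n} {s : SysState S n} (hs : ∀ k, J.Valid (s k))
    (hZ : Z (s k)) : J.levelCost a R k s ≤ J.levelCost a R (k + 1) s := by
  refine Finset.sum_le_sum fun j _ => Finset.sum_le_sum fun l _ => add_le_add ?_ le_rfl
  rcases lt_trichotomy (l : ℕ) k with h | h | h
  · rw [if_pos h, if_pos (by omega)]
  · rw [if_neg (by omega), if_pos (by omega)]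
    have : l = k := Fin.ext h
    rw [this]
    exact H.exchange _ _ (hs k) (hs j) hZ
  · rw [if_neg (by omega), if_neg (by omega)]

omit H in
theorem levelCost_update (a : JobState S → ℝ) (R : JobState S → JobState S → ℝ) (k : Fin n)
    (s : SysState S n) (p : JobState S) :
    J.levelCost a R (k + 1) (Function.update s k p) =
      ∑ l ∈ Finset.univ.erase k, (a p * J.isPresent (s l) +
        if k < l then R p (s l) else R (s l) p) +
      ∑ j ∈ Finset.univ.erase k, ∑ l ∈ Finset.univ.erase k,
        if j < l then J.levelPair a R (k + 1) s j l else 0 := by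
  rw [levelCost, sum_pairs_eq _ k]
  congr 1
  · refine Finset.sum_congr rfl fun l hl => ?_
    have hlk := Finset.ne_of_mem_erase hl
    by_cases h : k < l
    · have h' : ¬ (l : ℕ) < k + 1 := by have := Fin.lt_def.1 h; omega
      simp [levelPair, h, hlk, h']
    · simp [levelPair, h, hlk]
  · refine Finset.sum_congr rfl fun j hj => Finset.sum_congr rfl fun l hl => ?_
    simp [levelPair, Finset.ne_of_mem_erase hj, Finset.ne_of_mem_erase hl]

/-- Serving one job pays for the delay of the others. -/
theorem levelCost_step {k : Fin n} {s : SysState S n} (hs : ∀ k, J.Valid (s k))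
    (hk : (s k).1 ≠ J.fin) :
    ((J.numJobs s - 1 : ℕ) : ℝ) * J.workFor (s k).1 (s k).2 (d (s k).1 (s k).2) +
        (J.tail (s k).1 (s k).2 - J.tailAfter (s k).1 (s k).2 (d (s k).1 (s k).2)) *
          ∑ j, J.trans (s k).1 j * J.levelCost a R (k + 1) (Function.update s k (j, 0)) +
        J.tailAfter (s k).1 (s k).2 (d (s k).1 (s k).2) *
          J.levelCost a R (k + 1) (J.phaseEnd k d s) ≤
      J.tail (s k).1 (s k).2 * J.levelCost a R (k + 1) s := by
  have hself : J.levelCost a R (k + 1) s =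
      J.levelCost a R (k + 1) (Function.update s k ((s k).1, (s k).2)) := by
    rw [Prod.mk.eta, Function.update_eq_self]
  rw [hself, phaseEnd_eq_update k d hk, ← numOthers_eq hk, numOthers]
  have hv : J.Valid ((s k).1, (s k).2) := hs k
  generalize (s k).1 = i at hk hv ⊢
  generalize (s k).2 = x at hv ⊢
  simp only [levelCost_update, mul_add, Finset.sum_add_distrib, ← Finset.sum_mul, J.trans_sum,
    one_mul]
  have hterm : ∀ l ∈ Finset.univ.erase k,
      (if (s l).1 = J.fin then 0 else 1) * J.workFor i x (d i x) +
      ((J.tail i x - J.tailAfter i x (d i x)) * (∑ j, J.trans i j * (a (j, 0) * J.isPresent (s l) +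
        if k < l then R (j, 0) (s l) else R (s l) (j, 0))) +
      J.tailAfter i x (d i x) * (a (i, x + (d i x).toReal) * J.isPresent (s l) +
        if k < l then R (i, x + (d i x).toReal) (s l) else R (s l) (i, x + (d i x).toReal))) ≤
      J.tail i x * (a (i, x) * J.isPresent (s l) +
        if k < l then R (i, x) (s l) else R (s l) (i, x)) := by
    intro l _
    have h1 := congrArg (· * J.isPresent (s l)) (H.service i x hk hv)
    have h2 := H.rest_left i x (s l) hk hv (hs l)
    have h3 := H.rest_right i x (s l) hk hv (hs l)
    have h4 : (if (s l).1 = J.fin then (0 : ℝ) else 1) = J.isPresent (s l) := rfl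
    rw [h4]
    simp only [mul_add, Finset.sum_add_distrib, ← mul_assoc, ← Finset.sum_mul]
    split_ifs <;> linarith
  have hsum := Finset.sum_le_sum hterm
  simp only [Finset.sum_add_distrib, ← Finset.mul_sum, mul_add, ← Finset.sum_mul] at hsum ⊢
  have hcomm : ∀ f : Fin n → S → ℝ, ∑ l ∈ Finset.univ.erase k, ∑ j, J.trans i j * f l j =
      ∑ j, J.trans i j * ∑ l ∈ Finset.univ.erase k, f l j := by
    intro f
    rw [Finset.sum_comm]
    simp only [Finset.mul_sum]
  simp only [hcomm] at hsum
  simp only [← Finset.mul_sum] at hsum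
  linarith

/-- The cost bound for one round of service. -/
theorem costUpTo_serveDown_le {P : SysState S n → Policy S n} (hP : J.IsStrategy P)
    (hcost : ∀ s, (∀ k, J.Valid (s k)) → (∀ k, Z (s k)) → ∀ m,
      J.costUpTo (fun N => ((N - 1 : ℕ) : ℝ≥0∞)) 1 m s (P s) ≤
        ENNReal.ofReal (J.levelCost a R 0 s)) (k : ℕ) (hkn : k ≤ n) :
    ∀ s : SysState S n, (∀ k, J.Valid (s k)) → (∀ l : Fin n, k ≤ l → Z (s l)) → ∀ m,
      J.costUpTo (fun N => ((N - 1 : ℕ) : ℝ≥0∞)) 1 m s (J.serveDown d P k s) ≤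
        ENNReal.ofReal (J.levelCost a R k s) := by
  induction k with
  | zero => exact fun s hs hZ => hcost s hs fun k => hZ k (Nat.zero_le _)
  | succ k ih =>
    intro s hs hZ m
    have hkn' : k < n := hkn
    rw [serveDown, dif_pos hkn']
    set κ : Fin n := ⟨k, hkn'⟩ with hκ
    have hZ' : ∀ s : SysState S n, (∀ l : Fin n, k + 1 ≤ l → Z (s l)) → Z (s κ) →
        ∀ l : Fin n, k ≤ l → Z (s l) := by
      intro s h1 h2 l hl
      rcases hl.eq_or_lt with h | h
      · have : l = κ := Fin.ext h.symm
        rwa [this]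
      · exact h1 l h
    have hupd : ∀ s : SysState S n, (∀ l : Fin n, k + 1 ≤ l → Z (s l)) → ∀ p,
        ∀ l : Fin n, k + 1 ≤ l → Z (Function.update s κ p l) := by
      intro s h1 p l hl
      have : l ≠ κ := fun h => by rw [h, hκ] at hl; simp at hl
      rw [Function.update_of_ne this]
      exact h1 l hl
    have hend : ∀ s : SysState S n, ((∀ k, J.Valid (s k)) ∧ ∀ l : Fin n, k + 1 ≤ l → Z (s l)) →
        (s κ).1 ≠ J.fin → J.tailAfter (s κ).1 (s κ).2 (d (s κ).1 (s κ).2) ≠ 0 →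
        (∀ k, J.Valid (J.phaseEnd κ d s k)) ∧ (∀ l : Fin n, k ≤ l → Z (J.phaseEnd κ d s l)) := by
      intro s hs hk hA
      obtain ⟨h1, h2⟩ := H.finished _ _ hk (hs.1 κ) hA
      rw [phaseEnd_eq_update κ d hk]
      refine ⟨valid_update hs.1 κ h1, hZ' _ (hupd s hs.2 _) ?_⟩
      rwa [Function.update_self]
    refine costUpTo_phase_le_of_potential (c' := fun N => ((N - 1 : ℕ) : ℝ))
      (isStrategy_serveDown H.measurable_age hP k) (fun N => (ENNReal.ofReal_natCast _).symm)
      (fun N => Nat.cast_nonneg _) 1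
      (I := fun s => (∀ k, J.Valid (s k)) ∧ ∀ l : Fin n, k + 1 ≤ l → Z (s l))
      (V := J.levelCost a R (k + 1)) (V' := J.levelCost a R k) (fun s hs => hs.1)
      (fun s hs j => ⟨valid_update hs.1 κ (valid_zero j), hupd s hs.2 _⟩)
      (fun s hs => H.levelCost_nonneg _ hs.1) (fun s hs hk => ?_) (fun s hs hk hA => ?_)
      (fun s hs hk => ?_) m s ⟨hs, hZ⟩
    · have hZκ := H.finished_fin _ hk
      exact ⟨H.levelCost_le_succ (k := κ) hs.1 hZκ, ih (by omega) s hs.1 (hZ' s hs.2 hZκ)⟩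
    · obtain ⟨h1, h2⟩ := hend s hs hk hA
      exact ⟨H.levelCost_nonneg _ h1, ih (by omega) _ h1 h2⟩
    · refine le_trans (add_le_add le_rfl ?_) (H.levelCost_step (k := κ) hs.1 hk)
      rcases eq_or_ne (J.tailAfter (s κ).1 (s κ).2 (d (s κ).1 (s κ).2)) 0 with hA | hA
      · rw [hA, zero_mul, zero_mul]
      · obtain ⟨h1, h2⟩ := hend s hs hk hA
        exact mul_le_mul_of_nonneg_left (H.levelCost_le_succ (k := κ) h1 (h2 κ le_rfl))
          (tailAfter_nonneg hk _ _)

end Level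

end JobType
end Multistage
end

noncomputable section

namespace Multistage

open Filter Topology
open scoped NNReal

namespace JobType

/-! ### Serving the jobs along a grid of giving-up levels -/

variable {S : Type*} [Fintype S] [DecidableEq S] {J : JobType S} {n : ℕ}

/-- The remaining cost of a pair of jobs when the jobs are going to be served up to the levels
`ρ, ρ + δ, …, ρ + (m - 1) δ` in turn, and then to completion.  After the last level only the job `q`,
which has the larger index and is served first, delays the other one. -/
def levelRest (J : JobType S) (δ : ℝ) : ℕ → ℝ → JobState S → JobState S → ℝ
  | 0, ρ, p, q => (J.fullCost q - J.optCost q.1 q.2 ρ) * J.isPresent p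
  | m + 1, ρ, p, q => δ * (J.slope p ρ * J.slope q ρ) + levelRest J δ m (ρ + δ) p q

/-- Serve the jobs up to the levels `ρ, ρ + δ, …, ρ + (m - 1) δ` in turn, and then to completion. -/
def levelPolicy (J : JobType S) (δ : ℝ) : ℕ → ℝ → SysState S n → Policy S n
  | 0, _ => J.serveDown (fun _ _ => ⊤) J.serveFirst n
  | m + 1, ρ => J.serveDown (fun i x => J.giveUp i ρ x) (levelPolicy J δ m (ρ + δ)) n

theorem isStrategy_levelPolicy (δ : ℝ) (m : ℕ) (ρ : ℝ) :
    J.IsStrategy (J.levelPolicy (n := n) δ m ρ) := by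
  induction m generalizing ρ with
  | zero => exact isStrategy_serveDown (fun _ => measurable_const) isStrategy_serveFirst n
  | succ m ih => exact isStrategy_serveDown (fun i => measurable_giveUp i ρ) (ih _) n

theorem bypass_serveDown {d : S → ℝ → ℝ≥0∞} {P : SysState S n → Policy S n}
    (hP : ∀ s e t τ, (P s).bypass e t τ = 0) (k : ℕ) :
    ∀ s e t τ, (J.serveDown d P k s).bypass e t τ = 0 := by
  induction k with
  | zero => exact hP
  | succ k ih =>
    intro s e t τ
    rw [serveDown]
    split_ifs with h
    · rcases phaseEffort_cases (J := J) ⟨k, h⟩ d e s t τ with ⟨_, h1⟩ | ⟨s', e', t', τ', _, h1⟩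
      · exact h1 _ _
      · exact (h1 _ _).trans (ih s' e' t' τ')
    · exact ih s e t τ

theorem bypass_levelPolicy (δ : ℝ) (m : ℕ) (ρ : ℝ) (s : SysState S n) :
    ∀ e t τ, (J.levelPolicy δ m ρ s).bypass e t τ = 0 := by
  induction m generalizing ρ s with
  | zero => exact bypass_serveDown (fun _ _ _ _ => rfl) n s
  | succ m ih => exact bypass_serveDown (fun s => ih _ s) n s

theorem levelRest_nonneg {δ : ℝ} (hδ : 0 ≤ δ) (m : ℕ) (ρ : ℝ) {p q : JobState S}
    (hp : J.Valid p) (hq : J.Valid q) : 0 ≤ J.levelRest δ m ρ p q := by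
  induction m generalizing ρ with
  | zero => exact mul_nonneg (sub_nonneg.2 (optCost_le_fullCost hq ρ)) (isPresent_nonneg p)
  | succ m ih =>
    exact add_nonneg (mul_nonneg hδ (mul_nonneg (slope_nonneg hp ρ) (slope_nonneg hq ρ))) (ih _)

section Harmonic

variable {i : S} {x ρ ρ' δ : ℝ} {q : JobState S} (hi : i ≠ J.fin) (hv : J.Valid (i, x))
  (hq : J.Valid q) (hρ : 0 ≤ ρ) (hδ : 0 ≤ δ)
include hi hv hρ hδ

/-- While the second job of a pair is served up to the level `ρ`, the remaining cost at levels `ρ' ≥ ρ`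
does not change on average: the slopes and the optimal and full costs are harmonic until the
giving-up age, the costs of both kinds decreasing by the same service time. -/
theorem levelRest_right (m : ℕ) (hρρ : ρ ≤ ρ') :
    (J.tail i x - J.tailAfter i x (J.giveUp i ρ x)) *
        (∑ j, J.trans i j * J.levelRest δ m ρ' q (j, 0)) +
      J.tailAfter i x (J.giveUp i ρ x) *
        J.levelRest δ m ρ' q (i, x + (J.giveUp i ρ x).toReal) =
      J.tail i x * J.levelRest δ m ρ' q (i, x) := by
  induction m generalizing ρ' with
  | zero =>
    have h1 := tail_mul_fullCost_eq hi (hv hi).1 (J.giveUp i ρ x)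
    have h2 := tail_mul_optCost_eq hi hρ hρρ (hv hi).1
    have h3 : ∑ j, J.trans i j * J.levelRest δ 0 ρ' q (j, 0) =
        (J.nextFullCost i - J.nextCost i ρ') * J.isPresent q := by
      rw [nextFullCost, nextCost, ← Finset.sum_sub_distrib, Finset.sum_mul]
      exact Finset.sum_congr rfl fun j _ => by rw [levelRest]; ring
    rw [h3, levelRest, levelRest]
    linear_combination (-J.isPresent q) * (h1 - h2)
  | succ m ih =>
    have h1 := ih (by linarith : ρ ≤ ρ' + δ)
    have h2 := tail_mul_slope_eq hi hρ hρρ (hv hi).1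
    have h3 : ∑ j, J.trans i j * J.levelRest δ (m + 1) ρ' q (j, 0) =
        δ * J.slope q ρ' * J.nextSlope i ρ' +
          ∑ j, J.trans i j * J.levelRest δ m (ρ' + δ) q (j, 0) := by
      rw [nextSlope, Finset.mul_sum, ← Finset.sum_add_distrib]
      exact Finset.sum_congr rfl fun j _ => by rw [levelRest]; ring
    rw [h3, levelRest, levelRest]
    linear_combination h1 - δ * J.slope q ρ' * h2

include hq in
/-- The analogue of `levelRest_right` for the first job.  Here the remaining cost can drop, since no
further waiting counts once this job has left. -/
theorem levelRest_left (m : ℕ) (hρρ : ρ ≤ ρ') :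
    (J.tail i x - J.tailAfter i x (J.giveUp i ρ x)) *
        (∑ j, J.trans i j * J.levelRest δ m ρ' (j, 0) q) +
      J.tailAfter i x (J.giveUp i ρ x) *
        J.levelRest δ m ρ' (i, x + (J.giveUp i ρ x).toReal) q ≤
      J.tail i x * J.levelRest δ m ρ' (i, x) q := by
  induction m generalizing ρ' with
  | zero =>
    have hc : 0 ≤ J.fullCost q - J.optCost q.1 q.2 ρ' := sub_nonneg.2 (optCost_le_fullCost hq ρ')
    have h3 : ∑ j, J.trans i j * J.levelRest δ 0 ρ' (j, 0) q ≤
        J.fullCost q - J.optCost q.1 q.2 ρ' := by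
      calc _ ≤ ∑ j, J.trans i j * (J.fullCost q - J.optCost q.1 q.2 ρ') :=
            Finset.sum_le_sum fun j _ => mul_le_mul_of_nonneg_left
              (mul_le_of_le_one_right hc (isPresent_le_one _)) (J.trans_nonneg _ _)
        _ = _ := by rw [← Finset.sum_mul, J.trans_sum, one_mul]
    have h4 := mul_le_mul_of_nonneg_left h3
      (sub_nonneg.2 (tailAfter_le hi (hv hi).1 (J.giveUp i ρ x)))
    rw [levelRest, levelRest, isPresent_of_ne hi, isPresent_of_ne hi]
    linarith
  | succ m ih =>
    have h1 := ih (by linarith : ρ ≤ ρ' + δ)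
    have h2 := congrArg (δ * J.slope q ρ' * ·) (tail_mul_slope_eq hi hρ hρρ (hv hi).1)
    have h3 : ∑ j, J.trans i j * J.levelRest δ (m + 1) ρ' (j, 0) q =
        δ * J.slope q ρ' * J.nextSlope i ρ' +
          ∑ j, J.trans i j * J.levelRest δ m (ρ' + δ) (j, 0) q := by
      rw [nextSlope, Finset.mul_sum, ← Finset.sum_add_distrib]
      exact Finset.sum_congr rfl fun j _ => by rw [levelRest]; ring
    rw [h3, levelRest, levelRest]
    simp only at h2
    linarith

end Harmonic

/-- A job has left, or has reached the level `ρ`. -/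
def Finished (J : JobType S) (ρ : ℝ) (p : JobState S) : Prop := p.1 = J.fin ∨ J.slope p ρ = 1

/-- Service up to the level `ρ`.  The optimal cost of a job that has reached it is `ρ`, which bounds that
of the other job of a pair, so that the cost bound permits to exchange the two roles. -/
theorem level_giveUp {δ ρ : ℝ} (hδ : 0 ≤ δ) (hρ : 0 ≤ ρ) (m : ℕ) :
    J.Level (fun i x => J.giveUp i ρ x) (fun p => J.optCost p.1 p.2 ρ) (J.levelRest δ m ρ)
      (J.Finished ρ) where
  measurable_age i := measurable_giveUp i ρ
  nonneg p hp := (retirementCost_optCost hp).nonneg hρ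
  service i x hi hv := (tail_mul_optCost_eq hi hρ le_rfl (hv hi).1).symm
  rest_nonneg p q hp hq := levelRest_nonneg hδ m ρ hp hq
  rest_left i x q hi hv hq := levelRest_left hi hv hq hρ hδ m le_rfl
  rest_right i x q hi hv hq := (levelRest_right hi hv hρ hδ m le_rfl).le
  finished i x hi hv hA := by
    obtain ⟨h1, h2⟩ := (tailAfter_giveUp_cases hi (hv hi).1).resolve_left hA
    exact ⟨h1, Or.inr h2⟩
  finished_fin p hp := Or.inl hp
  exchange p q hp hq hZ := by
    by_cases h1 : p.1 = J.fin
    · rw [isPresent_of_fin h1, optCost_of_fin h1 hρ, mul_zero, zero_mul]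
    have h2 := (retirementCost_optCost hp).eq_self_of_rightSlope_eq_one (hZ.resolve_left h1)
    rw [isPresent_of_ne h1, mul_one, h2]
    by_cases h3 : q.1 = J.fin
    · rw [isPresent_of_fin h3, optCost_of_fin h3 hρ, mul_zero]
    · rw [isPresent_of_ne h3, mul_one]
      exact (retirementCost_optCost hq).le_self ρ

/-- Service to completion after the last level. -/
theorem level_top : J.Level (fun _ _ => ⊤) J.fullCost (fun _ _ => 0) (fun p => p.1 = J.fin) where
  measurable_age i := measurable_const
  nonneg p _ := fullCost_nonneg p
  service i x hi hv := (tail_mul_fullCost_eq hi (hv hi).1 ⊤).symm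
  rest_nonneg _ _ _ _ := le_rfl
  rest_left _ _ _ _ _ _ := by simp
  rest_right _ _ _ _ _ _ := by simp
  finished i x hi hv hA := absurd (if_pos rfl) hA
  finished_fin _ hp := hp
  exchange p q _ _ hZ := by
    rw [isPresent_of_fin hZ, mul_zero]
    exact mul_nonneg (fullCost_nonneg p) (isPresent_nonneg q)

/-- The cost of serving the jobs along a grid of levels. -/
theorem costUpTo_levelPolicy_le {δ : ℝ} (hδ : 0 ≤ δ) (m : ℕ) : ∀ {ρ : ℝ}, 0 ≤ ρ →
    ∀ s : SysState S n, (∀ k, J.Valid (s k)) → ∀ M,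
      J.costUpTo (fun N => ((N - 1 : ℕ) : ℝ≥0∞)) 1 M s (J.levelPolicy δ m ρ s) ≤
        ENNReal.ofReal (J.levelCost (fun p => J.optCost p.1 p.2 ρ) (J.levelRest δ m ρ) n s) := by
  induction m with
  | zero =>
    intro ρ hρ s hs M
    refine (level_top.costUpTo_serveDown_le isStrategy_serveFirst (fun s hs hZ M => ?_) n le_rfl s
      hs (fun l hl => absurd l.2 (by omega)) M).trans (ENNReal.ofReal_le_ofReal (le_of_eq ?_))
    · rw [costUpTo_of_all_fin hZ (isStrategy_serveFirst.admissible s) (by simp)]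
      exact zero_le
    · refine Finset.sum_congr rfl fun j _ => Finset.sum_congr rfl fun l _ => ?_
      rw [levelPair, levelPair, if_pos l.2, if_pos l.2, levelRest]
      ring
  | succ m ih =>
    intro ρ hρ s hs M
    refine (level_giveUp hδ hρ (m + 1)).costUpTo_serveDown_le (isStrategy_levelPolicy δ m _)
      (fun s hs hZ M => ?_) n le_rfl s hs (fun l hl => absurd l.2 (by omega)) M
    refine (ih (add_nonneg hρ hδ) s hs M).trans (ENNReal.ofReal_le_ofReal ?_)
    refine Finset.sum_le_sum fun j _ => Finset.sum_le_sum fun l _ => ?_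
    rw [levelPair, levelPair, if_pos l.2, if_neg (Nat.not_lt_zero _), levelRest, ← add_assoc]
    refine add_le_add ?_ le_rfl
    have h0 : 0 ≤ δ * (J.slope (s j) ρ * J.slope (s l) ρ) :=
      mul_nonneg hδ (mul_nonneg (slope_nonneg (hs j) ρ) (slope_nonneg (hs l) ρ))
    have h1 : 0 ≤ J.optCost (s j).1 (s j).2 ρ * J.isPresent (s l) :=
      mul_nonneg ((retirementCost_optCost (hs j)).nonneg hρ) (isPresent_nonneg _)
    by_cases hj : (s j).1 = J.fin
    · rw [isPresent_of_fin hj, mul_zero]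
      exact add_nonneg h1 h0
    by_cases hl : (s l).1 = J.fin
    · rw [optCost_of_fin hl (add_nonneg hρ hδ), zero_mul]
      exact add_nonneg h1 h0
    -- both jobs have reached the level `ρ`: their optimal costs are `ρ`, and as both slopes are `1`,
    -- the term `δ` pays for the next level `ρ + δ`, which bounds the optimal cost there
    have hj1 := (hZ j).resolve_left hj
    have hl1 := (hZ l).resolve_left hl
    rw [isPresent_of_ne hj, isPresent_of_ne hl, hj1, hl1,
      (retirementCost_optCost (hs j)).eq_self_of_rightSlope_eq_one hj1]
    simpa using (retirementCost_optCost (hs l)).le_self (ρ + δ)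

/-- Comparison of the sum over a grid with an integral. -/
theorem levelRest_le {δ : ℝ} (hδ : 0 ≤ δ) (m : ℕ) {p q : JobState S} (hp : J.Valid p)
    (hq : J.Valid q) : ∀ {ρ : ℝ}, 0 ≤ ρ → J.levelRest δ m ρ p q ≤
      δ * (J.slope p ρ * J.slope q ρ) + (∫ r in Ioi ρ, J.slope p r * J.slope q r) +
        (J.fullCost q - J.optCost q.1 q.2 (ρ + m * δ)) := by
  have h0 : ∀ r, 0 ≤ J.slope p r * J.slope q r := fun r =>
    mul_nonneg (slope_nonneg hp r) (slope_nonneg hq r)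
  induction m with
  | zero =>
    intro ρ hρ
    have h1 : 0 ≤ ∫ r in Ioi ρ, J.slope p r * J.slope q r := integral_nonneg h0
    have h2 := mul_le_of_le_one_right (sub_nonneg.2 (optCost_le_fullCost hq ρ))
      (isPresent_le_one (J := J) p)
    rw [levelRest]
    simp only [Nat.cast_zero, zero_mul, add_zero]
    linarith [mul_nonneg hδ (h0 ρ)]
  | succ m ih =>
    intro ρ hρ
    have hint := integrableOn_slope_mul hp hq
    have hanti : ∀ r ∈ Icc ρ (ρ + δ), J.slope p (ρ + δ) * J.slope q (ρ + δ) ≤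
        J.slope p r * J.slope q r := fun r hr =>
      mul_le_mul ((retirementCost_optCost hp).antitone_rightSlope hr.2)
        ((retirementCost_optCost hq).antitone_rightSlope hr.2) (slope_nonneg hq _)
        (slope_nonneg hp _)
    have h1 := ih (add_nonneg hρ hδ)
    have h2 := intervalIntegral.integral_interval_add_Ioi
      (hint.mono_set (Ioi_subset_Ioi hρ)) (hint.mono_set (Ioi_subset_Ioi (add_nonneg hρ hδ)))
    have h3 : δ * (J.slope p (ρ + δ) * J.slope q (ρ + δ)) ≤
        ∫ r in ρ..ρ + δ, J.slope p r * J.slope q r := by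
      have h4 := intervalIntegral.integral_mono_on (μ := volume) (le_add_of_nonneg_right hδ)
        (intervalIntegrable_const (a := ρ) (b := ρ + δ)) ?_ hanti
      · rw [intervalIntegral.integral_const, add_sub_cancel_left, smul_eq_mul] at h4
        exact h4
      · rw [intervalIntegrable_iff_integrableOn_Ioc_of_le (by linarith)]
        exact hint.mono_set fun r hr => lt_of_le_of_lt hρ hr.1
    have h5 : ρ + δ + m * δ = ρ + (m + 1 : ℕ) * δ := by push_cast; ring
    rw [levelRest, ← h5]
    linarith

theorem costP_le {s : SysState S n} (hs : ∀ k, J.Valid (s k)) {δ : ℝ} (hδ : 0 ≤ δ) (m : ℕ) :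
    J.costP s ≤ ENNReal.ofReal (∑ j, ∑ l ∈ Finset.Ioi j, (δ + J.pairCost (s j) (s l) +
      (J.fullCost (s l) - J.optCost (s l).1 (s l).2 (m * δ)))) := by
  refine iInf₂_le_of_le (J.levelPolicy δ m 0 s) ((isStrategy_levelPolicy δ m 0).admissible s) ?_
  refine iInf_le_of_le (fun e t τ k => congrFun (bypass_levelPolicy δ m 0 s e t τ) k) ?_
  refine iSup_le fun M => (costUpTo_levelPolicy_le hδ m le_rfl s hs M).trans
    (ENNReal.ofReal_le_ofReal ?_)
  refine Finset.sum_le_sum fun j _ => Finset.sum_le_sum fun l _ => ?_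
  have h1 := levelRest_le hδ m (hs j) (hs l) le_rfl
  have h2 : δ * (J.slope (s j) 0 * J.slope (s l) 0) ≤ δ :=
    mul_le_of_le_one_right hδ (mul_le_one₀ (slope_le_one (hs j) 0) (slope_nonneg (hs l) 0)
      (slope_le_one (hs l) 0))
  rw [levelPair, if_pos l.2, (retirementCost_optCost (hs l)).eq_self 0 le_rfl, zero_mul, zero_add]
  rw [zero_add] at h1
  refine h1.trans (add_le_add (add_le_add h2 le_rfl) le_rfl)

/-- The minimal cost of serving the jobs is the sum of the pairwise costs. -/
theorem costP_eq {s : SysState S n} (hs : ∀ k, J.Valid (s k)) :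
    J.costP s = ENNReal.ofReal (J.totalCost s) := by
  refine le_antisymm ?_ ?_
  · have hlim : Tendsto (fun N : ℕ => ENNReal.ofReal (∑ j, ∑ l ∈ Finset.Ioi j,
        (1 / ((N : ℝ) + 1) + J.pairCost (s j) (s l) + (J.fullCost (s l) -
          J.optCost (s l).1 (s l).2 ((N : ℝ) + 1))))) atTop
        (𝓝 (ENNReal.ofReal (∑ j, ∑ l ∈ Finset.Ioi j, (0 + J.pairCost (s j) (s l) +
          (J.fullCost (s l) - J.fullCost (s l)))))) := by
      refine ENNReal.tendsto_ofReal (tendsto_finsetSum _ fun j _ => tendsto_finsetSum _ fun l _ => ?_)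
      refine (tendsto_one_div_add_atTop_nhds_zero_nat.add_const _).add
        (tendsto_const_nhds.sub ((tendsto_optCost _ _ (hs l)).comp ?_))
      exact tendsto_atTop_add_const_right _ _ tendsto_natCast_atTop_atTop
    simp only [zero_add, sub_self, add_zero] at hlim
    -- `(N + 1)²` levels at distance `1 / (N + 1)` cover the rewards up to `N + 1`
    refine ge_of_tendsto' hlim fun N => ?_
    have h := costP_le hs (δ := 1 / ((N : ℝ) + 1)) (by positivity) ((N + 1) * (N + 1))
    have h1 : (((N + 1) * (N + 1) : ℕ) : ℝ) * (1 / ((N : ℝ) + 1)) = (N : ℝ) + 1 := by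
      push_cast; field_simp
    rwa [h1] at h
  · refine le_iInf₂ fun π hπ => le_iInf fun hb => ?_
    refine le_trans ?_ (le_iSup _ (∑ k, J.rank (s k).1))
    exact ofReal_totalCost_le_costUpTo _ s π hs hπ hb le_rfl

end JobType
end Multistage
end

noncomputable section

namespace Multistage

open Filter Topology
open scoped NNReal

theorem frequently_nhdsGT_of_ae {Q : ℝ → Prop} (h : ∀ᵐ r ∂(volume.restrict (Ioi (0 : ℝ))), Q r)
    {a : ℝ} (ha : 0 ≤ a) : ∃ᶠ r in 𝓝[>] a, Q r := by
  intro hcon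
  obtain ⟨b, hb, hsub⟩ := mem_nhdsGT_iff_exists_Ioo_subset.1 hcon
  have h1 := (ae_restrict_iff' measurableSet_Ioi).1 h
  have h2 : volume (Ioo a b) = 0 := by
    refine measure_mono_null (fun r hr => ?_) h1
    exact fun hQ => hsub hr (hQ (lt_of_le_of_lt ha hr.1))
  rw [Real.volume_Ioo, ENNReal.ofReal_eq_zero] at h2
  have : a < b := hb
  linarith

namespace JobType

/-! ### The derivative of the cost of a single job, and the prevailing index -/

variable {S : Type*} [Fintype S] [DecidableEq S] {J : JobType S} {p q : JobState S}

theorem singleCostA_eq (hp : J.Valid p) {r : ℝ} (hr : 0 < r) :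
    J.singleCostA p r = J.optCost p.1 p.2 r := by
  rw [singleCostA, costA_eq hr hp, ENNReal.toReal_ofReal ((retirementCost_optCost hp).nonneg hr.le)]

theorem singleCostA_eventuallyEq (hp : J.Valid p) {r : ℝ} (hr : 0 < r) :
    J.singleCostA p =ᶠ[𝓝 r] J.optCost p.1 p.2 := by
  filter_upwards [Ioi_mem_nhds hr] with r' hr' using singleCostA_eq hp hr'

theorem ae_differentiableAt_singleCostA (hp : J.Valid p) :
    ∀ᵐ r ∂(volume.restrict (Ioi (0 : ℝ))), DifferentiableAt ℝ (J.singleCostA p) r := by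
  filter_upwards [ae_restrict_of_ae (retirementCost_optCost hp).mono.ae_differentiableAt,
    ae_restrict_mem measurableSet_Ioi] with r h hr
  exact (singleCostA_eventuallyEq hp hr).differentiableAt_iff.2 h

theorem deriv_singleCostA (hp : J.Valid p) {r : ℝ} (hr : 0 < r)
    (h : DifferentiableAt ℝ (J.singleCostA p) r) : deriv (J.singleCostA p) r = J.slope p r := by
  have he := singleCostA_eventuallyEq hp hr
  rw [he.deriv_eq, slope, rightSlope_eq_deriv (he.differentiableAt_iff.1 h)]

theorem deriv_singleCostA_ae (hp : J.Valid p) :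
    ∀ᵐ r ∂(volume.restrict (Ioi (0 : ℝ))), deriv (J.singleCostA p) r = J.slope p r := by
  filter_upwards [ae_differentiableAt_singleCostA hp, ae_restrict_mem measurableSet_Ioi] with r h hr
  exact deriv_singleCostA hp hr h

theorem deriv_mul_deriv_ae (hp : J.Valid p) (hq : J.Valid q) :
    (fun r => deriv (J.singleCostA p) r * deriv (J.singleCostA q) r)
      =ᵐ[volume.restrict (Ioi (0 : ℝ))] fun r => J.slope p r * J.slope q r := by
  filter_upwards [deriv_singleCostA_ae hp, deriv_singleCostA_ae hq] with r h1 h2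
  rw [h1, h2]

theorem integral_deriv_mul_deriv (hp : J.Valid p) (hq : J.Valid q) :
    ∫ r in Ioi (0 : ℝ), deriv (J.singleCostA p) r * deriv (J.singleCostA q) r =
      J.pairCost p q := integral_congr_ae (deriv_mul_deriv_ae hp hq)

theorem isPrevailingLaw_law (hp : J.Valid p) :
    J.IsPrevailingLaw p (retirementCost_optCost hp).law where
  isProbabilityMeasure := (retirementCost_optCost hp).isProbabilityMeasure_law
  nonneg := (retirementCost_optCost hp).law_nonneg
  tail_eq r hr h := by
    rw [deriv_singleCostA hp hr h]
    exact (retirementCost_optCost hp).law_Ioi r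

/-- The defining property of the prevailing index, known for almost every level only, extends to all
levels by right continuity. -/
theorem IsPrevailingLaw.cdf_eq {μ : Measure ℝ} (hp : J.Valid p) (h : J.IsPrevailingLaw p μ)
    (r : ℝ) : cdf μ r = 1 - J.slope p r := by
  have := h.isProbabilityMeasure
  have hreal : ∀ a, cdf μ a = 1 - μ.real (Ioi a) := fun a => by
    rw [cdf_eq_real, ← compl_Ioi, probReal_compl_eq_one_sub measurableSet_Ioi]
  rcases lt_or_ge r 0 with hr | hr
  · have h1 : μ (Iic r) = 0 := by
      refine measure_mono_null (fun x hx => ?_) h.nonneg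
      have : x ≤ r := hx
      simp only [mem_compl_iff, mem_ofPred_eq]
      linarith
    rw [cdf_eq_real, Measure.real, h1, slope, (retirementCost_optCost hp).rightSlope_of_neg hr]
    simp
  · have hc1 : Tendsto (cdf μ) (𝓝[>] r) (𝓝 (cdf μ r)) :=
      ((cdf μ).right_continuous r).mono_left (nhdsWithin_mono r Ioi_subset_Ici_self)
    have hc2 : Tendsto (fun r => 1 - J.slope p r) (𝓝[>] r) (𝓝 (1 - J.slope p r)) :=
      tendsto_const_nhds.sub
        (((retirementCost_optCost hp).rightContinuous_rightSlope r).mono_left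
          (nhdsWithin_mono r Ioi_subset_Ici_self))
    refine tendsto_nhds_unique_of_frequently_eq hc1 hc2 (frequently_nhdsGT_of_ae ?_ hr)
    filter_upwards [ae_differentiableAt_singleCostA hp, ae_restrict_mem measurableSet_Ioi]
      with a ha ha0
    rw [hreal, Measure.real, h.tail_eq a ha0 ha, deriv_singleCostA hp ha0 ha,
      ENNReal.toReal_ofReal (slope_nonneg hp a)]

theorem IsPrevailingLaw.measure_Ioi {μ : Measure ℝ} (hp : J.Valid p) (h : J.IsPrevailingLaw p μ)
    (r : ℝ) : μ (Ioi r) = ENNReal.ofReal (J.slope p r) := by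
  have := h.isProbabilityMeasure
  have h1 := h.cdf_eq hp r
  rw [cdf_eq_real, ← compl_Ioi, probReal_compl_eq_one_sub measurableSet_Ioi] at h1
  rw [← ENNReal.ofReal_toReal (measure_ne_top μ (Ioi r))]
  congr 1
  change μ.real (Ioi r) = _
  linarith

theorem existsUnique_isPrevailingLaw (hp : J.Valid p) : ∃! μ : Measure ℝ, J.IsPrevailingLaw p μ := by
  refine ⟨_, isPrevailingLaw_law hp, fun μ hμ => ?_⟩
  have := hμ.isProbabilityMeasure
  have := (isPrevailingLaw_law hp).isProbabilityMeasure
  refine Measure.eq_of_cdf _ _ (StieltjesFunction.ext fun r => ?_)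
  rw [hμ.cdf_eq hp, (isPrevailingLaw_law hp).cdf_eq hp]

/-- The pairwise cost is the expected minimum of independent prevailing indices. -/
theorem pairCost_eq_integral_min (hp : J.Valid p) (hq : J.Valid q) {Ω : Type*} [MeasurableSpace Ω]
    {P : Measure Ω} {X Y : Ω → ℝ} (hX : AEMeasurable X P) (hY : AEMeasurable Y P)
    (hXY : IndepFun X Y P) (hpX : J.IsPrevailingLaw p (P.map X))
    (hqY : J.IsPrevailingLaw q (P.map Y)) :
    Integrable (fun ω => min (X ω) (Y ω)) P ∧ J.pairCost p q = ∫ ω, min (X ω) (Y ω) ∂P := by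
  have hnn : 0 ≤ᵐ[P] fun ω => min (X ω) (Y ω) := by
    filter_upwards [ae_of_ae_map hX hpX.nonneg, ae_of_ae_map hY hqY.nonneg] with ω h1 h2
      using le_min h1 h2
  have hm : AEMeasurable (fun ω => min (X ω) (Y ω)) P := hX.min hY
  have hmeas : ∀ t, P {ω | t < min (X ω) (Y ω)} =
      ENNReal.ofReal (J.slope p t * J.slope q t) := by
    intro t
    have h1 : {ω | t < min (X ω) (Y ω)} = X ⁻¹' Ioi t ∩ Y ⁻¹' Ioi t := by
      ext ω; simp
    rw [h1, hXY.measure_inter_preimage_eq_mul _ _ measurableSet_Ioi measurableSet_Ioi,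
      ENNReal.ofReal_mul (slope_nonneg hp t), ← hpX.measure_Ioi hp, ← hqY.measure_Ioi hq,
      Measure.map_apply_of_aemeasurable hX measurableSet_Ioi,
      Measure.map_apply_of_aemeasurable hY measurableSet_Ioi]
  have hlin : ∫⁻ ω, ENNReal.ofReal (min (X ω) (Y ω)) ∂P = ENNReal.ofReal (J.pairCost p q) := by
    rw [lintegral_eq_lintegral_meas_lt P hnn hm, pairCost,
      ofReal_integral_eq_lintegral_ofReal (integrableOn_slope_mul hp hq)
        (ae_of_all _ fun r => mul_nonneg (slope_nonneg hp r) (slope_nonneg hq r))]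
    exact lintegral_congr fun t => hmeas t
  refine ⟨⟨hm.aestronglyMeasurable, ?_⟩, ?_⟩
  · rw [hasFiniteIntegral_iff_ofReal hnn, hlin]
    exact ENNReal.ofReal_lt_top
  · rw [integral_eq_lintegral_of_nonneg_ae hnn hm.aestronglyMeasurable, hlin,
      ENNReal.toReal_ofReal (pairCost_nonneg hp hq)]

end JobType
end Multistage
end

theorem mainTheorem6 {S : Type*} [Fintype S] [DecidableEq S] (J : Multistage.JobType S) :
    -- the BPOP A cost of a single job is `r - V_p(r)`
    (∀ p : Multistage.JobState S, J.Valid p → ∀ r : ℝ, 0 < r →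
      J.costA r (fun _ : Fin 1 => p) = ENNReal.ofReal (r - J.profit p r)) ∧
    -- its derivative in `r` exists almost everywhere
    (∀ p : Multistage.JobState S, J.Valid p →
      ∀ᵐ r ∂(volume.restrict (Ioi (0 : ℝ))), DifferentiableAt ℝ (J.singleCostA p) r) ∧
    -- the cost function of BPOP P
    (∀ (n : ℕ) (s : Multistage.SysState S n), (∀ k, J.Valid (s k)) →
      (∀ k l, k < l → IntegrableOn
        (fun r => deriv (J.singleCostA (s k)) r * deriv (J.singleCostA (s l)) r) (Ioi 0)) ∧
      J.costP s = ENNReal.ofReal (∑ k, ∑ l ∈ Finset.Ioi k,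
        ∫ r in Ioi (0 : ℝ), deriv (J.singleCostA (s k)) r * deriv (J.singleCostA (s l)) r)) ∧
    -- prevailing indices are well defined
    (∀ p : Multistage.JobState S, J.Valid p → ∃! μ : Measure ℝ, J.IsPrevailingLaw p μ) ∧
    -- the pairwise term is the expected minimum of two independent prevailing indices
    (∀ p q : Multistage.JobState S, J.Valid p → J.Valid q →
      ∀ (Ω : Type*) [MeasurableSpace Ω] (P : Measure Ω) [IsProbabilityMeasure P] (X Y : Ω → ℝ),
        AEMeasurable X P → AEMeasurable Y P → IndepFun X Y P →
        J.IsPrevailingLaw p (P.map X) → J.IsPrevailingLaw q (P.map Y) →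
        Integrable (fun ω => min (X ω) (Y ω)) P ∧
        ∫ r in Ioi (0 : ℝ), deriv (J.singleCostA p) r * deriv (J.singleCostA q) r =
          ∫ ω, min (X ω) (Y ω) ∂P) := by
  refine ⟨fun p hp r hr => ?_, fun p hp => Multistage.JobType.ae_differentiableAt_singleCostA hp,
    fun n s hs => ⟨fun k l _ => ?_, ?_⟩,
    fun p hp => Multistage.JobType.existsUnique_isPrevailingLaw hp,
    fun p q hp hq Ω _ P _ X Y hX hY hXY hpX hqY => ?_⟩
  · rw [Multistage.JobType.costA_eq hr hp, Multistage.JobType.profit_eq hp hr.le, sub_sub_cancel]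
  · exact (Multistage.JobType.integrableOn_slope_mul (hs k) (hs l)).congr
      (Multistage.JobType.deriv_mul_deriv_ae (hs k) (hs l)).symm
  · rw [Multistage.JobType.costP_eq hs, Multistage.JobType.totalCost]
    congr 1
    exact Finset.sum_congr rfl fun k _ => Finset.sum_congr rfl fun l _ =>
      (Multistage.JobType.integral_deriv_mul_deriv (hs k) (hs l)).symm
  · rw [Multistage.JobType.integral_deriv_mul_deriv hp hq]
    exact Multistage.JobType.pairCost_eq_integral_min hp hq hX hY hXY hpX hqY
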